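/- Let $\rho\in(0,1)$. For $n\ge 2$ let $\Lambda_n=\{1,\dots,n-1\}$ and $\Omega_n=\{0,1\}^{\Lambda_n}$. For $\eta\in\Omega_n$ let $\eta^{x,y}$ be obtained from $\eta$ by exchanging the values at $x$ and $y$, and $\eta^x$ by replacing $\eta(x)$ with $1-\eta(x)$. The symmetric simple exclusion process (SSEP) with reservoirs of density $\rho$, in diffusive time scale, is the continuous-time Markov chain $(\eta_t)_{t\ge0}$ on $\Omega_n$ with generator \[ L_nf(\eta)=n^2\sum_{x=1}^{n-2}\big(f(\eta^{x,x+1})-f(\eta)\big)+n^2\sum_{x\in\{1,n-1\}}\big(\rho(1-\eta(x))+(1-\rho)\eta(x)\big)\big(f(\eta^x)-f(\eta)\big), \] where $\{1,n-1\}$ is read as a set (a single site if $n=2$). For $u:\Lambda_n\to[0,1]$ let $\nu^n_{u}$ be the Bernoulli product measure on $\Omega_n$ with $\nu^n_u(\eta(x)=1)=u(x)$, and let $\bar\nu^n_\rho$ be the one with $u\equiv\rho$. Let $u_0:[0,1]\to(0,1)$ be differentiable with bounded derivative, and assume $u_0(0)=u_0(1)=\rho$. For $\ell\in\mathbb N=\{1,2,\dots\}$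 put \[ c_\ell(u_0)=\sqrt2\int_0^1(u_0(x)-\rho)\sin(\pi\ell x)\,dx . \] Assume that $u_0\not\equiv\rho$, and let $\ell_0\ge1$ be the smallest integer such that $c_{\ell_0}(u_0)\ne0$. Let $\mu^n_t$ be the law of $\eta_t$ when $\eta_0$ has law $\nu^n_{u_0^n}$, $u_0^n(x)=u_0(x/n)$, and let \[ D_n(t)=\|\mu^n_t-\bar\nu^n_\rho\|_{TV},\qquad \|\mu-\nu\|_{TV}=\sup_A|\mu(A)-\nu(A)| . \] Let $\mathcal G(m)=\|\mathcal N(m,1)-\mathcal N(0,1)\|_{TV}$ for $m\in\mathbb R$. Then for every $b\in\mathbb R$, \[ \lim_{n\to\infty}D_n\big(t^n(b)\big)=\mathcal G(\gamma e^{-b}), \] where \[ t^n(b)=\frac{\log n}{2\pi^2\ell_0^2}+\frac{b}{\pi^2\ell_0^2}\quad\text{(which is nonnegative for all large }n\text{)},\qquad \gamma=\frac{|c_{\ell_0}(u_0)|}{\sqrt{\rho(1-\rho)}} . \] -/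

import Mathlib

open Set Filter Topology MeasureTheory ProbabilityTheory

noncomputable section

namespace SSEP

/-- The bulk `Λ_n = {1, …, n-1}`. -/
abbrev Site (n : ℕ) : Type := ↥(Finset.Ico 1 n)

/-- Configurations of particles `Ω_n = {0,1}^{Λ_n}`; `true` means occupied. -/
abbrev Config (n : ℕ) : Type := Site n → Bool

/-- The occupation number `η(x) ∈ {0,1}` as a real number. -/
def occ {n : ℕ} (η : Config n) (x : Site n) : ℝ := if η x then 1 else 0

/-- `η^{x,y}`: the contents of `x` and `y` are exchanged. -/
def exchange {n : ℕ} (x y : Site n) (η : Config n) : Config n :=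
  fun z => η (Equiv.swap x y z)

/-- `η^x`: the content of `x` is flipped. -/
def flip {n : ℕ} (x : Site n) (η : Config n) : Config n :=
  Function.update η x (!(η x))

/-- The (diffusively accelerated) generator of SSEP on `{1, …, n-1}` with reservoirs of density
`ρ`: exchanges across the edges `{x, x+1}` and flips at the boundary sites `{1, n-1}` with rate
`ρ` (creation) and `1 - ρ` (annihilation), everything multiplied by `n²`. -/
def generator (n : ℕ) (ρ : ℝ) (f : Config n → ℝ) (η : Config n) : ℝ :=
  (n : ℝ) ^ 2 * (∑ x : Site n, ∑ y : Site n,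
    if (y : ℕ) = (x : ℕ) + 1 then f (exchange x y η) - f η else 0)
  + (n : ℝ) ^ 2 * (∑ x : Site n,
    if (x : ℕ) = 1 ∨ (x : ℕ) = n - 1 then
      (ρ * (1 - occ η x) + (1 - ρ) * occ η x) * (f (flip x η) - f η) else 0)

/-- The matrix of jump rates: the entry `(η, ζ)` is the generator applied to the indicator of
`ζ`, evaluated at `η`. -/
def rateMatrix (n : ℕ) (ρ : ℝ) : Matrix (Config n) (Config n) ℝ :=
  Matrix.of fun η ζ => generator n ρ (Pi.single ζ 1) η

/-- The transition probabilities `P_t(η, ζ) = P(η_t = ζ | η_0 = η)` of the continuous-time Markov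
chain on the finite space `Ω_n` with the above generator: `P_t = e^{t L}`. -/
def transition (n : ℕ) (ρ t : ℝ) : Matrix (Config n) (Config n) ℝ :=
  NormedSpace.exp (t • rateMatrix n ρ)

/-- The Bernoulli product weights with density `u : Λ_n → [0,1]`. -/
def bernoulliWeight {n : ℕ} (u : Site n → ℝ) (η : Config n) : ℝ :=
  ∏ x : Site n, (occ η x * u x + (1 - occ η x) * (1 - u x))

/-- The weights of the law of `η_t` when `η_0` has the Bernoulli product law with density `u`. -/
def lawWeight (n : ℕ) (ρ : ℝ) (u : Site n → ℝ) (t : ℝ) (ζ : Config n) : ℝ :=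
  ∑ η : Config n, bernoulliWeight u η * transition n ρ t η ζ

/-- The measure on a finite set with given (nonnegative) point masses. -/
def ofWeight {α : Type*} [Fintype α] [MeasurableSpace α] (w : α → ℝ) : Measure α :=
  ∑ a : α, ENNReal.ofReal (w a) • Measure.dirac a

/-- The total variation distance of two probability measures,
`sup_A |μ(A) - ν(A)|` over measurable `A`. -/
def tvDist {α : Type*} [MeasurableSpace α] (μ ν : Measure α) : ℝ :=
  ⨆ A : {A : Set α // MeasurableSet A}, |μ.real A - ν.real A|

/-- The discretization `u^n(x) = u(x/n)` of a profile `u` on `[0,1]`. -/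
def discretize (n : ℕ) (u : ℝ → ℝ) (x : Site n) : ℝ := u ((x : ℕ) / (n : ℝ))

/-- The distance to equilibrium at time `t ≥ 0` of SSEP started from the profile measure
of `u₀`. -/
def distEq (n : ℕ) (ρ : ℝ) (u₀ : ℝ → ℝ) (t : ℝ) : ℝ :=
  tvDist (ofWeight (lawWeight n ρ (discretize n u₀) t))
    (ofWeight (bernoulliWeight fun _ : Site n => ρ))

/-- The sine-Fourier coefficient `c_ℓ(u₀)` of `u₀ - ρ`. -/
def fourierCoeff (ρ : ℝ) (u₀ : ℝ → ℝ) (ℓ : ℕ) : ℝ :=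
  √2 * ∫ x in (0 : ℝ)..1, (u₀ x - ρ) * Real.sin (Real.pi * ℓ * x)

/-- The Gaussian profile `G(m)`: total variation distance between `N(m,1)` and `N(0,1)`. -/
def gaussianProfile (m : ℝ) : ℝ := tvDist (gaussianReal m 1) (gaussianReal 0 1)

/-- The time `t^n(b) = log n / (2π²ℓ²) + b / (π²ℓ²)`. -/
def cutoffTime (ℓ n : ℕ) (b : ℝ) : ℝ :=
  1 / (2 * Real.pi ^ 2 * (ℓ : ℝ) ^ 2) * Real.log n + b / (Real.pi ^ 2 * (ℓ : ℝ) ^ 2)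

end SSEP

end

/-! The law at time t is compared with the Bernoulli product measure whose density u_t = ρ +
`heatSolution` solves the discrete heat equation with reservoirs. The total variation distance
between that product measure and equilibrium is then computed asymptotically.

Comparison. Let κ_t(S) be the expectation of the product over S of the occupation numbers centred at
u_t. Because the centring follows the heat equation, the κ_t satisfy a closed linear system
(`hasDerivAt_correlation`). Its main part is an exclusion dynamics of |S| dual particles, killed at
the reservoirs. The sources sit only on sets containing both ends of an edge; they involve κ_t at
one or two particles fewer, with coefficients g and g^2, where g is the gradient of u_t across the
edge and n^2 g^2 ≤ G e^{-t} (`sq_heatSolution_gradient_le`). The dissipation in the k-particle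
sector is at least of order k (`sum_card_mul_sq_le`). It absorbs the sources and also pays for an
exponentially growing base a in the energy ∑ a^|S| κ_t(S)^2, which therefore stays bounded uniformly
in n (`energy_le`). With a fixed base A, the part over nonempty S then decays exponentially in t
(`sum_correlation_sq_le`). By Parseval and Cauchy–Schwarz this controls the total variation error
(`sum_abs_sub_bernoulliWeight_sq_le`, `abs_distEq_sub_tvDist_le`), which vanishes because the cutoff
time tends to infinity.

Product measures. At the cutoff time √n (u_t - ρ) is uniformly close to √2 c e^{-b} sin(πℓ₀x/n):
mode ℓ₀ has size e^{-b}/√n, higher modes are smaller, and lower modes have discrete coefficients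
O(1/n). Hence u_t - ρ tends to 0 uniformly and its squares sum to (c e^{-b})^2 in the limit
(`tendsto_heatSolution_cutoffTime`). The log-likelihood ratio with respect to equilibrium is a sum
of independent small terms. Its characteristic function converges to that of N(-m²/2, m²), m² = c²
e^{-2b}/(ρ(1-ρ)), the law of the log-likelihood ratio of N(m,1) to N(0,1). Total variation is the
expectation of the bounded continuous function max(1 - e^y, 0) of this ratio, so it converges to the
Gaussian profile (`tendsto_tvDist_bernoulli`). -/

namespace SSEP

/-! ### Exchanges acting on finite sets of sites -/

section SwapSet

variable {V : Type*} [DecidableEq V]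

/-- The set obtained from `S` by exchanging the contents of `x` and `y`. -/
def swapSet (x y : V) (S : Finset V) : Finset V := S.map (Equiv.swap x y).toEmbedding

theorem mem_swapSet {x y z : V} {S : Finset V} : z ∈ swapSet x y S ↔ Equiv.swap x y z ∈ S := by
  unfold swapSet
  rw [Finset.mem_map_equiv, Equiv.symm_swap]

@[simp] theorem card_swapSet (x y : V) (S : Finset V) : (swapSet x y S).card = S.card :=
  Finset.card_map _

@[simp] theorem swapSet_swapSet (x y : V) (S : Finset V) : swapSet x y (swapSet x y S) = S := by
  ext z; simp [mem_swapSet]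

theorem mem_swapSet_left {x y : V} {S : Finset V} : x ∈ swapSet x y S ↔ y ∈ S := by
  simp [mem_swapSet]

theorem mem_swapSet_right {x y : V} {S : Finset V} : y ∈ swapSet x y S ↔ x ∈ S := by
  simp [mem_swapSet]

theorem mem_swapSet_of_ne {x y z : V} {S : Finset V} (hx : z ≠ x) (hy : z ≠ y) :
    z ∈ swapSet x y S ↔ z ∈ S := by
  rw [mem_swapSet, Equiv.swap_apply_of_ne_of_ne hx hy]

theorem swapSet_of_mem_of_mem {x y : V} {S : Finset V} (hx : x ∈ S) (hy : y ∈ S) :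
    swapSet x y S = S := by
  ext z
  rcases eq_or_ne z x with rfl | h1
  · simp [mem_swapSet_left, hx, hy]
  rcases eq_or_ne z y with rfl | h2
  · simp [mem_swapSet_right, hx, hy]
  · exact mem_swapSet_of_ne h1 h2

theorem swapSet_of_notMem_of_notMem {x y : V} {S : Finset V} (hx : x ∉ S) (hy : y ∉ S) :
    swapSet x y S = S := by
  ext z
  rcases eq_or_ne z x with rfl | h1
  · simp [mem_swapSet_left, hx, hy]
  rcases eq_or_ne z y with rfl | h2
  · simp [mem_swapSet_right, hx, hy]
  · exact mem_swapSet_of_ne h1 h2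

theorem swapSet_erase {x y : V} {S : Finset V} (hxy : x ≠ y) (hx : x ∈ S) (hy : y ∈ S) :
    swapSet x y (S.erase x) = S.erase y := by
  ext z
  rcases eq_or_ne z x with rfl | h1
  · simp [mem_swapSet_left, hx, hy, hxy, hxy.symm]
  rcases eq_or_ne z y with rfl | h2
  · simp [mem_swapSet_right, hx, hy]
  · simp [mem_swapSet_of_ne h1 h2, h1, h2]

/-- Exchanging the contents of two sites as a permutation of the finite sets of sites. -/
def swapSetEquiv (x y : V) : Finset V ≃ Finset V where
  toFun := swapSet x y
  invFun := swapSet x y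
  left_inv := swapSet_swapSet x y
  right_inv := swapSet_swapSet x y

variable [Fintype V]

theorem sum_swapSet {M : Type*} [AddCommMonoid M] (x y : V) (f : Finset V → M) :
    ∑ S, f (swapSet x y S) = ∑ S, f S :=
  Equiv.sum_comp (swapSetEquiv x y) f

/-- Summation by parts: an exchange is an involution preserving the number of particles, so any
weight depending on that number alone is reversible. -/
theorem sum_mul_swapSet_sub (x y : V) (w : ℕ → ℝ) (κ : Finset V → ℝ) :
    ∑ S, w S.card * κ S * (κ (swapSet x y S) - κ S)
      = -(1 / 2) * ∑ S, w S.card * (κ (swapSet x y S) - κ S) ^ 2 := by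
  have h := sum_swapSet x y (fun S => w S.card * κ S ^ 2)
  simp only [card_swapSet] at h
  have h2 : ∑ S, w S.card * (κ (swapSet x y S) - κ S) ^ 2
      = ∑ S, w S.card * κ (swapSet x y S) ^ 2 + ∑ S, w S.card * κ S ^ 2
        - 2 * ∑ S, w S.card * κ S * κ (swapSet x y S) := by
    rw [Finset.mul_sum, ← Finset.sum_add_distrib, ← Finset.sum_sub_distrib]
    exact Finset.sum_congr rfl fun S _ => by ring
  have h3 : ∑ S, w S.card * κ S * (κ (swapSet x y S) - κ S)
      = ∑ S, w S.card * κ S * κ (swapSet x y S) - ∑ S, w S.card * κ S ^ 2 := by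
    rw [← Finset.sum_sub_distrib]
    exact Finset.sum_congr rfl fun S _ => by ring
  rw [h3, h2, h]; ring

/-- Removing x and removing y give two sets that differ by the exchange, so this source term is an
exchange gradient one level below and can be absorbed by the Dirichlet form. The factor a pays for
the lost particle. -/
theorem sum_erase_sub_erase_le {x y : V} (hxy : x ≠ y) {a : ℝ} (ha : 0 < a)
    (κ : Finset V → ℝ) :
    ∑ S : Finset V with x ∈ S ∧ y ∈ S, a ^ S.card * (κ (S.erase x) - κ (S.erase y)) ^ 2
      ≤ a * ∑ S, a ^ S.card * (κ (swapSet x y S) - κ S) ^ 2 := by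
  rw [Finset.mul_sum]
  have hinj : Set.InjOn (fun S : Finset V => S.erase x)
      ((Finset.univ.filter fun S : Finset V => x ∈ S ∧ y ∈ S : Finset (Finset V)) :
        Set (Finset V)) := by
    intro S hS T hT h
    simp only [Finset.coe_filter, Finset.mem_univ, true_and, Set.mem_ofPred_eq] at hS hT
    rw [← Finset.insert_erase hS.1, ← Finset.insert_erase hT.1]
    exact congrArg _ h
  calc _ = ∑ S : Finset V with x ∈ S ∧ y ∈ S, a * (a ^ (S.erase x).card
            * (κ (swapSet x y (S.erase x)) - κ (S.erase x)) ^ 2) := by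
        refine Finset.sum_congr rfl fun S hS => ?_
        simp only [Finset.mem_filter, Finset.mem_univ, true_and] at hS
        rw [swapSet_erase hxy hS.1 hS.2, ← Finset.card_erase_add_one hS.1, pow_succ]
        ring
    _ = ∑ T ∈ (Finset.univ.filter fun S : Finset V => x ∈ S ∧ y ∈ S).image
          (fun S : Finset V => S.erase x),
          a * (a ^ T.card * (κ (swapSet x y T) - κ T) ^ 2) :=
        (Finset.sum_image (f := fun T : Finset V =>
          a * (a ^ T.card * (κ (swapSet x y T) - κ T) ^ 2)) hinj).symm
    _ ≤ _ := Finset.sum_le_sum_of_subset_of_nonneg (Finset.subset_univ _)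
        fun S _ _ => by positivity

theorem sum_erase_erase_le {x y : V} (hxy : x ≠ y) {a : ℝ} (ha : 0 < a) (κ : Finset V → ℝ) :
    ∑ S : Finset V with x ∈ S ∧ y ∈ S, (S.card : ℝ) * a ^ S.card * κ ((S.erase x).erase y) ^ 2
      ≤ a ^ 2 * ∑ S, ((S.card : ℝ) + 2) * a ^ S.card * κ S ^ 2 := by
  rw [Finset.mul_sum]
  have hinj : Set.InjOn (fun S : Finset V => (S.erase x).erase y)
      ((Finset.univ.filter fun S : Finset V => x ∈ S ∧ y ∈ S : Finset (Finset V)) :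
        Set (Finset V)) := by
    intro S hS T hT h
    simp only [Finset.coe_filter, Finset.mem_univ, true_and, Set.mem_ofPred_eq] at hS hT
    have hS' : y ∈ S.erase x := Finset.mem_erase.2 ⟨hxy.symm, hS.2⟩
    have hT' : y ∈ T.erase x := Finset.mem_erase.2 ⟨hxy.symm, hT.2⟩
    rw [← Finset.insert_erase hS.1, ← Finset.insert_erase hT.1, ← Finset.insert_erase hS',
      ← Finset.insert_erase hT']
    exact congrArg (fun U => insert x (insert y U)) h
  calc _ = ∑ S : Finset V with x ∈ S ∧ y ∈ S, a ^ 2 * (((((S.erase x).erase y).card : ℝ) + 2)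
            * a ^ ((S.erase x).erase y).card * κ ((S.erase x).erase y) ^ 2) := by
        refine Finset.sum_congr rfl fun S hS => ?_
        simp only [Finset.mem_filter, Finset.mem_univ, true_and] at hS
        have hS' : y ∈ S.erase x := Finset.mem_erase.2 ⟨hxy.symm, hS.2⟩
        rw [← Finset.card_erase_add_one hS.1, ← Finset.card_erase_add_one hS']
        push_cast
        ring
    _ = ∑ T ∈ (Finset.univ.filter fun S : Finset V => x ∈ S ∧ y ∈ S).image
          (fun S : Finset V => (S.erase x).erase y),
          a ^ 2 * (((T.card : ℝ) + 2) * a ^ T.card * κ T ^ 2) :=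
        (Finset.sum_image (f := fun T : Finset V =>
          a ^ 2 * (((T.card : ℝ) + 2) * a ^ T.card * κ T ^ 2)) hinj).symm
    _ ≤ _ := Finset.sum_le_sum_of_subset_of_nonneg (Finset.subset_univ _)
        fun S _ _ => by positivity

end SwapSet

/-! ### Dirichlet forms of the dual dynamics: Poincaré and trace inequalities -/

/-- The edges `{x, x+1}` of the bulk. -/
def edges (n : ℕ) : Finset (Site n × Site n) :=
  Finset.univ.filter fun e => (e.2 : ℕ) = (e.1 : ℕ) + 1

/-- The sites in contact with a reservoir. -/
def boundary (n : ℕ) : Finset (Site n) :=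
  Finset.univ.filter fun x => (x : ℕ) = 1 ∨ (x : ℕ) = n - 1

theorem mem_edges {n : ℕ} {e : Site n × Site n} : e ∈ edges n ↔ (e.2 : ℕ) = (e.1 : ℕ) + 1 := by
  simp [edges]

theorem ne_of_mem_edges {n : ℕ} {e : Site n × Site n} (he : e ∈ edges n) : e.1 ≠ e.2 := by
  intro h
  have := mem_edges.1 he
  rw [h] at this
  omega

theorem mem_boundary {n : ℕ} {x : Site n} : x ∈ boundary n ↔ (x : ℕ) = 1 ∨ (x : ℕ) = n - 1 := by
  simp [boundary]

/-- A particle at `x` can be carried to the left reservoir by `x` nearest-neighbour moves. -/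
theorem sum_mem_sq_le_path {n : ℕ} (κ : Finset (Site n) → ℝ) (m : ℕ) :
    ∀ (W : Finset (Site n) → ℝ) (_ : ∀ S, 0 ≤ W S) (x : Site n) (_ : (x : ℕ) = m)
      (_ : ∀ e ∈ edges n, (e.2 : ℕ) ≤ x → ∀ S, W (swapSet e.1 e.2 S) = W S),
      ∑ S : Finset (Site n) with x ∈ S, W S * κ S ^ 2
        ≤ m * (∑ e ∈ edges n with (e.2 : ℕ) ≤ x, ∑ S, W S * (κ (swapSet e.1 e.2 S) - κ S) ^ 2
          + ∑ S, W S * ((S ∩ boundary n).card : ℝ) * κ S ^ 2) := by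
  induction m with
  | zero =>
    intro W _ x hx _
    have := Finset.mem_Ico.1 x.2
    omega
  | succ m ih =>
    intro W hW x hx hinv
    have hxr := Finset.mem_Ico.1 x.2
    set Bd := ∑ S, W S * ((S ∩ boundary n).card : ℝ) * κ S ^ 2 with hBd
    have hBd0 : 0 ≤ Bd := Finset.sum_nonneg fun S _ => by have := hW S; positivity
    rcases Nat.eq_zero_or_pos m with rfl | hm
    · have h1 : ∑ S : Finset (Site n) with x ∈ S, W S * κ S ^ 2 ≤ Bd := by
        rw [Finset.sum_filter]
        refine Finset.sum_le_sum fun S _ => ?_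
        have hWS := hW S
        split_ifs with h
        · have : 1 ≤ (S ∩ boundary n).card :=
            Finset.card_pos.2 ⟨x, Finset.mem_inter.2 ⟨h, mem_boundary.2 (Or.inl (by omega))⟩⟩
          have h' : (1 : ℝ) ≤ (S ∩ boundary n).card := by exact_mod_cast this
          have := mul_nonneg hWS (sq_nonneg (κ S))
          nlinarith
        · positivity
      have h2 : 0 ≤ ∑ e ∈ edges n with (e.2 : ℕ) ≤ x,
          ∑ S, W S * (κ (swapSet e.1 e.2 S) - κ S) ^ 2 :=
        Finset.sum_nonneg fun e _ => Finset.sum_nonneg fun S _ => by have := hW S; positivity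
      push_cast
      linarith
    · let y : Site n := ⟨m, Finset.mem_Ico.2 ⟨hm, by omega⟩⟩
      have hy : (y : ℕ) = m := rfl
      have he : (y, x) ∈ edges n := mem_edges.2 (by simp [hx, hy])
      have hinvy : ∀ S, W (swapSet y x S) = W S := hinv _ he le_rfl
      have hI := ih W hW y rfl fun e he' hle => hinv e he' (by omega)
      have hfilter : (edges n).filter (fun e => (e.2 : ℕ) ≤ x)
          = insert (y, x) ((edges n).filter fun e => (e.2 : ℕ) ≤ y) := by
        ext e
        simp only [Finset.mem_filter, Finset.mem_insert]
        constructor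
        · rintro ⟨h1, h2⟩
          rcases Nat.lt_or_ge (y : ℕ) (e.2 : ℕ) with h3 | h3
          · left
            have := mem_edges.1 h1
            refine Prod.ext (Subtype.ext ?_) (Subtype.ext ?_) <;> simp only <;> omega
          · exact Or.inr ⟨h1, h3⟩
        · rintro (rfl | ⟨h1, h2⟩)
          · exact ⟨he, le_rfl⟩
          · exact ⟨h1, by omega⟩
      have hnot : (y, x) ∉ (edges n).filter fun e => (e.2 : ℕ) ≤ y := by
        simp only [Finset.mem_filter, not_and, not_le]
        intro _; omega
      rw [hfilter, Finset.sum_insert hnot]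
      set A := ∑ e ∈ edges n with (e.2 : ℕ) ≤ y, ∑ S, W S * (κ (swapSet e.1 e.2 S) - κ S) ^ 2
      set d := ∑ S, W S * (κ (swapSet y x S) - κ S) ^ 2 with hd
      have hm' : (0 : ℝ) < m := by exact_mod_cast hm
      have hshift : ∑ S : Finset (Site n) with x ∈ S, W S * κ (swapSet y x S) ^ 2 = ∑ S : Finset (Site n) with y ∈ S, W S * κ S ^ 2 := by
        rw [Finset.sum_filter, Finset.sum_filter,
          ← sum_swapSet y x fun S => if y ∈ S then W S * κ S ^ 2 else 0]
        refine Finset.sum_congr rfl fun S _ => ?_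
        simp only [mem_swapSet_left, hinvy]
      have hdle : ∑ S : Finset (Site n) with x ∈ S, W S * (κ (swapSet y x S) - κ S) ^ 2 ≤ d := by
        refine Finset.sum_le_sum_of_subset_of_nonneg (Finset.filter_subset _ _) fun S _ _ => ?_
        have := hW S; positivity
      -- Young's inequality with parameter 1/m, chosen because (1 + 1/m) m = m + 1: the constant in
      -- front of the form grows exactly by one at each step of the path.
      have hpt : ∑ S : Finset (Site n) with x ∈ S, W S * κ S ^ 2
          ≤ (1 + 1 / (m : ℝ)) * ∑ S : Finset (Site n) with x ∈ S, W S * κ (swapSet y x S) ^ 2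
            + (1 + (m : ℝ)) * ∑ S : Finset (Site n) with x ∈ S, W S * (κ (swapSet y x S) - κ S) ^ 2 := by
        rw [Finset.mul_sum, Finset.mul_sum, ← Finset.sum_add_distrib]
        refine Finset.sum_le_sum fun S _ => ?_
        have hkey : κ S ^ 2 ≤ (1 + 1 / (m : ℝ)) * κ (swapSet y x S) ^ 2
            + (1 + (m : ℝ)) * (κ (swapSet y x S) - κ S) ^ 2 := by
          have : (1 + 1 / (m : ℝ)) * κ (swapSet y x S) ^ 2
            + (1 + (m : ℝ)) * (κ (swapSet y x S) - κ S) ^ 2 - κ S ^ 2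
            = 1 / m * (κ (swapSet y x S) + m * (κ (swapSet y x S) - κ S)) ^ 2 := by
            field_simp; ring
          have h2 : 0 ≤ 1 / (m : ℝ) * (κ (swapSet y x S) + m * (κ (swapSet y x S) - κ S)) ^ 2 := by
            positivity
          linarith
        nlinarith [mul_le_mul_of_nonneg_left hkey (hW S)]
      rw [hshift] at hpt
      have h3 : (1 + 1 / (m : ℝ)) * ∑ S : Finset (Site n) with y ∈ S, W S * κ S ^ 2
          ≤ (1 + 1 / (m : ℝ)) * (m * (A + Bd)) := mul_le_mul_of_nonneg_left hI (by positivity)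
      have h4 : (1 + 1 / (m : ℝ)) * (m * (A + Bd)) = (m + 1) * (A + Bd) := by field_simp
      have h5 := mul_le_mul_of_nonneg_left hdle (by positivity : (0 : ℝ) ≤ 1 + m)
      push_cast
      linarith

/-- The Dirichlet form of the exchange part of the dual dynamics, with weights depending on the
number of particles. -/
noncomputable def exchangeForm (n : ℕ) (w : ℕ → ℝ) (κ : Finset (Site n) → ℝ) : ℝ :=
  ∑ e ∈ edges n, ∑ S, w S.card * (κ (swapSet e.1 e.2 S) - κ S) ^ 2

/-- The Dirichlet form of the absorption at the boundary of the dual dynamics. -/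
noncomputable def boundaryForm (n : ℕ) (w : ℕ → ℝ) (κ : Finset (Site n) → ℝ) : ℝ :=
  ∑ S, w S.card * ((S ∩ boundary n).card : ℝ) * κ S ^ 2

theorem exchangeForm_nonneg {n : ℕ} {w : ℕ → ℝ} (hw : ∀ k, 0 ≤ w k) (κ : Finset (Site n) → ℝ) :
    0 ≤ exchangeForm n w κ :=
  Finset.sum_nonneg fun e _ => Finset.sum_nonneg fun S _ => by have := hw S.card; positivity

theorem boundaryForm_nonneg {n : ℕ} {w : ℕ → ℝ} (hw : ∀ k, 0 ≤ w k) (κ : Finset (Site n) → ℝ) :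
    0 ≤ boundaryForm n w κ :=
  Finset.sum_nonneg fun S _ => by have := hw S.card; positivity

theorem exchangeForm_mono {n : ℕ} {v w : ℕ → ℝ} (h : ∀ k, v k ≤ w k) (κ : Finset (Site n) → ℝ) :
    exchangeForm n v κ ≤ exchangeForm n w κ :=
  Finset.sum_le_sum fun _ _ => Finset.sum_le_sum fun _ _ =>
    mul_le_mul_of_nonneg_right (h _) (sq_nonneg _)

theorem boundaryForm_mono {n : ℕ} {v w : ℕ → ℝ} (h : ∀ k, v k ≤ w k) (κ : Finset (Site n) → ℝ) :
    boundaryForm n v κ ≤ boundaryForm n w κ :=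
  Finset.sum_le_sum fun _ _ =>
    mul_le_mul_of_nonneg_right (mul_le_mul_of_nonneg_right (h _) (Nat.cast_nonneg _)) (sq_nonneg _)

theorem card_site_le (n : ℕ) : (Fintype.card (Site n) : ℝ) ≤ n := by
  have : Fintype.card (Site n) ≤ n := by simp
  exact_mod_cast this

theorem card_mul_eq_sum {V : Type*} [Fintype V] [DecidableEq V] (S : Finset V) (c : ℝ) :
    (S.card : ℝ) * c = ∑ x : V, if x ∈ S then c else 0 := by
  rw [Finset.sum_ite_mem, Finset.univ_inter, Finset.sum_const, nsmul_eq_mul]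

/-- Poincaré inequality for the dual dynamics: the gap in the `k`-particle sector is at least of
order `k`. -/
theorem sum_card_mul_sq_le {n : ℕ} {w : ℕ → ℝ} (hw : ∀ k, 0 ≤ w k) (κ : Finset (Site n) → ℝ) :
    ∑ S, (S.card : ℝ) * (w S.card * κ S ^ 2)
      ≤ (n : ℝ) ^ 2 * (exchangeForm n w κ + boundaryForm n w κ) := by
  have hD := exchangeForm_nonneg hw κ
  have hB := boundaryForm_nonneg hw κ
  have hx : ∀ x : Site n, ∑ S : Finset (Site n) with x ∈ S, w S.card * κ S ^ 2
      ≤ n * (exchangeForm n w κ + boundaryForm n w κ) := by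
    intro x
    refine (sum_mem_sq_le_path κ x (fun S => w S.card) (fun S => hw _) x rfl
      (fun e _ _ S => by simp)).trans ?_
    have hxn : ((x : ℕ) : ℝ) ≤ n := by exact_mod_cast (Finset.mem_Ico.1 x.2).2.le
    refine mul_le_mul hxn (add_le_add ?_ le_rfl) ?_ (Nat.cast_nonneg _)
    · exact Finset.sum_le_sum_of_subset_of_nonneg (Finset.filter_subset _ _) fun e _ _ =>
        Finset.sum_nonneg fun S _ => by have := hw S.card; positivity
    · exact add_nonneg (Finset.sum_nonneg fun e _ =>
        Finset.sum_nonneg fun S _ => by have := hw S.card; positivity) hB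
  calc ∑ S, (S.card : ℝ) * (w S.card * κ S ^ 2)
      = ∑ x : Site n, ∑ S : Finset (Site n) with x ∈ S, w S.card * κ S ^ 2 := by
        simp_rw [card_mul_eq_sum, Finset.sum_filter]
        exact Finset.sum_comm
    _ ≤ ∑ x : Site n, n * (exchangeForm n w κ + boundaryForm n w κ) :=
        Finset.sum_le_sum fun x _ => hx x
    _ = Fintype.card (Site n) * (n * (exchangeForm n w κ + boundaryForm n w κ)) := by
        rw [Finset.sum_const, nsmul_eq_mul, Finset.card_univ]
    _ ≤ n * (n * (exchangeForm n w κ + boundaryForm n w κ)) :=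
        mul_le_mul_of_nonneg_right (card_site_le n) (by positivity)
    _ = _ := by ring

theorem sum_edges_le_sum_site {n : ℕ} {f : Site n → ℝ} (hf : ∀ x, 0 ≤ f x) :
    ∑ e ∈ edges n, f e.2 ≤ ∑ x, f x := by
  have hinj : Set.InjOn (fun e : Site n × Site n => e.2) (edges n : Set (Site n × Site n)) := by
    intro e he e' he' h
    have h1 := mem_edges.1 (Finset.mem_coe.1 he)
    have h2 := mem_edges.1 (Finset.mem_coe.1 he')
    have h' : e.2 = e'.2 := h
    refine Prod.ext (Subtype.ext ?_) h'
    rw [h'] at h1; omega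
  rw [← Finset.sum_image (f := f) hinj]
  exact Finset.sum_le_sum_of_subset_of_nonneg (Finset.subset_univ _) fun x _ _ => hf x

/-- Trace inequality: the mass on configurations with two given neighbouring particles, summed
over all edges, is controlled by the Dirichlet form. -/
theorem sum_edges_pair_sq_le {n : ℕ} {w : ℕ → ℝ} (hw : ∀ k, 0 ≤ w k)
    (κ : Finset (Site n) → ℝ) :
    ∑ e ∈ edges n, ∑ S : Finset (Site n) with e.1 ∈ S ∧ e.2 ∈ S, w S.card * κ S ^ 2
      ≤ n * (exchangeForm n (fun k => k * w k) κ + boundaryForm n (fun k => k * w k) κ) := by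
  -- The weight marks a particle at z. The path carrying the left end of an edge to the reservoir
  -- avoids the right end z, so the mark is invariant along it. Summing over z turns the marks into
  -- the factor |S|.
  let W : Site n → Finset (Site n) → ℝ := fun z S => if z ∈ S then w S.card else 0
  have hW : ∀ z S, 0 ≤ W z S := fun z S => by
    simp only [W]; split_ifs
    · exact hw _
    · exact le_rfl
  let A : Site n → ℝ := fun z =>
    ∑ e ∈ edges n, ∑ S, W z S * (κ (swapSet e.1 e.2 S) - κ S) ^ 2
      + ∑ S, W z S * ((S ∩ boundary n).card : ℝ) * κ S ^ 2
  have hA : ∀ z, 0 ≤ A z := fun z => add_nonneg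
    (Finset.sum_nonneg fun e _ => Finset.sum_nonneg fun S _ => mul_nonneg (hW z S) (sq_nonneg _))
    (Finset.sum_nonneg fun S _ => mul_nonneg (mul_nonneg (hW z S) (Nat.cast_nonneg _))
      (sq_nonneg _))
  have he : ∀ e ∈ edges n, ∑ S : Finset (Site n) with e.1 ∈ S ∧ e.2 ∈ S, w S.card * κ S ^ 2
      ≤ n * A e.2 := by
    intro e he
    have h1 : ∑ S : Finset (Site n) with e.1 ∈ S ∧ e.2 ∈ S, w S.card * κ S ^ 2
        = ∑ S : Finset (Site n) with e.1 ∈ S, W e.2 S * κ S ^ 2 := by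
      rw [Finset.sum_filter, Finset.sum_filter]
      refine Finset.sum_congr rfl fun S _ => ?_
      by_cases h1 : e.1 ∈ S <;> by_cases h2 : e.2 ∈ S <;> simp [W, h1, h2]
    rw [h1]
    have hee := mem_edges.1 he
    refine (sum_mem_sq_le_path κ e.1 (W e.2) (hW e.2) e.1 rfl ?_).trans ?_
    · intro e' he' hle S
      have h1 := mem_edges.1 he'
      have : e.2 ∈ swapSet e'.1 e'.2 S ↔ e.2 ∈ S := by
        apply mem_swapSet_of_ne <;> intro h <;> rw [h] at hee <;> omega
      simp [W, this]
    · have hxn : ((e.1 : ℕ) : ℝ) ≤ n := by exact_mod_cast (Finset.mem_Ico.1 e.1.2).2.le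
      refine mul_le_mul hxn (add_le_add ?_ le_rfl) ?_ (Nat.cast_nonneg _)
      · exact Finset.sum_le_sum_of_subset_of_nonneg (Finset.filter_subset _ _) fun e _ _ =>
          Finset.sum_nonneg fun S _ => mul_nonneg (hW _ S) (sq_nonneg _)
      · exact add_nonneg (Finset.sum_nonneg fun e _ =>
          Finset.sum_nonneg fun S _ => mul_nonneg (hW _ S) (sq_nonneg _))
          (Finset.sum_nonneg fun S _ => mul_nonneg (mul_nonneg (hW _ S) (Nat.cast_nonneg _))
            (sq_nonneg _))
  have hsumA : ∑ z, A z
      = exchangeForm n (fun k => k * w k) κ + boundaryForm n (fun k => k * w k) κ := by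
    have hWs : ∀ S : Finset (Site n), ∑ z, W z S = S.card * w S.card := fun S =>
      (card_mul_eq_sum S _).symm
    simp only [A]
    rw [Finset.sum_add_distrib]
    congr 1
    · rw [Finset.sum_comm]
      refine Finset.sum_congr rfl fun e _ => ?_
      rw [Finset.sum_comm]
      refine Finset.sum_congr rfl fun S _ => ?_
      rw [← Finset.sum_mul, hWs]
    · rw [Finset.sum_comm]
      refine Finset.sum_congr rfl fun S _ => ?_
      rw [← Finset.sum_mul, ← Finset.sum_mul, hWs]
  calc _ ≤ ∑ e ∈ edges n, n * A e.2 := Finset.sum_le_sum he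
    _ = n * ∑ e ∈ edges n, A e.2 := by rw [Finset.mul_sum]
    _ ≤ n * ∑ z, A z :=
        mul_le_mul_of_nonneg_left (sum_edges_le_sum_site hA) (Nat.cast_nonneg _)
    _ = _ := by rw [hsumA]

/-- Each edge is charged to its right end. No Dirichlet form is spent, so where this bound is used
the smallness has to come from the base a. -/
theorem sum_edges_pair_sq_le_card {n : ℕ} {w : ℕ → ℝ} (hw : ∀ k, 0 ≤ w k)
    (κ : Finset (Site n) → ℝ) :
    ∑ e ∈ edges n, ∑ S : Finset (Site n) with e.1 ∈ S ∧ e.2 ∈ S, w S.card * κ S ^ 2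
      ≤ ∑ S, (S.card : ℝ) * (w S.card * κ S ^ 2) := by
  have h0 : ∀ S : Finset (Site n), 0 ≤ w S.card * κ S ^ 2 := fun S =>
    mul_nonneg (hw _) (sq_nonneg _)
  calc _ ≤ ∑ e ∈ edges n, ∑ S : Finset (Site n) with e.2 ∈ S, w S.card * κ S ^ 2 := by
        refine Finset.sum_le_sum fun e _ => Finset.sum_le_sum_of_subset_of_nonneg ?_ fun S _ _ => h0 S
        intro S hS
        simp only [Finset.mem_filter] at hS ⊢
        exact ⟨hS.1, hS.2.2⟩
    _ ≤ ∑ z : Site n, ∑ S : Finset (Site n) with z ∈ S, w S.card * κ S ^ 2 :=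
        sum_edges_le_sum_site (f := fun z => ∑ S : Finset (Site n) with z ∈ S, w S.card * κ S ^ 2)
          fun z => Finset.sum_nonneg fun S _ => h0 S
    _ = _ := by
        simp_rw [card_mul_eq_sum, Finset.sum_filter]
        exact Finset.sum_comm

theorem card_edges_le (n : ℕ) : ((edges n).card : ℝ) ≤ n := by
  have h := sum_edges_le_sum_site (n := n) (f := fun _ => (1 : ℝ)) fun _ => zero_le_one
  simp only [Finset.sum_const, nsmul_eq_mul, mul_one, Finset.card_univ] at h
  exact h.trans (card_site_le n)

/-! ### Energy estimate for the correlation hierarchy -/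

/-- The time derivative of the correlation functions `κ` of the exclusion process, centred at a
solution of the discrete heat equation with gradients `g`. -/
noncomputable def correlationDrift (n : ℕ) (g : Site n × Site n → ℝ) (κ : Finset (Site n) → ℝ)
    (S : Finset (Site n)) : ℝ :=
  (n : ℝ) ^ 2 * ∑ e ∈ edges n, (κ (swapSet e.1 e.2 S) - κ S
    - if e.1 ∈ S ∧ e.2 ∈ S then g e ^ 2 * κ ((S.erase e.1).erase e.2)
        + 2 * g e * (κ (S.erase e.1) - κ (S.erase e.2)) else 0)
    - (n : ℝ) ^ 2 * (((S ∩ boundary n).card : ℝ) * κ S)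

/-- Two Young inequalities, written as completed squares. The term linear in g is split so that its
gradient part costs a quarter of the exchange form. The term in g^2 is split with weight νn/|S|: the
1/|S| compensates the |S| produced by the trace inequality, and the 1/(νn) on the other side
compensates the number of edges. -/
theorem edge_energy_le {n : ℕ} (hn : 0 < n) {a ν : ℝ} (ha : 0 < a) (hν : 0 < ν) (g : ℝ)
    (κ : Finset (Site n) → ℝ) {x y : Site n} (hxy : x ≠ y) :
    2 * ∑ S, a ^ S.card * κ S * (κ (swapSet x y S) - κ S
      - if x ∈ S ∧ y ∈ S then g ^ 2 * κ ((S.erase x).erase y)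
        + 2 * g * (κ (S.erase x) - κ (S.erase y)) else 0)
    ≤ -(3 / 4) * ∑ S, a ^ S.card * (κ (swapSet x y S) - κ S) ^ 2
      + g ^ 2 * (16 * a * ∑ S : Finset (Site n) with x ∈ S ∧ y ∈ S, a ^ S.card * κ S ^ 2
        + ν * n * ∑ S : Finset (Site n) with x ∈ S ∧ y ∈ S, a ^ S.card / S.card * κ S ^ 2
        + a ^ 2 / (ν * n) * ∑ S : Finset (Site n), ((S.card : ℝ) + 2) * a ^ S.card * κ S ^ 2) := by
  have hn' : (0 : ℝ) < n := by exact_mod_cast hn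
  have h1 := sum_mul_swapSet_sub x y (fun k => a ^ k) κ
  have h2 := sum_erase_sub_erase_le hxy ha κ
  have h3 := sum_erase_erase_le hxy ha κ
  have hsplit : ∑ S, a ^ S.card * κ S * (κ (swapSet x y S) - κ S
      - if x ∈ S ∧ y ∈ S then g ^ 2 * κ ((S.erase x).erase y)
        + 2 * g * (κ (S.erase x) - κ (S.erase y)) else 0)
      = ∑ S, a ^ S.card * κ S * (κ (swapSet x y S) - κ S)
        - ∑ S : Finset (Site n) with x ∈ S ∧ y ∈ S, a ^ S.card * κ S
          * (g ^ 2 * κ ((S.erase x).erase y) + 2 * g * (κ (S.erase x) - κ (S.erase y))) := by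
    rw [Finset.sum_filter, ← Finset.sum_sub_distrib]
    refine Finset.sum_congr rfl fun S _ => ?_
    split_ifs <;> ring
  have hpt : -2 * ∑ S : Finset (Site n) with x ∈ S ∧ y ∈ S, a ^ S.card * κ S
          * (g ^ 2 * κ ((S.erase x).erase y) + 2 * g * (κ (S.erase x) - κ (S.erase y)))
      ≤ ∑ S : Finset (Site n) with x ∈ S ∧ y ∈ S,
          (1 / (4 * a) * (a ^ S.card * (κ (S.erase x) - κ (S.erase y)) ^ 2)
          + g ^ 2 * (16 * a) * (a ^ S.card * κ S ^ 2)
          + g ^ 2 * (ν * n) * (a ^ S.card / S.card * κ S ^ 2)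
          + g ^ 2 / (ν * n) * (S.card * a ^ S.card * κ ((S.erase x).erase y) ^ 2)) := by
    rw [Finset.mul_sum]
    refine Finset.sum_le_sum fun S hS => ?_
    simp only [Finset.mem_filter, Finset.mem_univ, true_and] at hS
    have hk : (0 : ℝ) < S.card := by exact_mod_cast Finset.card_pos.2 ⟨x, hS.1⟩
    set k : ℝ := (S.card : ℝ)
    set A := a ^ S.card with hA
    have hA0 : 0 < A := by positivity
    set d := κ (S.erase x) - κ (S.erase y)
    set q := κ ((S.erase x).erase y)
    set c := κ S
    have e1 : 1 / (4 * a) * (A * d ^ 2) + g ^ 2 * (16 * a) * (A * c ^ 2) + A * (4 * g * c * d)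
        = A / (4 * a) * (d + 8 * a * g * c) ^ 2 := by
      field_simp; ring
    have e2 : g ^ 2 * (ν * n) * (A / k * c ^ 2) + g ^ 2 / (ν * n) * (k * A * q ^ 2)
        + A * (2 * g ^ 2 * c * q) = A * g ^ 2 * (ν * n / k) * (c + k / (ν * n) * q) ^ 2 := by
      field_simp; ring
    have p1 : 0 ≤ A / (4 * a) * (d + 8 * a * g * c) ^ 2 := by positivity
    have p2 : 0 ≤ A * g ^ 2 * (ν * n / k) * (c + k / (ν * n) * q) ^ 2 := by positivity
    nlinarith [p1, p2, e1, e2]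
  rw [Finset.sum_add_distrib, Finset.sum_add_distrib, Finset.sum_add_distrib, ← Finset.mul_sum,
    ← Finset.mul_sum, ← Finset.mul_sum, ← Finset.mul_sum] at hpt
  rw [hsplit]
  have h2' := mul_le_mul_of_nonneg_left h2 (by positivity : 0 ≤ 1 / (4 * a))
  have h3' := mul_le_mul_of_nonneg_left h3 (by positivity : 0 ≤ g ^ 2 / (ν * n))
  have e4 : 1 / (4 * a) * (a * ∑ S, a ^ S.card * (κ (swapSet x y S) - κ S) ^ 2)
      = 1 / 4 * ∑ S, a ^ S.card * (κ (swapSet x y S) - κ S) ^ 2 := by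
    field_simp
  rw [e4] at h2'
  have e5 : g ^ 2 / (ν * n) * (a ^ 2 * ∑ S : Finset (Site n), ((S.card : ℝ) + 2) * a ^ S.card * κ S ^ 2)
    = g ^ 2 * (a ^ 2 / (ν * n) * ∑ S : Finset (Site n), ((S.card : ℝ) + 2) * a ^ S.card * κ S ^ 2) := by
    ring
  rw [e5] at h3'
  linarith

theorem sum_card_add_two_le {V : Type*} [Fintype V] [DecidableEq V] {a : ℝ} (ha : 0 < a)
    (κ : Finset V → ℝ) :
    ∑ S : Finset V, ((S.card : ℝ) + 2) * a ^ S.card * κ S ^ 2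
      ≤ 3 * ∑ S : Finset V, (S.card : ℝ) * (a ^ S.card * κ S ^ 2) + 2 * κ ∅ ^ 2 := by
  have h : 2 * κ ∅ ^ 2 = ∑ S : Finset V, if S = ∅ then 2 * κ ∅ ^ 2 else 0 := by simp
  rw [h, Finset.mul_sum, ← Finset.sum_add_distrib]
  refine Finset.sum_le_sum fun S _ => ?_
  split_ifs with hS
  · subst hS; simp
  · have : (1 : ℝ) ≤ S.card := by
      exact_mod_cast Finset.card_pos.2 (Finset.nonempty_iff_ne_empty.2 hS)
    have h2 : 0 ≤ a ^ S.card * κ S ^ 2 := by positivity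
    nlinarith

-- Balance of dissipation: of n^2 times the exchange form, one quarter goes to the sources linear in
-- g and one quarter to the trace inequality. At least half of n^2 times the full form remains, and
-- the Poincaré inequality turns it into -(1/2) ∑ |S| a^|S| κ(S)^2. What is left of the sources is
-- small with a, apart from the forcing by the empty set.
set_option maxHeartbeats 400000 in
theorem energy_drift_le {n : ℕ} (hn : 0 < n) {a ν G : ℝ} (ha : 0 < a) (hν : 0 < ν)
    (g : Site n × Site n → ℝ) (hg : ∀ e ∈ edges n, (n : ℝ) ^ 2 * g e ^ 2 ≤ G)
    (hG : 0 ≤ G) (hνG : ν * G ≤ 1 / 4) (κ : Finset (Site n) → ℝ) :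
    2 * ∑ S, a ^ S.card * κ S * correlationDrift n g κ S
      ≤ (-(1 / 2) + 16 * a * G + 3 * a ^ 2 * G / ν)
          * ∑ S, (S.card : ℝ) * (a ^ S.card * κ S ^ 2)
        + 2 * a ^ 2 * G / ν * κ ∅ ^ 2 := by
  have hn' : (0 : ℝ) < n := by exact_mod_cast hn
  have hw : ∀ k : ℕ, 0 ≤ a ^ k := fun k => by positivity
  have hcancel : ∀ M : ℝ, (n : ℝ) * (a ^ 2 / (ν * n) * M) = a ^ 2 / ν * M := fun M => by
    field_simp
  have hw' : ∀ k : ℕ, 0 ≤ a ^ k / k := fun k => by positivity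
  set N := ∑ S : Finset (Site n), (S.card : ℝ) * (a ^ S.card * κ S ^ 2) with hN
  set D := exchangeForm n (fun k => a ^ k) κ with hD
  set B := boundaryForm n (fun k => a ^ k) κ with hB
  have hD0 : 0 ≤ D := exchangeForm_nonneg hw κ
  have hB0 : 0 ≤ B := boundaryForm_nonneg hw κ
  have hN0 : 0 ≤ N := Finset.sum_nonneg fun S _ => by positivity
  have hP : N ≤ (n : ℝ) ^ 2 * (D + B) := sum_card_mul_sq_le hw κ
  have hT : ∑ e ∈ edges n, ∑ S : Finset (Site n) with e.1 ∈ S ∧ e.2 ∈ S,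
      a ^ S.card / S.card * κ S ^ 2 ≤ n * (D + B) := by
    refine (sum_edges_pair_sq_le hw' κ).trans ?_
    -- Only an inequality: at k = 0 division by zero makes the left side 0.
    have hle : ∀ k : ℕ, (k : ℝ) * (a ^ k / k) ≤ a ^ k := by
      intro k
      rcases Nat.eq_zero_or_pos k with rfl | hk
      · simp
      · have : (0 : ℝ) < k := by exact_mod_cast hk
        rw [mul_div_cancel₀ _ this.ne']
    exact mul_le_mul_of_nonneg_left
      (add_le_add (exchangeForm_mono hle κ) (boundaryForm_mono hle κ)) hn'.le
  have hQ : ∑ e ∈ edges n, ∑ S : Finset (Site n) with e.1 ∈ S ∧ e.2 ∈ S,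
      a ^ S.card * κ S ^ 2 ≤ N := sum_edges_pair_sq_le_card hw κ
  set M := ∑ S : Finset (Site n), ((S.card : ℝ) + 2) * a ^ S.card * κ S ^ 2 with hM
  have hM0 : 0 ≤ M := Finset.sum_nonneg fun S _ => by positivity
  have hMN : M ≤ 3 * N + 2 * κ ∅ ^ 2 := sum_card_add_two_le ha κ
  have hexp : 2 * ∑ S, a ^ S.card * κ S * correlationDrift n g κ S
      = (n : ℝ) ^ 2 * ∑ e ∈ edges n, (2 * ∑ S, a ^ S.card * κ S * (κ (swapSet e.1 e.2 S) - κ S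
      - if e.1 ∈ S ∧ e.2 ∈ S then g e ^ 2 * κ ((S.erase e.1).erase e.2)
        + 2 * g e * (κ (S.erase e.1) - κ (S.erase e.2)) else 0)) - 2 * (n : ℝ) ^ 2 * B := by
    rw [← Finset.mul_sum, Finset.sum_comm, hB, boundaryForm, Finset.mul_sum, Finset.mul_sum,
      Finset.mul_sum, Finset.mul_sum, ← Finset.sum_sub_distrib]
    refine Finset.sum_congr rfl fun S _ => ?_
    rw [← Finset.mul_sum, correlationDrift]
    ring
  rw [hexp, ← Finset.mul_sum]
  have hedge : ∀ e ∈ edges n, (n : ℝ) ^ 2 * (2 * ∑ S, a ^ S.card * κ S * (κ (swapSet e.1 e.2 S) - κ S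
      - if e.1 ∈ S ∧ e.2 ∈ S then g e ^ 2 * κ ((S.erase e.1).erase e.2)
        + 2 * g e * (κ (S.erase e.1) - κ (S.erase e.2)) else 0))
      ≤ -(3 / 4) * (n : ℝ) ^ 2 * ∑ S, a ^ S.card * (κ (swapSet e.1 e.2 S) - κ S) ^ 2
        + G * (16 * a * ∑ S : Finset (Site n) with e.1 ∈ S ∧ e.2 ∈ S, a ^ S.card * κ S ^ 2
        + ν * n * ∑ S : Finset (Site n) with e.1 ∈ S ∧ e.2 ∈ S, a ^ S.card / S.card * κ S ^ 2
        + a ^ 2 / (ν * n) * M) := by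
    intro e he
    have h := mul_le_mul_of_nonneg_left (edge_energy_le hn ha hν (g e) κ (ne_of_mem_edges he))
      (by positivity : 0 ≤ (n : ℝ) ^ 2)
    have h1 : 0 ≤ 16 * a * ∑ S : Finset (Site n) with e.1 ∈ S ∧ e.2 ∈ S, a ^ S.card * κ S ^ 2
        + ν * n * ∑ S : Finset (Site n) with e.1 ∈ S ∧ e.2 ∈ S, a ^ S.card / S.card * κ S ^ 2
        + a ^ 2 / (ν * n) * M :=
      add_nonneg (add_nonneg (mul_nonneg (by positivity) (Finset.sum_nonneg fun S _ =>
        mul_nonneg (hw _) (sq_nonneg _))) (mul_nonneg (by positivity) (Finset.sum_nonneg fun S _ =>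
        mul_nonneg (hw' _) (sq_nonneg _)))) (mul_nonneg (by positivity) hM0)
    have h2 := mul_le_mul_of_nonneg_right (hg e he) h1
    linarith
  have hsum := Finset.sum_le_sum hedge
  rw [← Finset.mul_sum, Finset.sum_add_distrib, ← Finset.mul_sum, ← Finset.mul_sum,
    ← Finset.mul_sum, Finset.sum_add_distrib, Finset.sum_add_distrib, ← Finset.mul_sum,
    ← Finset.mul_sum, Finset.sum_const, nsmul_eq_mul] at hsum
  change _ ≤ -(3 / 4) * (n : ℝ) ^ 2 * D + _ at hsum
  clear_value M N D B
  have hE : ((edges n).card : ℝ) * (a ^ 2 / (ν * n) * M) ≤ a ^ 2 / ν * (3 * N + 2 * κ ∅ ^ 2) := by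
    calc _ ≤ (n : ℝ) * (a ^ 2 / (ν * n) * M) :=
          mul_le_mul_of_nonneg_right (card_edges_le n) (by positivity)
      _ = a ^ 2 / ν * M := hcancel M
      _ ≤ _ := mul_le_mul_of_nonneg_left hMN (by positivity)
  have hT' := mul_le_mul_of_nonneg_left hT (by positivity : 0 ≤ ν * n)
  have hQ' := mul_le_mul_of_nonneg_left hQ (by positivity : 0 ≤ 16 * a)
  have hall := mul_le_mul_of_nonneg_left (add_le_add (add_le_add hQ' hT') hE) hG
  have hDB : 0 ≤ (n : ℝ) ^ 2 * (D + B) := by positivity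
  have hνG' : G * (ν * n * (n * (D + B))) ≤ 1 / 4 * ((n : ℝ) ^ 2 * (D + B)) := by
    calc _ = ν * G * ((n : ℝ) ^ 2 * (D + B)) := by ring
      _ ≤ _ := mul_le_mul_of_nonneg_right hνG hDB
  have hB' : 0 ≤ (n : ℝ) ^ 2 * B := by positivity
  have e : (-(1 / 2) + 16 * a * G + 3 * a ^ 2 * G / ν) * N + 2 * a ^ 2 * G / ν * κ ∅ ^ 2
      = -(1 / 2) * N + G * (16 * a * N) + G * (a ^ 2 / ν * (3 * N + 2 * κ ∅ ^ 2)) := by ring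
  rw [e]
  linarith

/-! ### The generator on centred monomials -/

/-- The product over `S` of the occupation numbers centred at `u`. -/
noncomputable def monomial {n : ℕ} (u : Site n → ℝ) (S : Finset (Site n)) (η : Config n) : ℝ :=
  ∏ x ∈ S, (occ η x - u x)

/-- The right-hand side of the discrete heat equation with reservoirs of density `ρ`. -/
noncomputable def heatDrift (n : ℕ) (ρ : ℝ) (u : Site n → ℝ) (x : Site n) : ℝ :=
  (n : ℝ) ^ 2 * (∑ e ∈ edges n, ((if e.1 = x then u e.2 - u e.1 else 0)
    - if e.2 = x then u e.2 - u e.1 else 0) + if x ∈ boundary n then ρ - u x else 0)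

theorem occ_exchange {n : ℕ} (x y z : Site n) (η : Config n) :
    occ (exchange x y η) z = occ η (Equiv.swap x y z) := rfl

theorem occ_flip_self {n : ℕ} (x : Site n) (η : Config n) : occ (flip x η) x = 1 - occ η x := by
  unfold occ flip
  rw [Function.update_self]
  cases η x <;> simp

theorem occ_flip_of_ne {n : ℕ} {x z : Site n} (h : z ≠ x) (η : Config n) :
    occ (flip x η) z = occ η z := by
  unfold occ flip
  rw [Function.update_of_ne h]

theorem occ_sq {n : ℕ} (η : Config n) (x : Site n) : occ η x * occ η x = occ η x := by
  unfold occ; split_ifs <;> simp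

theorem monomial_insert {n : ℕ} (u : Site n → ℝ) {S : Finset (Site n)} {x : Site n} (h : x ∉ S)
    (η : Config n) : monomial u (insert x S) η = (occ η x - u x) * monomial u S η :=
  Finset.prod_insert h

theorem monomial_exchange_of_notMem {n : ℕ} (u : Site n → ℝ) {S : Finset (Site n)}
    {x y : Site n} (hx : x ∉ S) (hy : y ∉ S) (η : Config n) :
    monomial u S (exchange x y η) = monomial u S η := by
  refine Finset.prod_congr rfl fun z hz => ?_
  rw [occ_exchange, Equiv.swap_apply_of_ne_of_ne]
  · rintro rfl; exact hx hz
  · rintro rfl; exact hy hz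

theorem monomial_flip_of_notMem {n : ℕ} (u : Site n → ℝ) {S : Finset (Site n)}
    {x : Site n} (hx : x ∉ S) (η : Config n) :
    monomial u S (flip x η) = monomial u S η := by
  refine Finset.prod_congr rfl fun z hz => ?_
  rw [occ_flip_of_ne]
  rintro rfl; exact hx hz

/-- When both sites lie in S the single-site terms enter with the opposite sign; the factor 2 in the
source compensates, so that the last bracket has the same form in all cases. That bracket is the
part cancelled by the heat equation. -/
theorem monomial_exchange_sub {n : ℕ} (u : Site n → ℝ) (S : Finset (Site n)) {x y : Site n}
    (hxy : x ≠ y) (η : Config n) :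
    monomial u S (exchange x y η) - monomial u S η
      = (monomial u (swapSet x y S) η - monomial u S η
        - if x ∈ S ∧ y ∈ S then (u y - u x) ^ 2 * monomial u ((S.erase x).erase y) η
          + 2 * (u y - u x) * (monomial u (S.erase x) η - monomial u (S.erase y) η) else 0)
        + ((if x ∈ S then (u y - u x) * monomial u (S.erase x) η else 0)
          - if y ∈ S then (u y - u x) * monomial u (S.erase y) η else 0) := by
  by_cases hx : x ∈ S <;> by_cases hy : y ∈ S
  · obtain ⟨T, hxT, rfl⟩ : ∃ T, x ∉ T ∧ insert x T = S :=
      ⟨S.erase x, Finset.notMem_erase _ _, Finset.insert_erase hx⟩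
    have hyT : y ∈ T := (Finset.mem_insert.1 hy).resolve_left hxy.symm
    obtain ⟨R, hyR, rfl⟩ : ∃ R, y ∉ R ∧ insert y R = T :=
      ⟨T.erase y, Finset.notMem_erase _ _, Finset.insert_erase hyT⟩
    have hxR : x ∉ R := fun h => hxT (Finset.mem_insert_of_mem h)
    have hex : (insert x (insert y R)).erase y = insert x R := by
      rw [Finset.insert_comm, Finset.erase_insert]
      simp [hyR, hxy.symm]
    rw [swapSet_of_mem_of_mem hx hy, if_pos ⟨hx, hy⟩, if_pos hx, if_pos hy,
      Finset.erase_insert hxT, Finset.erase_insert hyR, hex, monomial_insert u hxT,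
      monomial_insert u hxT, monomial_insert u hyR, monomial_insert u hyR, monomial_insert u hxR,
      monomial_exchange_of_notMem u hxR hyR, occ_exchange, occ_exchange, Equiv.swap_apply_left,
      Equiv.swap_apply_right]
    ring
  · obtain ⟨T, hxT, rfl⟩ : ∃ T, x ∉ T ∧ insert x T = S :=
      ⟨S.erase x, Finset.notMem_erase _ _, Finset.insert_erase hx⟩
    have hyT : y ∉ T := fun h => hy (Finset.mem_insert_of_mem h)
    have hsw : swapSet x y (insert x T) = insert y T := by
      ext z
      rcases eq_or_ne z x with rfl | h1
      · simp [mem_swapSet_left, hxT, hyT, hxy, hxy.symm]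
      rcases eq_or_ne z y with rfl | h2
      · simp [mem_swapSet_right]
      · simp [mem_swapSet_of_ne h1 h2, h1, h2]
    rw [hsw, if_neg (fun h => hy h.2), if_pos hx, if_neg hy, Finset.erase_insert hxT,
      monomial_insert u hxT, monomial_insert u hxT, monomial_insert u hyT,
      monomial_exchange_of_notMem u hxT hyT, occ_exchange, Equiv.swap_apply_left]
    ring
  · obtain ⟨T, hyT, rfl⟩ : ∃ T, y ∉ T ∧ insert y T = S :=
      ⟨S.erase y, Finset.notMem_erase _ _, Finset.insert_erase hy⟩
    have hxT : x ∉ T := fun h => hx (Finset.mem_insert_of_mem h)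
    have hsw : swapSet x y (insert y T) = insert x T := by
      ext z
      rcases eq_or_ne z x with rfl | h1
      · simp [mem_swapSet_left]
      rcases eq_or_ne z y with rfl | h2
      · simp [mem_swapSet_right, hxT, hyT, hxy, hxy.symm]
      · simp [mem_swapSet_of_ne h1 h2, h1, h2]
    rw [hsw, if_neg (fun h => hx h.1), if_neg hx, if_pos hy, Finset.erase_insert hyT,
      monomial_insert u hyT, monomial_insert u hyT, monomial_insert u hxT,
      monomial_exchange_of_notMem u hxT hyT, occ_exchange, Equiv.swap_apply_right]
    ring
  · rw [swapSet_of_notMem_of_notMem hx hy, if_neg (fun h => hy h.2), if_neg hx, if_neg hy,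
      monomial_exchange_of_notMem u hx hy]
    ring

/-- Since the occupation number η(x) is 0 or 1, the flip rate times the jump 1 - 2η(x) equals ρ -
η(x) = (ρ - u(x)) - (η(x) - u(x)): a contribution to the heat drift and a killing term. -/
theorem monomial_flip_sub {n : ℕ} (ρ : ℝ) (u : Site n → ℝ) (S : Finset (Site n)) (x : Site n)
    (η : Config n) :
    (ρ * (1 - occ η x) + (1 - ρ) * occ η x) * (monomial u S (flip x η) - monomial u S η)
      = (if x ∈ S then (ρ - u x) * monomial u (S.erase x) η else 0)
        - if x ∈ S then monomial u S η else 0 := by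
  by_cases hx : x ∈ S
  · obtain ⟨T, hxT, rfl⟩ : ∃ T, x ∉ T ∧ insert x T = S :=
      ⟨S.erase x, Finset.notMem_erase _ _, Finset.insert_erase hx⟩
    rw [if_pos hx, if_pos hx, Finset.erase_insert hxT, monomial_insert u hxT,
      monomial_insert u hxT, monomial_flip_of_notMem u hxT, occ_flip_self]
    linear_combination (4 * ρ - 2) * monomial u T η * occ_sq η x
  · rw [if_neg hx, if_neg hx, monomial_flip_of_notMem u hx]
    ring

theorem generator_eq {n : ℕ} (ρ : ℝ) (f : Config n → ℝ) (η : Config n) :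
    generator n ρ f η = (n : ℝ) ^ 2 * ∑ e ∈ edges n, (f (exchange e.1 e.2 η) - f η)
      + (n : ℝ) ^ 2 * ∑ x ∈ boundary n,
        (ρ * (1 - occ η x) + (1 - ρ) * occ η x) * (f (flip x η) - f η) := by
  unfold generator edges boundary
  rw [Finset.sum_filter, Finset.sum_filter, Fintype.sum_prod_type]

theorem sum_heatDrift_mul {n : ℕ} (ρ : ℝ) (u : Site n → ℝ) (S : Finset (Site n))
    (c : Site n → ℝ) :
    ∑ x ∈ S, heatDrift n ρ u x * c x
      = (n : ℝ) ^ 2 * ∑ e ∈ edges n, ((if e.1 ∈ S then (u e.2 - u e.1) * c e.1 else 0)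
          - if e.2 ∈ S then (u e.2 - u e.1) * c e.2 else 0)
        + (n : ℝ) ^ 2 * ∑ x ∈ boundary n, if x ∈ S then (ρ - u x) * c x else 0 := by
  have h1 : ∑ x ∈ S, heatDrift n ρ u x * c x
      = (n : ℝ) ^ 2 * ∑ x ∈ S, ∑ e ∈ edges n, ((if e.1 = x then (u e.2 - u e.1) * c x else 0)
          - if e.2 = x then (u e.2 - u e.1) * c x else 0)
        + (n : ℝ) ^ 2 * ∑ x ∈ S, if x ∈ boundary n then (ρ - u x) * c x else 0 := by
    rw [Finset.mul_sum, Finset.mul_sum, ← Finset.sum_add_distrib]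
    refine Finset.sum_congr rfl fun x _ => ?_
    have : ∑ e ∈ edges n, ((if e.1 = x then (u e.2 - u e.1) * c x else 0)
          - if e.2 = x then (u e.2 - u e.1) * c x else 0)
        = (∑ e ∈ edges n, ((if e.1 = x then u e.2 - u e.1 else 0)
          - if e.2 = x then u e.2 - u e.1 else 0)) * c x := by
      rw [Finset.sum_mul]
      refine Finset.sum_congr rfl fun e _ => ?_
      split_ifs <;> ring
    rw [this, heatDrift]
    split_ifs <;> ring
  rw [h1, Finset.sum_comm]
  congr 2
  · refine Finset.sum_congr rfl fun e _ => ?_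
    rw [Finset.sum_sub_distrib]
    congr 1 <;> simp
  · rw [← Finset.sum_filter, ← Finset.sum_filter]
    refine Finset.sum_congr ?_ fun _ _ => rfl
    ext x; simp [and_comm]

/-- The single-site terms left over from exchanges and flips are exactly those produced by
differentiating a centring that follows the heat equation. -/
theorem generator_monomial {n : ℕ} (ρ : ℝ) (u : Site n → ℝ) (S : Finset (Site n))
    (η : Config n) :
    generator n ρ (monomial u S) η
      - ∑ x ∈ S, heatDrift n ρ u x * monomial u (S.erase x) η
      = correlationDrift n (fun e => u e.2 - u e.1) (fun T => monomial u T η) S := by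
  have hcard : ((S ∩ boundary n).card : ℝ) * monomial u S η
      = ∑ x ∈ boundary n, if x ∈ S then monomial u S η else 0 := by
    rw [Finset.sum_ite_mem, Finset.sum_const, nsmul_eq_mul, Finset.inter_comm]
  rw [generator_eq, sum_heatDrift_mul ρ u S fun x => monomial u (S.erase x) η, correlationDrift,
    hcard]
  simp_rw [monomial_flip_sub]
  have hedge : ∑ e ∈ edges n, (monomial u S (exchange e.1 e.2 η) - monomial u S η)
      = ∑ e ∈ edges n, (monomial u (swapSet e.1 e.2 S) η - monomial u S η
        - if e.1 ∈ S ∧ e.2 ∈ S then (u e.2 - u e.1) ^ 2 * monomial u ((S.erase e.1).erase e.2) η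
          + 2 * (u e.2 - u e.1) * (monomial u (S.erase e.1) η - monomial u (S.erase e.2) η) else 0)
      + ∑ e ∈ edges n, ((if e.1 ∈ S then (u e.2 - u e.1) * monomial u (S.erase e.1) η else 0)
          - if e.2 ∈ S then (u e.2 - u e.1) * monomial u (S.erase e.2) η else 0) := by
    rw [← Finset.sum_add_distrib]
    exact Finset.sum_congr rfl fun e he => monomial_exchange_sub u S (ne_of_mem_edges he) η
  rw [hedge, Finset.sum_sub_distrib (s := boundary n)]
  ring

/-! ### Evolution of the law and of the correlation functions -/

theorem sum_rateMatrix_mul {n : ℕ} (ρ : ℝ) (f : Config n → ℝ) (η : Config n) :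
    ∑ ζ, rateMatrix n ρ η ζ * f ζ = generator n ρ f η := by
  have key : ∀ a b : Config n,
      ∑ ζ, ((Pi.single ζ 1 : Config n → ℝ) a - (Pi.single ζ 1 : Config n → ℝ) b) * f ζ
        = f a - f b := by
    intro a b
    simp [sub_mul, Finset.sum_sub_distrib, Pi.single_apply]
  obtain ⟨r, hr⟩ : ∃ r : Site n → ℝ, ∀ f : Config n → ℝ, generator n ρ f η
      = (n : ℝ) ^ 2 * ∑ e ∈ edges n, (f (exchange e.1 e.2 η) - f η)
        + (n : ℝ) ^ 2 * ∑ x ∈ boundary n, r x * (f (flip x η) - f η) :=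
    ⟨_, fun f => generator_eq ρ f η⟩
  simp only [rateMatrix, Matrix.of_apply, hr, ← key, Finset.mul_sum, add_mul,
    Finset.sum_mul, Finset.sum_add_distrib]
  congr 1
  · rw [Finset.sum_comm]
    exact Finset.sum_congr rfl fun _ _ => Finset.sum_congr rfl fun _ _ => by ring
  · rw [Finset.sum_comm]
    exact Finset.sum_congr rfl fun _ _ => Finset.sum_congr rfl fun _ _ => by ring

theorem hasDerivAt_transition {n : ℕ} (ρ t : ℝ) :
    HasDerivAt (fun s => transition n ρ s) (transition n ρ t * rateMatrix n ρ) t := by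
  -- An auxiliary Banach algebra norm on the finite-dimensional matrix algebra, used only to
  -- differentiate the exponential.
  let : NormedRing (Matrix (Config n) (Config n) ℝ) := Matrix.linftyOpNormedRing
  let : NormedAlgebra ℝ (Matrix (Config n) (Config n) ℝ) := Matrix.linftyOpNormedAlgebra
  exact hasDerivAt_exp_smul_const (rateMatrix n ρ) t

theorem hasDerivAt_lawWeight {n : ℕ} (ρ : ℝ) (u : Site n → ℝ) (t : ℝ) (ζ : Config n) :
    HasDerivAt (fun s => lawWeight n ρ u s ζ)
      (∑ η, lawWeight n ρ u t η * rateMatrix n ρ η ζ) t := by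
  have h : ∀ η, HasDerivAt (fun s => transition n ρ s η ζ)
      ((transition n ρ t * rateMatrix n ρ) η ζ) t := fun η =>
    hasDerivAt_pi.1 (hasDerivAt_pi.1 (hasDerivAt_transition ρ t) η) ζ
  have h2 : HasDerivAt (fun s => lawWeight n ρ u s ζ)
      (∑ η, bernoulliWeight u η * (transition n ρ t * rateMatrix n ρ) η ζ) t := by
    unfold lawWeight
    exact HasDerivAt.fun_sum fun η _ => (h η).const_mul _
  convert h2 using 1
  simp_rw [lawWeight, Matrix.mul_apply, Finset.mul_sum, Finset.sum_mul]
  rw [Finset.sum_comm]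
  simp_rw [mul_assoc]

/-- The correlation functions at time `t` of the process started from the product measure with
density `u₀`, centred at `u`. -/
noncomputable def correlation (n : ℕ) (ρ : ℝ) (u₀ u : Site n → ℝ) (t : ℝ)
    (S : Finset (Site n)) : ℝ :=
  ∑ ζ, lawWeight n ρ u₀ t ζ * monomial u S ζ

theorem hasDerivAt_monomial {n : ℕ} {u : ℝ → Site n → ℝ} {u' : Site n → ℝ} {t : ℝ}
    (hu : ∀ x, HasDerivAt (fun s => u s x) (u' x) t) (S : Finset (Site n)) (η : Config n) :
    HasDerivAt (fun s => monomial (u s) S η)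
      (-∑ x ∈ S, u' x * monomial (u t) (S.erase x) η) t := by
  have h := HasDerivAt.fun_finsetProd (u := S) (f := fun x s => occ η x - u s x)
    (f' := fun x => -u' x) (x := t) fun x _ => by simpa using (hu x).const_sub (occ η x)
  refine h.congr_deriv ?_
  rw [← Finset.sum_neg_distrib]
  refine Finset.sum_congr rfl fun x _ => ?_
  rw [smul_eq_mul, monomial]
  ring

theorem correlationDrift_sum {n : ℕ} (g : Site n × Site n → ℝ) (w : Config n → ℝ)
    (m : Config n → Finset (Site n) → ℝ) (S : Finset (Site n)) :
    ∑ ζ, w ζ * correlationDrift n g (m ζ) S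
      = correlationDrift n g (fun T => ∑ ζ, w ζ * m ζ T) S := by
  have hedge : ∀ e : Site n × Site n, ∑ ζ, w ζ * (m ζ (swapSet e.1 e.2 S) - m ζ S
      - if e.1 ∈ S ∧ e.2 ∈ S then g e ^ 2 * m ζ ((S.erase e.1).erase e.2)
        + 2 * g e * (m ζ (S.erase e.1) - m ζ (S.erase e.2)) else 0)
      = (∑ ζ, w ζ * m ζ (swapSet e.1 e.2 S) - ∑ ζ, w ζ * m ζ S
        - if e.1 ∈ S ∧ e.2 ∈ S then g e ^ 2 * ∑ ζ, w ζ * m ζ ((S.erase e.1).erase e.2)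
          + 2 * g e * (∑ ζ, w ζ * m ζ (S.erase e.1) - ∑ ζ, w ζ * m ζ (S.erase e.2)) else 0) := by
    intro e
    split_ifs
    · rw [← Finset.sum_sub_distrib, ← Finset.sum_sub_distrib, Finset.mul_sum, Finset.mul_sum,
        ← Finset.sum_add_distrib, ← Finset.sum_sub_distrib]
      exact Finset.sum_congr rfl fun ζ _ => by ring
    · rw [← Finset.sum_sub_distrib, sub_zero]
      exact Finset.sum_congr rfl fun ζ _ => by ring
  unfold correlationDrift
  simp_rw [← hedge]
  rw [Finset.sum_comm, Finset.mul_sum, Finset.mul_sum, Finset.mul_sum, ← Finset.sum_sub_distrib]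
  refine Finset.sum_congr rfl fun ζ _ => ?_
  rw [← Finset.mul_sum]
  ring

/-- The forward equation moves the generator onto the monomial, and the motion of the centring
removes the single-site terms; the hierarchy is closed because the sources only look at smaller
sets. -/
theorem hasDerivAt_correlation {n : ℕ} (ρ : ℝ) (u₀ : Site n → ℝ) {u : ℝ → Site n → ℝ} {t : ℝ}
    (hu : ∀ x, HasDerivAt (fun s => u s x) (heatDrift n ρ (u t) x) t) (S : Finset (Site n)) :
    HasDerivAt (fun s => correlation n ρ u₀ (u s) s S)
      (correlationDrift n (fun e => u t e.2 - u t e.1)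
        (fun T => correlation n ρ u₀ (u t) t T) S) t := by
  have h := HasDerivAt.fun_sum (u := Finset.univ) (x := t) fun ζ (_ : ζ ∈ Finset.univ) =>
    (hasDerivAt_lawWeight ρ u₀ t ζ).mul (hasDerivAt_monomial hu S ζ)
  refine h.congr_deriv ?_
  unfold correlation
  rw [← correlationDrift_sum]
  rw [Finset.sum_add_distrib]
  have h1 : ∑ ζ, (∑ η, lawWeight n ρ u₀ t η * rateMatrix n ρ η ζ) * monomial (u t) S ζ
      = ∑ η, lawWeight n ρ u₀ t η * generator n ρ (monomial (u t) S) η := by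
    simp_rw [Finset.sum_mul]
    rw [Finset.sum_comm]
    refine Finset.sum_congr rfl fun η _ => ?_
    rw [← sum_rateMatrix_mul, Finset.mul_sum]
    exact Finset.sum_congr rfl fun ζ _ => by ring
  rw [h1, ← Finset.sum_add_distrib]
  refine Finset.sum_congr rfl fun η _ => ?_
  rw [← generator_monomial ρ]
  ring

theorem sum_config_prod {R : Type*} [CommSemiring R] {n : ℕ} (f : Site n → Bool → R) :
    ∑ η : Config n, ∏ x, f x (η x) = ∏ x, (f x true + f x false) := by
  rw [← Fintype.prod_sum]
  simp

theorem lawWeight_zero {n : ℕ} (ρ : ℝ) (u : Site n → ℝ) (ζ : Config n) :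
    lawWeight n ρ u 0 ζ = bernoulliWeight u ζ := by
  simp [lawWeight, transition, Matrix.one_apply]

theorem monomial_eq_prod_univ {n : ℕ} (u : Site n → ℝ) (S : Finset (Site n)) (η : Config n) :
    monomial u S η = ∏ x, if x ∈ S then occ η x - u x else 1 := by
  rw [monomial, Finset.prod_ite_mem, Finset.univ_inter]

/-- The sum factorises over sites, and every site of S contributes a centred variable. -/
theorem sum_bernoulliWeight_mul_monomial {n : ℕ} (u : Site n → ℝ) (S : Finset (Site n)) :
    ∑ η, bernoulliWeight u η * monomial u S η = if S = ∅ then 1 else 0 := by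
  have h : ∑ η, bernoulliWeight u η * monomial u S η = ∏ x, (u x * (if x ∈ S then 1 - u x else 1)
      + (1 - u x) * (if x ∈ S then 0 - u x else 1)) := by
    have := sum_config_prod (n := n) fun x b =>
      (if b then u x else 1 - u x) * (if x ∈ S then (if b then 1 else 0) - u x else 1)
    simp only [if_true, Bool.false_eq_true, if_false] at this
    rw [← this]
    refine Finset.sum_congr rfl fun η _ => ?_
    rw [bernoulliWeight, monomial_eq_prod_univ, ← Finset.prod_mul_distrib]
    refine Finset.prod_congr rfl fun x _ => ?_
    unfold occ
    cases η x <;> simp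
  rw [h]
  split_ifs with hS
  · subst hS; simp
  · obtain ⟨x, hx⟩ := Finset.nonempty_iff_ne_empty.2 hS
    refine Finset.prod_eq_zero (Finset.mem_univ x) ?_
    simp only [if_pos hx]; ring

theorem correlation_zero {n : ℕ} (ρ : ℝ) (u : Site n → ℝ) (S : Finset (Site n)) :
    correlation n ρ u u 0 S = if S = ∅ then 1 else 0 := by
  simp only [correlation, lawWeight_zero, sum_bernoulliWeight_mul_monomial]

theorem correlationDrift_empty {n : ℕ} (g : Site n × Site n → ℝ) (κ : Finset (Site n) → ℝ) :
    correlationDrift n g κ ∅ = 0 := by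
  simp [correlationDrift, swapSet]

/-- Conservation of total mass, read off from the vanishing of the drift at the empty set. -/
theorem correlation_empty {n : ℕ} {ρ : ℝ} {u : ℝ → Site n → ℝ}
    (hu : ∀ t x, HasDerivAt (fun s => u s x) (heatDrift n ρ (u t) x) t) (t : ℝ) :
    correlation n ρ (u 0) (u t) t ∅ = 1 := by
  have hd : ∀ t, HasDerivAt (fun s => correlation n ρ (u 0) (u s) s ∅) 0 t := fun t => by
    have := hasDerivAt_correlation ρ (u 0) (hu t) ∅
    rwa [correlationDrift_empty] at this
  have := is_const_of_deriv_eq_zero (fun t => (hd t).differentiableAt) (fun t => (hd t).deriv) t 0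
  rw [this, correlation_zero, if_pos rfl]

/-! ### Exponential decay of the correlations -/

/-- The exponentially weighted energy of the correlation functions stays bounded, uniformly in
the size of the system. -/
theorem energy_le {n : ℕ} (hn : 0 < n) {ρ G : ℝ} (hG : 0 < G) {u : ℝ → Site n → ℝ}
    (hu : ∀ t x, HasDerivAt (fun s => u s x) (heatDrift n ρ (u t) x) t)
    (hg : ∀ t, 0 ≤ t → ∀ e ∈ edges n,
      (n : ℝ) ^ 2 * (u t e.2 - u t e.1) ^ 2 ≤ G * Real.exp (-t)) {t : ℝ} (ht : 0 ≤ t) :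
    ∑ S, (1 / (128 * (1 + G)) * Real.exp (t / 8)) ^ S.card
      * correlation n ρ (u 0) (u t) t S ^ 2 ≤ 3 := by
  -- Chosen so that a₀ G ≤ 1/128. With ν = 1/(4G) this makes each of the two error coefficients in
  -- `energy_drift_le` at most 1/8.
  set a₀ : ℝ := 1 / (128 * (1 + G)) with ha₀
  have ha₀pos : 0 < a₀ := by positivity
  have ha₀G : a₀ * G ≤ 1 / 128 := by
    rw [ha₀, div_mul_eq_mul_div, one_mul, div_le_div_iff₀ (by positivity) (by norm_num)]
    nlinarith
  -- The growth of the base adds (1/8) ∑ |S| a^|S| κ(S)^2 to the derivative of the energy, within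
  -- what the dissipation can absorb. The rate is slow enough for a^2 e^{-s} still to decay.
  let a : ℝ → ℝ := fun s => a₀ * Real.exp (s / 8)
  have hapos : ∀ s, 0 < a s := fun s => by positivity
  have hader : ∀ s, HasDerivAt a (a s / 8) s := fun s => by
    have h : HasDerivAt (fun s : ℝ => s / 8) (1 / 8) s := (hasDerivAt_id s).div_const 8
    refine ((h.exp).const_mul a₀).congr_deriv ?_
    simp only [a]; ring
  let κ : ℝ → Finset (Site n) → ℝ := fun s S => correlation n ρ (u 0) (u s) s S
  let g : ℝ → Site n × Site n → ℝ := fun s e => u s e.2 - u s e.1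
  have hκ : ∀ s S, HasDerivAt (fun s => κ s S) (correlationDrift n (g s) (κ s) S) s :=
    fun s S => hasDerivAt_correlation ρ (u 0) (hu s) S
  let N : ℝ → ℝ := fun s => ∑ S : Finset (Site n), (S.card : ℝ) * (a s ^ S.card * κ s S ^ 2)
  have hN0 : ∀ s, 0 ≤ N s := fun s => Finset.sum_nonneg fun S _ => by
    have := hapos s; positivity
  let F : ℝ → ℝ := fun s => ∑ S, a s ^ S.card * κ s S ^ 2
  have hF : ∀ s, HasDerivAt F (1 / 8 * N s
      + 2 * ∑ S, a s ^ S.card * κ s S * correlationDrift n (g s) (κ s) S) s := by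
    intro s
    have h := HasDerivAt.fun_sum (u := Finset.univ) (x := s)
      fun (S : Finset (Site n)) (_ : S ∈ Finset.univ) =>
        ((hader s).fun_pow S.card).fun_mul ((hκ s S).fun_pow 2)
    refine h.congr_deriv ?_
    rw [Finset.mul_sum, Finset.mul_sum, ← Finset.sum_add_distrib]
    refine Finset.sum_congr rfl fun S _ => ?_
    -- The exponent |S| - 1 in the derivative is a truncated subtraction, so the empty set is
    -- treated apart.
    rcases Nat.eq_zero_or_pos S.card with h0 | h0
    · rw [h0]; simp; ring
    · obtain ⟨k, hk⟩ := Nat.exists_eq_succ_of_ne_zero h0.ne'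
      rw [hk]
      simp only [Nat.succ_eq_add_one, Nat.add_sub_cancel, pow_succ]
      push_cast
      ring
  have hbound : ∀ s, 0 ≤ s → 1 / 8 * N s
      + 2 * ∑ S, a s ^ S.card * κ s S * correlationDrift n (g s) (κ s) S
      ≤ Real.exp (-(3 / 4) * s) := by
    intro s hs
    have hexp : Real.exp (-s) ≤ 1 := Real.exp_le_one_iff.2 (by linarith)
    have h := energy_drift_le hn (hapos s) (by positivity : 0 < 1 / (4 * G)) (g s)
      (fun e he => hg s hs e he) (by positivity) (by
        rw [div_mul_eq_mul_div, div_le_div_iff₀ (by positivity) (by norm_num)]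
        nlinarith) (κ s)
    have hempty : κ s ∅ = 1 := correlation_empty hu s
    rw [hempty] at h
    have e1 : a s * (G * Real.exp (-s)) = a₀ * G * Real.exp (-(7 / 8) * s) := by
      simp only [a]
      rw [show -(7 / 8) * s = s / 8 + -s by ring, Real.exp_add]; ring
    have e2 : a s ^ 2 * (G * Real.exp (-s)) / (1 / (4 * G))
        = 4 * (a₀ * G) ^ 2 * Real.exp (-(3 / 4) * s) := by
      simp only [a]
      rw [show -(3 / 4) * s = s / 8 + s / 8 + -s by ring, Real.exp_add, Real.exp_add]
      field_simp
    have x1 : Real.exp (-(7 / 8) * s) ≤ 1 := Real.exp_le_one_iff.2 (by linarith)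
    have x2 : Real.exp (-(3 / 4) * s) ≤ 1 := Real.exp_le_one_iff.2 (by linarith)
    have p1 := Real.exp_pos (-(7 / 8) * s)
    have p2 := Real.exp_pos (-(3 / 4) * s)
    have p3 : 0 ≤ a₀ * G := by positivity
    have p4 : (a₀ * G) ^ 2 ≤ 1 / 128 := by nlinarith
    have b1 : 16 * a s * (G * Real.exp (-s)) ≤ 1 / 8 := by
      rw [mul_assoc, e1]; nlinarith
    have b2 : 3 * a s ^ 2 * (G * Real.exp (-s)) / (1 / (4 * G)) ≤ 1 / 8 := by
      rw [mul_assoc, mul_div_assoc, e2]; nlinarith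
    have b3 : 2 * a s ^ 2 * (G * Real.exp (-s)) / (1 / (4 * G)) ≤ Real.exp (-(3 / 4) * s) := by
      rw [mul_assoc, mul_div_assoc, e2]; nlinarith
    have hNs := hN0 s
    have b4 : (-(1 / 2) + 16 * a s * (G * Real.exp (-s))
        + 3 * a s ^ 2 * (G * Real.exp (-s)) / (1 / (4 * G))) * N s ≤ -(1 / 8) * N s :=
      mul_le_mul_of_nonneg_right (by linarith) hNs
    rw [one_pow, mul_one] at h
    change _ ≤ _ * N s + _ at h
    linarith
  -- The added term is the integral of the forcing e^{-3s/4} still to come, so H is nonincreasing;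
  -- it starts at 1 + 4/3 ≤ 3.
  let H : ℝ → ℝ := fun s => F s + 4 / 3 * Real.exp (-(3 / 4) * s)
  have hH : ∀ s, HasDerivAt H (1 / 8 * N s
      + 2 * ∑ S, a s ^ S.card * κ s S * correlationDrift n (g s) (κ s) S
      - Real.exp (-(3 / 4) * s)) s := by
    intro s
    have h : HasDerivAt (fun s : ℝ => -(3 / 4) * s) (-(3 / 4)) s := by
      simpa using (hasDerivAt_id s).const_mul (-(3 / 4) : ℝ)
    refine ((hF s).add ((h.exp).const_mul (4 / 3))).congr_deriv ?_
    ring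
  have hanti : AntitoneOn H (Ici 0) := by
    refine antitoneOn_of_deriv_nonpos (convex_Ici 0)
      (fun s _ => (hH s).continuousAt.continuousWithinAt)
      (fun s _ => (hH s).differentiableAt.differentiableWithinAt) fun s hs => ?_
    rw [interior_Ici] at hs
    rw [(hH s).deriv]
    linarith [hbound s (le_of_lt hs)]
  have hle := hanti (mem_Ici.2 le_rfl) (mem_Ici.2 ht) ht
  have hF0 : F 0 = 1 := by
    simp only [F, κ, correlation_zero]
    simp
  have : H 0 = 1 + 4 / 3 := by simp only [H, hF0]; simp
  rw [this] at hle
  have := Real.exp_pos (-(3 / 4) * t)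
  change F t ≤ 3
  simp only [H] at hle
  linarith

/-- The total mass of the nontrivial correlations, with fixed weights, decays exponentially. -/
theorem sum_correlation_sq_le {n : ℕ} (hn : 0 < n) {ρ G A : ℝ} (hG : 0 < G) (hA : 0 < A)
    {u : ℝ → Site n → ℝ} (hu : ∀ t x, HasDerivAt (fun s => u s x) (heatDrift n ρ (u t) x) t)
    (hg : ∀ t, 0 ≤ t → ∀ e ∈ edges n,
      (n : ℝ) ^ 2 * (u t e.2 - u t e.1) ^ 2 ≤ G * Real.exp (-t)) {t : ℝ} (ht : 0 ≤ t)
    (hAt : A ≤ 1 / (128 * (1 + G)) * Real.exp (t / 8)) :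
    ∑ S ∈ Finset.univ.erase ∅, A ^ S.card * correlation n ρ (u 0) (u t) t S ^ 2
      ≤ 384 * (1 + G) * A * Real.exp (-(t / 8)) := by
  set a := 1 / (128 * (1 + G)) * Real.exp (t / 8) with ha
  have hapos : 0 < a := by positivity
  have h := energy_le hn hG hu hg ht
  -- For |S| ≥ 1 and A ≤ a one has (A/a)^|S| ≤ A/a: a single factor 1/a already gives the decay
  -- e^{-t/8}.
  have hterm : ∀ S ∈ Finset.univ.erase (∅ : Finset (Site n)),
      A ^ S.card * correlation n ρ (u 0) (u t) t S ^ 2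
        ≤ A / a * (a ^ S.card * correlation n ρ (u 0) (u t) t S ^ 2) := by
    intro S hS
    have hk : 0 < S.card :=
      Finset.card_pos.2 (Finset.nonempty_iff_ne_empty.2 (Finset.ne_of_mem_erase hS))
    obtain ⟨k, hk⟩ := Nat.exists_eq_succ_of_ne_zero hk.ne'
    rw [← mul_assoc]
    refine mul_le_mul_of_nonneg_right ?_ (sq_nonneg _)
    rw [hk, Nat.succ_eq_add_one, pow_succ, pow_succ]
    have : A / a * (a ^ k * a) = a ^ k * A := by field_simp
    rw [this]
    exact mul_le_mul_of_nonneg_right (pow_le_pow_left₀ hA.le hAt k) hA.le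
  calc _ ≤ ∑ S ∈ Finset.univ.erase (∅ : Finset (Site n)),
        A / a * (a ^ S.card * correlation n ρ (u 0) (u t) t S ^ 2) := Finset.sum_le_sum hterm
    _ ≤ A / a * ∑ S, a ^ S.card * correlation n ρ (u 0) (u t) t S ^ 2 := by
        rw [← Finset.mul_sum]
        refine mul_le_mul_of_nonneg_left ?_ (by positivity)
        exact Finset.sum_le_sum_of_subset_of_nonneg (Finset.erase_subset _ _)
          fun S _ _ => by positivity
    _ ≤ A / a * 3 := mul_le_mul_of_nonneg_left h (by positivity)
    _ = _ := by
        rw [ha, Real.exp_neg]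
        field_simp
        norm_num

/-! ### Total variation distance -/

section TotalVariation

variable {α : Type*} [MeasurableSpace α]

theorem bddAbove_range_abs_sub (μ ν : Measure α) [IsFiniteMeasure μ] [IsFiniteMeasure ν] :
    BddAbove (Set.range fun A : {A : Set α // MeasurableSet A} => |μ.real A - ν.real A|) := by
  refine ⟨μ.real univ + ν.real univ, ?_⟩
  rintro _ ⟨A, rfl⟩
  have h1 := measureReal_mono (μ := μ) (subset_univ A.1)
  have h2 := measureReal_mono (μ := ν) (subset_univ A.1)
  have h3 : 0 ≤ μ.real A.1 := measureReal_nonneg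
  have h4 : 0 ≤ ν.real A.1 := measureReal_nonneg
  rw [abs_le]; constructor <;> linarith

theorem abs_sub_le_tvDist (μ ν : Measure α) [IsFiniteMeasure μ] [IsFiniteMeasure ν] {A : Set α}
    (hA : MeasurableSet A) : |μ.real A - ν.real A| ≤ tvDist μ ν :=
  le_ciSup (bddAbove_range_abs_sub μ ν) ⟨A, hA⟩

theorem tvDist_le {μ ν : Measure α} {c : ℝ}
    (h : ∀ A, MeasurableSet A → |μ.real A - ν.real A| ≤ c) : tvDist μ ν ≤ c := by
  have : Nonempty {A : Set α // MeasurableSet A} := ⟨⟨∅, MeasurableSet.empty⟩⟩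
  exact ciSup_le fun A => h A.1 A.2

theorem tvDist_comm (μ ν : Measure α) : tvDist μ ν = tvDist ν μ := by
  simp only [tvDist, abs_sub_comm]

theorem tvDist_triangle (μ ν π : Measure α) [IsFiniteMeasure μ] [IsFiniteMeasure ν]
    [IsFiniteMeasure π] : tvDist μ π ≤ tvDist μ ν + tvDist ν π :=
  tvDist_le fun _ hA => (abs_sub_le _ _ _).trans
    (add_le_add (abs_sub_le_tvDist μ ν hA) (abs_sub_le_tvDist ν π hA))

theorem abs_tvDist_sub_tvDist_le (μ ν π : Measure α) [IsFiniteMeasure μ] [IsFiniteMeasure ν]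
    [IsFiniteMeasure π] : |tvDist μ π - tvDist ν π| ≤ tvDist μ ν := by
  have h1 := tvDist_triangle μ ν π
  have h2 := tvDist_triangle ν μ π
  rw [tvDist_comm ν μ] at h2
  rw [abs_le]; constructor <;> linarith

instance isFiniteMeasure_ofWeight [Fintype α] (w : α → ℝ) : IsFiniteMeasure (ofWeight w) := by
  constructor
  simp only [ofWeight, Measure.finsetSum_apply, Measure.smul_apply, smul_eq_mul]
  refine ENNReal.sum_lt_top.2 fun a _ => ENNReal.mul_lt_top ENNReal.ofReal_lt_top ?_
  simp

theorem ofWeight_real [Fintype α] (w : α → ℝ) {A : Set α} (hA : MeasurableSet A) :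
    (ofWeight w).real A = ∑ a, A.indicator (fun a => max (w a) 0) a := by
  classical
  simp only [ofWeight, measureReal_def, Measure.finsetSum_apply, Measure.smul_apply, smul_eq_mul]
  rw [ENNReal.toReal_sum fun a _ => by
    rw [Measure.dirac_apply' _ hA]
    exact ENNReal.mul_ne_top ENNReal.ofReal_ne_top (by by_cases h : a ∈ A <;> simp [h])]
  refine Finset.sum_congr rfl fun a _ => ?_
  rw [Measure.dirac_apply' _ hA]
  by_cases h : a ∈ A <;> simp [h, ENNReal.toReal_ofReal']

/-- Truncation at 0 is 1-Lipschitz, so signed weights are allowed and positivity of the transition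
probabilities is never needed. -/
theorem tvDist_ofWeight_le [Fintype α] (w w' : α → ℝ) :
    tvDist (ofWeight w) (ofWeight w') ≤ ∑ a, |w a - w' a| := by
  refine tvDist_le fun A hA => ?_
  rw [ofWeight_real w hA, ofWeight_real w' hA, ← Finset.sum_sub_distrib]
  refine (Finset.abs_sum_le_sum_abs _ _).trans (Finset.sum_le_sum fun a _ => ?_)
  by_cases h : a ∈ A
  · simp only [Set.indicator_of_mem h]
    exact abs_max_sub_max_le_abs _ _ _
  · simp [Set.indicator_of_notMem h]

/-- The total variation distance of two probability measures in terms of a relative density. -/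
theorem tvDist_withDensity (ν : Measure α) [IsProbabilityMeasure ν] {f : α → ℝ}
    (hf : Measurable f) (hf0 : ∀ a, 0 ≤ f a)
    [IsProbabilityMeasure (ν.withDensity fun a => ENNReal.ofReal (f a))] :
    tvDist (ν.withDensity fun a => ENNReal.ofReal (f a)) ν = ∫ a, max (1 - f a) 0 ∂ν := by
  set μ := ν.withDensity fun a => ENNReal.ofReal (f a) with hμ
  have hfi : Integrable f ν := by
    refine ⟨hf.aestronglyMeasurable, ?_⟩
    have h1 : μ univ < ⊤ := measure_lt_top _ _
    rw [hμ, withDensity_apply _ MeasurableSet.univ, Measure.restrict_univ] at h1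
    rw [hasFiniteIntegral_iff_ofReal (Eventually.of_forall hf0)]
    exact h1
  have hreal : ∀ A, MeasurableSet A → μ.real A = ∫ a in A, f a ∂ν := by
    intro A hA
    rw [measureReal_def, hμ, withDensity_apply _ hA,
      integral_eq_lintegral_of_nonneg_ae (Eventually.of_forall hf0)
        hf.aestronglyMeasurable.restrict]
  have hdiff : ∀ A, MeasurableSet A → ν.real A - μ.real A = ∫ a in A, (1 - f a) ∂ν := by
    intro A hA
    rw [hreal A hA, integral_sub (integrable_const _).integrableOn hfi.integrableOn]
    simp
  have hfi1 : Integrable (fun a => 1 - f a) ν := (integrable_const 1).sub hfi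
  have hfip : Integrable (fun a => max (1 - f a) 0) ν := hfi1.pos_part
  have hle : ∀ A, MeasurableSet A → ν.real A - μ.real A ≤ ∫ a, max (1 - f a) 0 ∂ν := by
    intro A hA
    rw [hdiff A hA]
    calc ∫ a in A, (1 - f a) ∂ν ≤ ∫ a in A, max (1 - f a) 0 ∂ν :=
          setIntegral_mono hfi1.integrableOn hfip.integrableOn fun a => le_max_left _ _
      _ ≤ ∫ a, max (1 - f a) 0 ∂ν :=
          setIntegral_le_integral hfip (Eventually.of_forall fun a => le_max_right _ _)
  apply le_antisymm
  · refine tvDist_le fun A hA => ?_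
    rw [abs_le]
    refine ⟨by linarith [hle A hA], ?_⟩
    -- For probability measures the reverse bound is the first one on the complement.
    have h := hle Aᶜ hA.compl
    rw [probReal_compl_eq_one_sub hA, probReal_compl_eq_one_sub hA] at h
    linarith
  · have hA : MeasurableSet {a | f a ≤ 1} := measurableSet_le hf measurable_const
    have h : ∫ a, max (1 - f a) 0 ∂ν = ν.real {a | f a ≤ 1} - μ.real {a | f a ≤ 1} := by
      rw [hdiff _ hA, ← integral_indicator hA]
      refine integral_congr_ae (Eventually.of_forall fun a => ?_)
      by_cases ha : f a ≤ 1
      · simp [Set.indicator, ha]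
      · simp only [Set.indicator, Set.mem_ofPred_eq, if_neg ha]
        exact max_eq_right (by linarith [not_le.1 ha])
    rw [h]
    exact (le_abs_self _).trans ((abs_sub_comm _ _).trans_le (abs_sub_le_tvDist μ ν hA))

end TotalVariation

/-! ### Parseval identity for Bernoulli product measures -/

section Parseval

variable {n : ℕ} {u : Site n → ℝ}

theorem bernoulliWeight_pos (hu : ∀ x, u x ∈ Ioo (0 : ℝ) 1) (η : Config n) :
    0 < bernoulliWeight u η := by
  refine Finset.prod_pos fun x _ => ?_
  have := hu x
  unfold occ
  split_ifs <;> simp [this.1, this.2]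

theorem sum_bernoulliWeight (u : Site n → ℝ) : ∑ η, bernoulliWeight u η = 1 := by
  simpa [monomial] using sum_bernoulliWeight_mul_monomial u ∅

/-- Completeness of the monomials. The sum over S expands a product over sites; a factor vanishes
where the configurations differ and is the inverse one-site weight where they agree. -/
theorem sum_monomial_mul_monomial (hu : ∀ x, u x ∈ Ioo (0 : ℝ) 1) (ζ η : Config n) :
    ∑ S, monomial u S ζ * monomial u S η / ∏ x ∈ S, (u x * (1 - u x))
      = if ζ = η then (bernoulliWeight u η)⁻¹ else 0 := by
  have h1 : ∑ S, monomial u S ζ * monomial u S η / ∏ x ∈ S, (u x * (1 - u x))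
      = ∏ x, (1 + (occ ζ x - u x) * (occ η x - u x) / (u x * (1 - u x))) := by
    rw [Finset.prod_one_add, Finset.powerset_univ]
    refine Finset.sum_congr rfl fun S _ => ?_
    rw [monomial, monomial, ← Finset.prod_mul_distrib, ← Finset.prod_div_distrib]
  rw [h1]
  split_ifs with h
  · subst h
    rw [bernoulliWeight, ← Finset.prod_inv_distrib]
    refine Finset.prod_congr rfl fun x _ => ?_
    have h0 := (hu x).1.ne'
    have h1 : 1 - u x ≠ 0 := by linarith [(hu x).2]
    unfold occ
    split_ifs
    · simp only [one_mul, sub_self, zero_mul, add_zero]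
      field_simp; ring
    · simp only [zero_sub, zero_mul, sub_zero, one_mul, zero_add]
      field_simp; ring
  · obtain ⟨x, hx⟩ := Function.ne_iff.1 h
    refine Finset.prod_eq_zero (Finset.mem_univ x) ?_
    have h0 := (hu x).1.ne'
    have h1 : 1 - u x ≠ 0 := by linarith [(hu x).2]
    unfold occ
    rcases hz : ζ x <;> rcases he : η x <;> simp_all <;> field_simp
    all_goals ring

/-- Parseval identity for the orthogonal basis of centred monomials of a product measure. -/
theorem sum_sq_div_bernoulliWeight (hu : ∀ x, u x ∈ Ioo (0 : ℝ) 1) (m : Config n → ℝ) :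
    ∑ η, m η ^ 2 / bernoulliWeight u η
      = ∑ S, (∑ η, m η * monomial u S η) ^ 2 / ∏ x ∈ S, (u x * (1 - u x)) := by
  have h : ∀ S, (∑ η, m η * monomial u S η) ^ 2 / ∏ x ∈ S, (u x * (1 - u x))
      = ∑ ζ, ∑ η, m ζ * m η * (monomial u S ζ * monomial u S η / ∏ x ∈ S, (u x * (1 - u x))) := by
    intro S
    rw [sq, Finset.sum_mul_sum, Finset.sum_div]
    refine Finset.sum_congr rfl fun ζ _ => ?_
    rw [Finset.sum_div]
    exact Finset.sum_congr rfl fun η _ => by ring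
  simp_rw [h]
  rw [Finset.sum_comm]
  refine Finset.sum_congr rfl fun ζ _ => ?_
  rw [Finset.sum_comm]
  simp_rw [← Finset.mul_sum, sum_monomial_mul_monomial hu]
  simp
  ring

/-- Cauchy–Schwarz bounds the l¹ distance by the chi-square distance, which Parseval expands; the
empty set drops out because both total masses are 1. -/
theorem sum_abs_sub_bernoulliWeight_sq_le (hu : ∀ x, u x ∈ Ioo (0 : ℝ) 1) (μ : Config n → ℝ)
    (hμ : ∑ η, μ η * monomial u ∅ η = 1) :
    (∑ η, |μ η - bernoulliWeight u η|) ^ 2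
      ≤ ∑ S ∈ Finset.univ.erase ∅,
        (∑ η, μ η * monomial u S η) ^ 2 / ∏ x ∈ S, (u x * (1 - u x)) := by
  have h := sum_sq_div_bernoulliWeight hu fun η => μ η - bernoulliWeight u η
  have h2 : ∑ S, (∑ η, (μ η - bernoulliWeight u η) * monomial u S η) ^ 2
        / ∏ x ∈ S, (u x * (1 - u x))
      = ∑ S ∈ Finset.univ.erase ∅,
        (∑ η, μ η * monomial u S η) ^ 2 / ∏ x ∈ S, (u x * (1 - u x)) := by
    simp_rw [sub_mul, Finset.sum_sub_distrib, sum_bernoulliWeight_mul_monomial]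
    rw [← Finset.add_sum_erase _ _ (Finset.mem_univ ∅), hμ]
    simp only [if_true, sub_self, ne_eq, OfNat.ofNat_ne_zero, not_false_eq_true, zero_pow,
      zero_div, zero_add]
    refine Finset.sum_congr rfl fun S hS => ?_
    rw [if_neg (Finset.ne_of_mem_erase hS), sub_zero]
  rw [← h2, ← h]
  have hcs := Finset.sum_sq_le_sum_mul_sum_of_sq_le_mul Finset.univ
    (r := fun η => |μ η - bernoulliWeight u η|) (f := bernoulliWeight u)
    (g := fun η => (μ η - bernoulliWeight u η) ^ 2 / bernoulliWeight u η)
    (fun η _ => (bernoulliWeight_pos hu η).le)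
    (fun η _ => div_nonneg (sq_nonneg _) (bernoulliWeight_pos hu η).le)
    (fun η _ => by rw [sq_abs, mul_div_cancel₀ _ (bernoulliWeight_pos hu η).ne'])
  rwa [sum_bernoulliWeight, one_mul] at hcs

end Parseval

/-! ### The discrete heat equation by sine series -/

/-- The eigenvalues of the discrete Dirichlet Laplacian on `{1, …, n-1}`, with a factor `-n²`. -/
noncomputable def heatEigenvalue (n ℓ : ℕ) : ℝ :=
  4 * (n : ℝ) ^ 2 * Real.sin (Real.pi * ℓ / (2 * n)) ^ 2

/-- The discrete sine-Fourier coefficients of `f` at the points `x/n`. -/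
noncomputable def sineCoeff (n : ℕ) (f : ℝ → ℝ) (ℓ : ℕ) : ℝ :=
  √2 / n * ∑ y ∈ Finset.range n, f (y / n) * Real.sin (Real.pi * ℓ * y / n)

/-- The solution of the discrete heat equation on `{1, …, n-1}` with zero boundary values and
initial values `f (x / n)`, extended to real arguments. -/
noncomputable def heatSolution (n : ℕ) (f : ℝ → ℝ) (t x : ℝ) : ℝ :=
  ∑ ℓ ∈ Finset.range n, sineCoeff n f ℓ * Real.exp (-heatEigenvalue n ℓ * t)
    * (√2 * Real.sin (Real.pi * ℓ * x / n))

theorem sin_pi_mul_nat (ℓ : ℕ) : Real.sin (Real.pi * ℓ) = 0 := by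
  rw [mul_comm]; exact Real.sin_nat_mul_pi ℓ

theorem heatSolution_zero_right (n : ℕ) (f : ℝ → ℝ) (t : ℝ) : heatSolution n f t 0 = 0 := by
  simp [heatSolution]

/-- Odd reflection at 0; together with the one at n it encodes the zero boundary values for the
extension to real x, where the heat equation holds without exception. -/
theorem heatSolution_neg (n : ℕ) (f : ℝ → ℝ) (t x : ℝ) :
    heatSolution n f t (-x) = -heatSolution n f t x := by
  simp only [heatSolution, ← Finset.sum_neg_distrib]
  refine Finset.sum_congr rfl fun ℓ _ => ?_
  rw [show Real.pi * ℓ * -x / n = -(Real.pi * ℓ * x / n) by ring, Real.sin_neg]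
  ring

theorem heatSolution_add_right {n : ℕ} (hn : 0 < n) (f : ℝ → ℝ) (t x : ℝ) :
    heatSolution n f t (n + x) = -heatSolution n f t (n - x) := by
  have hn' : (n : ℝ) ≠ 0 := by exact_mod_cast hn.ne'
  simp only [heatSolution, ← Finset.sum_neg_distrib]
  refine Finset.sum_congr rfl fun ℓ _ => ?_
  rw [show Real.pi * ℓ * (n + x) / n = Real.pi * ℓ + Real.pi * ℓ * x / n by field_simp,
    show Real.pi * ℓ * (n - x) / n = Real.pi * ℓ - Real.pi * ℓ * x / n by field_simp,
    Real.sin_add, Real.sin_sub, sin_pi_mul_nat]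
  ring

theorem heatSolution_natCast {n : ℕ} (hn : 0 < n) (f : ℝ → ℝ) (t : ℝ) :
    heatSolution n f t n = 0 := by
  have h := heatSolution_add_right hn f t 0
  rw [add_zero, sub_zero] at h
  linarith

theorem hasDerivAt_heatSolution (n : ℕ) (f : ℝ → ℝ) (t x : ℝ) :
    HasDerivAt (fun s => heatSolution n f s x) ((n : ℝ) ^ 2 * (heatSolution n f t (x + 1)
      - 2 * heatSolution n f t x + heatSolution n f t (x - 1))) t := by
  have h := HasDerivAt.fun_sum (u := Finset.range n) (x := t) fun ℓ (_ : ℓ ∈ Finset.range n) =>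
    ((((hasDerivAt_id t).const_mul (-heatEigenvalue n ℓ)).exp).const_mul
      (sineCoeff n f ℓ)).mul_const (√2 * Real.sin (Real.pi * ℓ * x / n))
  refine h.congr_deriv ?_
  simp only [heatSolution]
  rw [Finset.mul_sum, ← Finset.sum_sub_distrib, ← Finset.sum_add_distrib, Finset.mul_sum]
  refine Finset.sum_congr rfl fun ℓ _ => ?_
  rw [show Real.pi * ℓ * (x + 1) / n = Real.pi * ℓ * x / n + 2 * (Real.pi * ℓ / (2 * n)) by
      field_simp,
    show Real.pi * ℓ * (x - 1) / n = Real.pi * ℓ * x / n - 2 * (Real.pi * ℓ / (2 * n)) by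
      field_simp, Real.sin_add, Real.sin_sub, Real.cos_two_mul, heatEigenvalue]
  have hsq := Real.sin_sq_add_cos_sq (Real.pi * ℓ / (2 * n))
  simp only [id]
  set E := Real.exp (-(4 * (n : ℝ) ^ 2 * Real.sin (Real.pi * ℓ / (2 * n)) ^ 2) * t)
  set S := Real.sin (Real.pi * ℓ * x / n)
  linear_combination (-4 * (n : ℝ) ^ 2 * sineCoeff n f ℓ * E * √2 * S) * hsq

/-- Multiplying by 2 sin φ telescopes the sum. Integrality of j enters only through sin(πj) = 0, so
that j may be a difference or a sum of casts. -/
theorem sum_cos_eq {n : ℕ} (hn : 0 < n) {j : ℝ} (hj : Real.sin (Real.pi * j) = 0)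
    (h0 : Real.sin (Real.pi * j / (2 * n)) ≠ 0) :
    ∑ ℓ ∈ Finset.range n, Real.cos (Real.pi * ℓ * j / n) = (1 - Real.cos (Real.pi * j)) / 2 := by
  have hn' : (n : ℝ) ≠ 0 := by exact_mod_cast hn.ne'
  set φ := Real.pi * j / (2 * n) with hφ
  have hstep : ∀ m : ℕ, 2 * Real.sin φ * ∑ ℓ ∈ Finset.range m, Real.cos (Real.pi * ℓ * j / n)
      = Real.sin ((2 * m - 1) * φ) + Real.sin φ := by
    intro m
    induction m with
    | zero => simp [Real.sin_neg]
    | succ m ih =>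
      rw [Finset.sum_range_succ, mul_add, ih]
      have e1 : Real.pi * m * j / n = 2 * m * φ := by rw [hφ]; field_simp
      have e2 : ((2 : ℝ) * (m + 1 : ℕ) - 1) * φ = 2 * m * φ + φ := by push_cast; ring
      have e3 : ((2 : ℝ) * m - 1) * φ = 2 * m * φ - φ := by ring
      rw [e1, e2, e3, Real.sin_add, Real.sin_sub]
      ring
  have h := hstep n
  have e : ((2 : ℝ) * n - 1) * φ = Real.pi * j - φ := by rw [hφ]; field_simp
  rw [e, Real.sin_sub, hj] at h
  have h2 : Real.sin φ * (∑ ℓ ∈ Finset.range n, Real.cos (Real.pi * ℓ * j / n)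
      - (1 - Real.cos (Real.pi * j)) / 2) = 0 := by linarith
  rcases mul_eq_zero.1 h2 with h3 | h3
  · exact absurd h3 h0
  · linarith

theorem sin_pi_mul_div_ne_zero {n : ℕ} {j : ℝ} (hj0 : 0 < j) (hj : j < 2 * n) :
    Real.sin (Real.pi * j / (2 * n)) ≠ 0 := by
  have hn : (0 : ℝ) < 2 * n := hj0.trans hj
  refine (Real.sin_pos_of_pos_of_lt_pi (by positivity) ?_).ne'
  rw [div_lt_iff₀ hn]
  exact mul_lt_mul_of_pos_left hj Real.pi_pos

/-- Orthogonality of the discrete sine functions. -/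
theorem sum_sin_mul_sin {n x y : ℕ} (hx0 : 0 < x) (hx : x < n) (hy0 : 0 < y) (hy : y < n) :
    ∑ ℓ ∈ Finset.range n, 2 * (Real.sin (Real.pi * ℓ * x / n) * Real.sin (Real.pi * ℓ * y / n))
      = if x = y then (n : ℝ) else 0 := by
  wlog hxy : y ≤ x generalizing x y
  · have h := this hy0 hy hx0 hx (not_le.1 hxy).le
    simp only [eq_comm (a := x), ← h]
    exact Finset.sum_congr rfl fun ℓ _ => by ring
  have hn : 0 < n := by omega
  have hn' : (n : ℝ) ≠ 0 := by exact_mod_cast hn.ne'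
  have hsplit : ∑ ℓ ∈ Finset.range n,
      2 * (Real.sin (Real.pi * ℓ * x / n) * Real.sin (Real.pi * ℓ * y / n))
      = ∑ ℓ ∈ Finset.range n, Real.cos (Real.pi * ℓ * ((x : ℝ) - y) / n)
        - ∑ ℓ ∈ Finset.range n, Real.cos (Real.pi * ℓ * ((x : ℝ) + y) / n) := by
    rw [← Finset.sum_sub_distrib]
    refine Finset.sum_congr rfl fun ℓ _ => ?_
    rw [show Real.pi * ℓ * ((x : ℝ) - y) / n = Real.pi * ℓ * x / n - Real.pi * ℓ * y / n by ring,
      show Real.pi * ℓ * ((x : ℝ) + y) / n = Real.pi * ℓ * x / n + Real.pi * ℓ * y / n by ring,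
      Real.cos_sub, Real.cos_add]
    ring
  have hx' : (x : ℝ) < n := by exact_mod_cast hx
  have hy' : (y : ℝ) < n := by exact_mod_cast hy
  have hx0' : (0 : ℝ) < x := by exact_mod_cast hx0
  have hy0' : (0 : ℝ) < y := by exact_mod_cast hy0
  have hp := sum_cos_eq hn (j := (x : ℝ) + y)
    (by rw [mul_add, Real.sin_add, sin_pi_mul_nat, sin_pi_mul_nat]; ring)
    (sin_pi_mul_div_ne_zero (by linarith) (by linarith))
  rw [hsplit, hp, mul_add, Real.cos_add, sin_pi_mul_nat, sin_pi_mul_nat]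
  split_ifs with h
  · subst h
    have h1 := Real.sin_sq_add_cos_sq (Real.pi * x)
    rw [sin_pi_mul_nat] at h1
    simp only [sub_self, mul_zero, zero_div, Real.cos_zero, Finset.sum_const, Finset.card_range,
      nsmul_eq_mul, mul_one]
    linarith
  · have hlt : (y : ℝ) < x := by exact_mod_cast lt_of_le_of_ne hxy (Ne.symm h)
    rw [sum_cos_eq hn (j := (x : ℝ) - y)
      (by rw [mul_sub, Real.sin_sub, sin_pi_mul_nat, sin_pi_mul_nat]; ring)
      (sin_pi_mul_div_ne_zero (by linarith) (by linarith)), mul_sub, Real.cos_sub,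
      sin_pi_mul_nat, sin_pi_mul_nat]
    ring

/-- Inversion of the discrete sine transform, by orthogonality summed over the frequencies. -/
theorem heatSolution_zero_left {n : ℕ} {f : ℝ → ℝ} (hf0 : f 0 = 0) (hf1 : f 1 = 0) {x : ℕ}
    (hx : x ≤ n) : heatSolution n f 0 x = f (x / n) := by
  rcases Nat.eq_zero_or_pos x with rfl | hx0
  · simp [heatSolution_zero_right, hf0]
  have hn : 0 < n := by omega
  have hn' : (n : ℝ) ≠ 0 := by exact_mod_cast hn.ne'
  rcases hx.eq_or_lt with rfl | hxn
  · rw [heatSolution_natCast hn, div_self hn', hf1]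
  have h2 : √2 * √2 = (2 : ℝ) := Real.mul_self_sqrt (by norm_num)
  calc heatSolution n f 0 x
      = ∑ ℓ ∈ Finset.range n, ∑ y ∈ Finset.range n, f (y / n) / n
          * (2 * (Real.sin (Real.pi * ℓ * x / n) * Real.sin (Real.pi * ℓ * y / n))) := by
        simp only [heatSolution, sineCoeff, mul_zero, Real.exp_zero, mul_one]
        refine Finset.sum_congr rfl fun ℓ _ => ?_
        rw [mul_assoc, Finset.sum_mul, Finset.mul_sum]
        refine Finset.sum_congr rfl fun y _ => ?_
        linear_combination (f (y / n) * Real.sin (Real.pi * ℓ * y / n)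
          * Real.sin (Real.pi * ℓ * x / n) / n) * h2
    _ = ∑ y ∈ Finset.range n, f (y / n) / n * if x = y then (n : ℝ) else 0 := by
        rw [Finset.sum_comm]
        refine Finset.sum_congr rfl fun y hy => ?_
        rw [← Finset.mul_sum]
        rcases Nat.eq_zero_or_pos y with rfl | hy0
        · simp [hf0]
        · rw [sum_sin_mul_sin hx0 hxn hy0 (Finset.mem_range.1 hy)]
    _ = f (x / n) := by
        simp only [mul_ite, mul_zero, Finset.sum_ite_eq, Finset.mem_range, hxn, if_true]
        field_simp

/-- Jordan's inequality for the sine on [0, π/2]; not sharp, but uniform in n. -/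
theorem four_mul_sq_le_heatEigenvalue {n ℓ : ℕ} (hℓ : ℓ ≤ n) :
    4 * (ℓ : ℝ) ^ 2 ≤ heatEigenvalue n ℓ := by
  rcases Nat.eq_zero_or_pos n with rfl | hn
  · obtain rfl : ℓ = 0 := by omega
    simp [heatEigenvalue]
  have hn' : (0 : ℝ) < n := by exact_mod_cast hn
  have hℓ' : (ℓ : ℝ) ≤ n := by exact_mod_cast hℓ
  have h := Real.mul_le_sin (x := Real.pi * ℓ / (2 * n)) (by positivity) (by
    rw [div_le_div_iff₀ (by positivity) (by norm_num)]
    nlinarith [Real.pi_pos])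
  have e : 2 / Real.pi * (Real.pi * ℓ / (2 * n)) = ℓ / n := by
    have := Real.pi_pos; field_simp
  rw [e] at h
  have h2 := pow_le_pow_left₀ (by positivity) h 2
  rw [heatEigenvalue]
  calc 4 * (ℓ : ℝ) ^ 2 = 4 * (n : ℝ) ^ 2 * (ℓ / n : ℝ) ^ 2 := by field_simp
    _ ≤ _ := mul_le_mul_of_nonneg_left h2 (by positivity)

theorem abs_sineCoeff_le {n : ℕ} {f : ℝ → ℝ} (hf : ∀ x ∈ Icc (0 : ℝ) 1, |f x| ≤ 1) (ℓ : ℕ) :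
    |sineCoeff n f ℓ| ≤ √2 := by
  rcases Nat.eq_zero_or_pos n with rfl | hn
  · simp [sineCoeff]
  have hn' : (0 : ℝ) < n := by exact_mod_cast hn
  have h : |∑ y ∈ Finset.range n, f (y / n) * Real.sin (Real.pi * ℓ * y / n)| ≤ n := by
    refine (Finset.abs_sum_le_sum_abs _ _).trans ?_
    calc _ ≤ ∑ y ∈ Finset.range n, (1 : ℝ) := by
          refine Finset.sum_le_sum fun y hy => ?_
          have hy' : (y : ℝ) ≤ n := by exact_mod_cast (Finset.mem_range.1 hy).le
          rw [abs_mul]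
          exact mul_le_one₀ (hf _ ⟨by positivity, (div_le_one hn').2 hy'⟩) (abs_nonneg _)
            (Real.abs_sin_le_one _)
      _ = n := by simp
  rw [sineCoeff, abs_mul, abs_of_nonneg (by positivity)]
  calc √2 / n * _ ≤ √2 / n * n := mul_le_mul_of_nonneg_left h (by positivity)
    _ = √2 := by field_simp

theorem abs_sin_sub_sin_le (a b : ℝ) : |Real.sin a - Real.sin b| ≤ |a - b| := by
  simpa [Real.dist_eq] using Real.lipschitzWith_sin.dist_le_mul a b

/-! ### Gradient bounds for the heat equation -/

/-- Maximum principle for the discrete gradient. -/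
theorem abs_heatSolution_gradient_le {n : ℕ} (hn : 0 < n) {f : ℝ → ℝ} (hf0 : f 0 = 0)
    (hf1 : f 1 = 0) {K : ℝ} (hK : 0 ≤ K)
    (hf : ∀ x ∈ Icc (0 : ℝ) 1, ∀ y ∈ Icc (0 : ℝ) 1, |f x - f y| ≤ K * |x - y|) {t : ℝ}
    (ht : 0 ≤ t) {x : ℕ} (hx : x < n) :
    |heatSolution n f t (x + 1) - heatSolution n f t x| ≤ K / n := by
  have hn' : (0 : ℝ) < n := by exact_mod_cast hn
  let p : ℝ → ℝ → ℝ := fun s z => heatSolution n f s (z + 1) - heatSolution n f s z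
  -- The exponential removes the diagonal of the Laplacian, leaving n^2 times a sum of two
  -- neighbours. Grönwall then gives growth e^{2n²t}, which the same factor cancels exactly.
  let q : ℝ → Fin n → ℝ := fun s i => Real.exp (2 * (n : ℝ) ^ 2 * s) * p s i
  let q' : ℝ → Fin n → ℝ := fun s i =>
    Real.exp (2 * (n : ℝ) ^ 2 * s) * ((n : ℝ) ^ 2 * (p s (i + 1) + p s (i - 1)))
  have hq : ∀ s, HasDerivAt q (q' s) s := by
    intro s
    rw [hasDerivAt_pi]
    intro i
    have h1 : HasDerivAt (fun s : ℝ => 2 * (n : ℝ) ^ 2 * s) (2 * (n : ℝ) ^ 2) s := by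
      simpa using (hasDerivAt_id s).const_mul (2 * (n : ℝ) ^ 2)
    refine ((h1.exp).mul ((hasDerivAt_heatSolution n f s ((i : ℝ) + 1)).sub
      (hasDerivAt_heatSolution n f s (i : ℝ)))).congr_deriv ?_
    simp only [q', p, Pi.sub_apply]
    rw [show (i : ℝ) + 1 - 1 = i by ring, show (i : ℝ) - 1 + 1 = i by ring]
    ring
  have hpq : ∀ s (i : Fin n), |Real.exp (2 * (n : ℝ) ^ 2 * s) * p s i| ≤ ‖q s‖ := fun s i =>
    norm_le_pi_norm (q s) i
  have hbound : ∀ s, ‖q' s‖ ≤ 2 * (n : ℝ) ^ 2 * ‖q s‖ := by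
    intro s
    rw [pi_norm_le_iff_of_nonneg (by positivity)]
    intro i
    have hup : |Real.exp (2 * (n : ℝ) ^ 2 * s) * p s (i + 1)| ≤ ‖q s‖ := by
      by_cases hi : (i : ℕ) + 1 < n
      · have := hpq s ⟨i + 1, hi⟩
        simpa using this
      · have hin : ((i : ℕ) : ℝ) + 1 = n := by
          have : (i : ℕ) + 1 = n := by have := i.2; omega
          exact_mod_cast this
        -- By odd reflection of the solution the gradient is even about the end, that is, it
        -- satisfies a Neumann condition.
        have e : p s (i + 1) = p s i := by
          simp only [p]
          rw [hin, heatSolution_add_right hn, heatSolution_natCast hn,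
            show (i : ℝ) = n - 1 by linarith]
          ring
        rw [e]; exact hpq s i
    have hdown : |Real.exp (2 * (n : ℝ) ^ 2 * s) * p s (i - 1)| ≤ ‖q s‖ := by
      rcases Nat.eq_zero_or_pos (i : ℕ) with hi | hi
      · have e : p s (i - 1) = p s i := by
          simp only [p, hi, Nat.cast_zero, zero_sub, zero_add]
          rw [heatSolution_neg, neg_add_cancel, heatSolution_zero_right]
          ring
        rw [e]; exact hpq s i
      · have := hpq s ⟨i - 1, by have := i.2; omega⟩
        simp only [Nat.cast_pred hi] at this
        exact this
    have e : q' s i = (n : ℝ) ^ 2 * (Real.exp (2 * (n : ℝ) ^ 2 * s) * p s (i + 1)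
        + Real.exp (2 * (n : ℝ) ^ 2 * s) * p s (i - 1)) := by simp only [q']; ring
    rw [Real.norm_eq_abs, e, abs_mul, abs_of_nonneg (by positivity : (0 : ℝ) ≤ (n : ℝ) ^ 2)]
    calc _ ≤ (n : ℝ) ^ 2 * (‖q s‖ + ‖q s‖) :=
          mul_le_mul_of_nonneg_left ((abs_add_le _ _).trans (add_le_add hup hdown)) (by positivity)
      _ = _ := by ring
  have hstart : ‖q 0‖ ≤ K / n := by
    rw [pi_norm_le_iff_of_nonneg (by positivity)]
    intro i
    have hi : (i : ℕ) < n := i.2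
    have hi' : ((i : ℕ) : ℝ) + 1 ≤ n := by exact_mod_cast hi
    simp only [q, p, mul_zero, Real.exp_zero, one_mul, Real.norm_eq_abs]
    have e := heatSolution_zero_left hf0 hf1 (x := (i : ℕ) + 1) (n := n) hi
    push_cast at e
    rw [e, heatSolution_zero_left hf0 hf1 hi.le]
    refine (hf _ ⟨by positivity, (div_le_one hn').2 hi'⟩ _
      ⟨by positivity, (div_le_one hn').2 (by linarith)⟩).trans (le_of_eq ?_)
    rw [show (((i : ℕ) : ℝ) + 1) / n - (i : ℕ) / n = 1 / n by ring, abs_of_pos (by positivity)]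
    ring
  have hgr := norm_le_gronwallBound_of_norm_deriv_right_le (f := q) (f' := q') (a := 0) (b := t)
    (δ := K / n) (K := 2 * (n : ℝ) ^ 2) (ε := 0)
    (fun s _ => (hq s).continuousAt.continuousWithinAt)
    (fun s _ => (hq s).hasDerivWithinAt) hstart (fun s _ => by simpa using hbound s) t ⟨ht, le_rfl⟩
  rw [gronwallBound_ε0, sub_zero] at hgr
  have h := (hpq t ⟨x, hx⟩).trans hgr
  rw [abs_mul, abs_of_pos (Real.exp_pos _), mul_comm] at h
  exact le_of_mul_le_mul_right h (Real.exp_pos _)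

/-- Mode by mode, 4ℓ²t ≥ t + 3ℓ for t ≥ 1: one factor e^{-ℓ} absorbs the ℓ of the gradient and the
rest is summable. Shorter times are left to the maximum principle. -/
theorem abs_heatSolution_gradient_le_exp {n : ℕ} (hn : 0 < n) {f : ℝ → ℝ}
    (hf : ∀ x ∈ Icc (0 : ℝ) 1, |f x| ≤ 1) {t : ℝ} (ht : 1 ≤ t) (x : ℝ) :
    |heatSolution n f t (x + 1) - heatSolution n f t x| ≤ 4 * Real.pi * Real.exp (-t) / n := by
  have hn' : (0 : ℝ) < n := by exact_mod_cast hn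
  have h2 : √2 * √2 = (2 : ℝ) := Real.mul_self_sqrt (by norm_num)
  have hterm : ∀ ℓ ∈ Finset.range n, |sineCoeff n f ℓ * Real.exp (-heatEigenvalue n ℓ * t)
        * (√2 * Real.sin (Real.pi * ℓ * (x + 1) / n))
      - sineCoeff n f ℓ * Real.exp (-heatEigenvalue n ℓ * t)
        * (√2 * Real.sin (Real.pi * ℓ * x / n))|
      ≤ 2 * Real.pi * Real.exp (-t) / n * (1 / 2 : ℝ) ^ ℓ := by
    intro ℓ hℓ
    rcases Nat.eq_zero_or_pos ℓ with rfl | hℓ0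
    · simp only [Nat.cast_zero, mul_zero, zero_mul, zero_div, Real.sin_zero, sub_self, abs_zero]
      positivity
    have hℓ1 : (1 : ℝ) ≤ ℓ := by exact_mod_cast hℓ0
    have hexp : Real.exp (-heatEigenvalue n ℓ * t) * ℓ ≤ Real.exp (-t) * (1 / 2 : ℝ) ^ ℓ := by
      have h1 := four_mul_sq_le_heatEigenvalue (Finset.mem_range.1 hℓ).le
      have h3 : -heatEigenvalue n ℓ * t ≤ -t + -(3 * ℓ) := by
        have g1 := mul_le_mul_of_nonneg_right h1 (by linarith : 0 ≤ t)
        have g2 : (ℓ : ℝ) * t ≤ (ℓ : ℝ) ^ 2 * t := by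
          refine mul_le_mul_of_nonneg_right ?_ (by linarith)
          nlinarith
        have g3 : t ≤ ℓ * t := by nlinarith
        have g4 : (ℓ : ℝ) ≤ ℓ * t := by nlinarith
        linarith
      have h4 : Real.exp (-heatEigenvalue n ℓ * t) ≤ Real.exp (-t) * Real.exp (-(3 * ℓ)) := by
        rw [← Real.exp_add]; exact Real.exp_le_exp.2 h3
      have h5 : (ℓ : ℝ) ≤ Real.exp ℓ := by linarith [Real.add_one_le_exp (ℓ : ℝ)]
      have h6 : Real.exp (-(3 * ℓ)) * Real.exp ℓ ≤ (1 / 2 : ℝ) ^ ℓ := by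
        rw [← Real.exp_add, show -(3 * (ℓ : ℝ)) + ℓ = ℓ * (-2) by ring, Real.exp_nat_mul]
        refine pow_le_pow_left₀ (Real.exp_pos _).le ?_ ℓ
        rw [Real.exp_neg, one_div]
        exact inv_anti₀ (by norm_num) (by linarith [Real.add_one_le_exp (2 : ℝ)])
      calc _ ≤ Real.exp (-t) * Real.exp (-(3 * ℓ)) * Real.exp ℓ :=
            mul_le_mul h4 h5 (by positivity) (by positivity)
        _ = Real.exp (-t) * (Real.exp (-(3 * ℓ)) * Real.exp ℓ) := by ring
        _ ≤ _ := mul_le_mul_of_nonneg_left h6 (Real.exp_pos _).le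
    have hsin : |Real.sin (Real.pi * ℓ * (x + 1) / n) - Real.sin (Real.pi * ℓ * x / n)|
        ≤ Real.pi * ℓ / n := by
      refine (abs_sin_sub_sin_le _ _).trans (le_of_eq ?_)
      rw [show Real.pi * ℓ * (x + 1) / n - Real.pi * ℓ * x / n = Real.pi * ℓ / n by ring]
      exact abs_of_nonneg (by positivity)
    rw [← mul_sub, ← mul_sub, abs_mul, abs_mul, abs_mul, abs_of_pos (Real.exp_pos _),
      abs_of_nonneg (Real.sqrt_nonneg 2)]
    calc _ ≤ √2 * Real.exp (-heatEigenvalue n ℓ * t) * (√2 * (Real.pi * ℓ / n)) := by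
          gcongr
          exact abs_sineCoeff_le hf ℓ
      _ = 2 * Real.pi / n * (Real.exp (-heatEigenvalue n ℓ * t) * ℓ) := by
          linear_combination (Real.exp (-heatEigenvalue n ℓ * t) * (Real.pi * ℓ / n)) * h2
      _ ≤ 2 * Real.pi / n * (Real.exp (-t) * (1 / 2 : ℝ) ^ ℓ) :=
          mul_le_mul_of_nonneg_left hexp (by positivity)
      _ = _ := by ring
  rw [heatSolution, heatSolution, ← Finset.sum_sub_distrib]
  refine (Finset.abs_sum_le_sum_abs _ _).trans ((Finset.sum_le_sum hterm).trans ?_)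
  rw [← Finset.mul_sum]
  calc _ ≤ 2 * Real.pi * Real.exp (-t) / n * 2 :=
        mul_le_mul_of_nonneg_left (sum_geometric_two_le n) (by positivity)
    _ = _ := by ring

/-- The squared discrete gradient decays exponentially, uniformly in the size of the system. -/
theorem sq_heatSolution_gradient_le {n : ℕ} (hn : 0 < n) {f : ℝ → ℝ} (hf0 : f 0 = 0)
    (hf1 : f 1 = 0) {K : ℝ} (hK : 0 ≤ K)
    (hf : ∀ x ∈ Icc (0 : ℝ) 1, ∀ y ∈ Icc (0 : ℝ) 1, |f x - f y| ≤ K * |x - y|)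
    (hfb : ∀ x ∈ Icc (0 : ℝ) 1, |f x| ≤ 1) {t : ℝ} (ht : 0 ≤ t) {x : ℕ} (hx : x < n) :
    (n : ℝ) ^ 2 * (heatSolution n f t (x + 1) - heatSolution n f t x) ^ 2
      ≤ (3 * K ^ 2 + 16 * Real.pi ^ 2) * Real.exp (-t) := by
  have hn' : (0 : ℝ) < n := by exact_mod_cast hn
  have hE := Real.exp_pos (-t)
  rw [← mul_pow, ← sq_abs, abs_mul, abs_of_pos hn']
  rcases le_total t 1 with h | h
  · have h1 := mul_le_mul_of_nonneg_left
      (abs_heatSolution_gradient_le hn hf0 hf1 hK hf ht hx) hn'.le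
    rw [mul_div_cancel₀ _ hn'.ne'] at h1
    have h2 := pow_le_pow_left₀ (by positivity) h1 2
    have h3 : 1 ≤ 3 * Real.exp (-t) := by
      have h4 : Real.exp t ≤ 3 := by
        have := Real.exp_le_exp.2 h
        linarith [Real.exp_one_lt_d9]
      have : Real.exp t * Real.exp (-t) = 1 := by rw [← Real.exp_add]; simp
      nlinarith
    have h5 : 0 ≤ K ^ 2 := sq_nonneg K
    have h6 : 0 ≤ 16 * Real.pi ^ 2 * Real.exp (-t) := by positivity
    nlinarith
  · have h1 := mul_le_mul_of_nonneg_left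
      (abs_heatSolution_gradient_le_exp hn hfb h (x : ℝ)) hn'.le
    rw [mul_div_cancel₀ _ hn'.ne'] at h1
    have h2 := pow_le_pow_left₀ (by positivity) h1 2
    have h3 : Real.exp (-t) ≤ 1 := Real.exp_le_one_iff.2 (by linarith)
    have h5 : 0 ≤ 3 * K ^ 2 * Real.exp (-t) := by positivity
    have h6 : (4 * Real.pi * Real.exp (-t)) ^ 2 ≤ 16 * Real.pi ^ 2 * Real.exp (-t) := by
      have : 0 ≤ 16 * Real.pi ^ 2 * Real.exp (-t) := by positivity
      nlinarith
    linarith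

/-! ### The density profile with reservoirs -/

theorem sum_edges_fst {n : ℕ} (H : ℕ → ℝ) (x : Site n) :
    ∑ e ∈ edges n, (if e.1 = x then H e.2 - H e.1 else 0)
      = if (x : ℕ) + 1 < n then H (x + 1) - H x else 0 := by
  rw [edges, Finset.sum_filter, Fintype.sum_prod_type]
  rw [Finset.sum_eq_single x (fun y _ hy => Finset.sum_eq_zero fun z _ => by simp [hy])
    (fun h => absurd (Finset.mem_univ x) h)]
  simp only [if_true]
  split_ifs with h
  · have hx := Finset.mem_Ico.1 x.2
    let z : Site n := ⟨x + 1, Finset.mem_Ico.2 ⟨by omega, h⟩⟩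
    rw [Finset.sum_eq_single z (fun y _ hy => if_neg fun h' => hy (Subtype.ext h'))
      (fun h => absurd (Finset.mem_univ z) h)]
    simp [z]
  · refine Finset.sum_eq_zero fun z _ => if_neg fun h' => ?_
    have := (Finset.mem_Ico.1 z.2).2
    omega

theorem sum_edges_snd {n : ℕ} (H : ℕ → ℝ) (x : Site n) :
    ∑ e ∈ edges n, (if e.2 = x then H e.2 - H e.1 else 0)
      = if 1 < (x : ℕ) then H x - H (x - 1) else 0 := by
  have hx := Finset.mem_Ico.1 x.2
  rw [edges, Finset.sum_filter, Fintype.sum_prod_type_right]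
  rw [Finset.sum_eq_single x (fun y _ hy => Finset.sum_eq_zero fun z _ => by simp [hy])
    (fun h => absurd (Finset.mem_univ x) h)]
  simp only [if_true]
  split_ifs with h
  · let z : Site n := ⟨x - 1, Finset.mem_Ico.2 ⟨by omega, by omega⟩⟩
    rw [Finset.sum_eq_single z (fun y _ hy => if_neg fun h' => hy (Subtype.ext (by
      simp only [z]; omega))) (fun h => absurd (Finset.mem_univ z) h)]
    rw [if_pos (by simp only [z]; omega)]
  · refine Finset.sum_eq_zero fun z _ => if_neg fun h' => ?_
    have := (Finset.mem_Ico.1 z.2).1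
    omega

/-- The density profile solving the discrete heat equation with reservoirs. -/
noncomputable def profile (n : ℕ) (ρ : ℝ) (f : ℝ → ℝ) (t : ℝ) (x : Site n) : ℝ :=
  ρ + heatSolution n f t (x : ℕ)

/-- False for n = 2: the single site is then in contact with one reservoir only, whereas the second
difference sees two zero neighbours. -/
theorem hasDerivAt_profile {n : ℕ} (hn : 3 ≤ n) (ρ : ℝ) (f : ℝ → ℝ) (t : ℝ) (x : Site n) :
    HasDerivAt (fun s => profile n ρ f s x) (heatDrift n ρ (profile n ρ f t) x) t := by
  have hx := Finset.mem_Ico.1 x.2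
  refine ((hasDerivAt_heatSolution n f t (x : ℕ)).const_add ρ).congr_deriv ?_
  let H : ℕ → ℝ := fun k => heatSolution n f t k
  have hH0 : H 0 = 0 := by simp [H, heatSolution_zero_right]
  have hHn : H n = 0 := heatSolution_natCast (by omega) f t
  have hprof : ∀ y z : Site n, profile n ρ f t y - profile n ρ f t z = H y - H z := fun y z => by
    simp only [profile, H]; ring
  have hb : ρ - profile n ρ f t x = -H x := by simp only [profile, H]; ring
  rw [heatDrift, Finset.sum_sub_distrib]
  simp only [hprof, hb, mem_boundary]
  rw [sum_edges_fst H x, sum_edges_snd H x]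
  have e1 : heatSolution n f t ((x : ℕ) + 1) = H (x + 1) := by simp [H]
  have e2 : heatSolution n f t ((x : ℕ) - 1) = H (x - 1) := by simp [H, Nat.cast_pred hx.1]
  have e3 : heatSolution n f t (x : ℕ) = H x := rfl
  rw [e1, e2, e3]
  by_cases h1 : (x : ℕ) = 1
  · rw [h1, if_pos (by omega), if_neg (by omega), if_pos (Or.inl rfl)]
    simp only [Nat.sub_self, hH0]
    ring
  · by_cases h2 : (x : ℕ) = n - 1
    · rw [if_neg (by omega), if_pos (by omega), if_pos (Or.inr h2),
        show (x : ℕ) + 1 = n by omega, hHn]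
      ring
    · rw [if_pos (by omega), if_pos (by omega), if_neg (by tauto)]
      ring

/-! ### Asymptotics at the cutoff time -/

theorem abs_riemannSum_sub_integral_le {F : ℝ → ℝ} {K : ℝ} (hK : 0 ≤ K)
    (hF : ∀ x ∈ Icc (0 : ℝ) 1, ∀ y ∈ Icc (0 : ℝ) 1, |F x - F y| ≤ K * |x - y|) {n : ℕ}
    (hn : 0 < n) :
    |1 / (n : ℝ) * ∑ y ∈ Finset.range n, F (y / n) - ∫ x in (0 : ℝ)..1, F x| ≤ K / n := by
  have hn' : (0 : ℝ) < n := by exact_mod_cast hn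
  have hcont : ContinuousOn F (Icc 0 1) := by
    have hL : LipschitzOnWith K.toNNReal F (Icc 0 1) :=
      LipschitzOnWith.of_dist_le_mul fun x hx y hy => by
        rw [Real.dist_eq, Real.dist_eq, Real.coe_toNNReal K hK]
        exact hF x hx y hy
    exact hL.continuousOn
  have hmem : ∀ k : ℕ, k ≤ n → ((k : ℝ) / n) ∈ Icc (0 : ℝ) 1 := fun k hk =>
    ⟨by positivity, (div_le_one hn').2 (by exact_mod_cast hk)⟩
  have hle : ∀ k : ℕ, (k : ℝ) / n ≤ (k + 1 : ℕ) / n := fun k => by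
    gcongr; exact Nat.le_succ k
  have hsub : ∀ k : ℕ, k < n → uIcc ((k : ℝ) / n) ((k + 1 : ℕ) / n) ⊆ Icc 0 1 := fun k hk => by
    rw [uIcc_of_le (hle k)]
    exact Icc_subset_Icc (hmem k hk.le).1 (hmem (k + 1) hk).2
  have hfi : ∀ k : ℕ, k < n →
      IntervalIntegrable F volume ((k : ℝ) / n) ((k + 1 : ℕ) / n) := fun k hk =>
    (hcont.mono (hsub k hk)).intervalIntegrable
  have hsum := intervalIntegral.sum_integral_adjacent_intervals (f := F) (μ := volume)
    (a := fun k : ℕ => (k : ℝ) / n) (n := n) hfi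
  simp only [Nat.cast_zero, zero_div, div_self hn'.ne'] at hsum
  rw [← hsum, Finset.mul_sum, ← Finset.sum_sub_distrib]
  have hterm : ∀ k ∈ Finset.range n,
      |1 / (n : ℝ) * F (k / n) - ∫ x in ((k : ℝ) / n)..((k + 1 : ℕ) / n), F x|
        ≤ K / n * (1 / n) := by
    intro k hk
    have hk' := Finset.mem_range.1 hk
    have hlen : ((k + 1 : ℕ) : ℝ) / n - k / n = 1 / n := by push_cast; ring
    have e : 1 / (n : ℝ) * F (k / n) = ∫ _ in ((k : ℝ) / n)..((k + 1 : ℕ) / n), F (k / n) := by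
      rw [intervalIntegral.integral_const, hlen, smul_eq_mul]
    rw [e, ← intervalIntegral.integral_sub intervalIntegrable_const (hfi k hk')]
    have h := intervalIntegral.norm_integral_le_of_norm_le_const (C := K / n)
      (f := fun x => F (k / n) - F x) (a := (k : ℝ) / n) (b := (k + 1 : ℕ) / n) fun x hx => by
        rw [uIoc_of_le (hle k)] at hx
        have hx' : x ∈ Icc (0 : ℝ) 1 := hsub k hk' (by
          rw [uIcc_of_le (hle k)]; exact ⟨hx.1.le, hx.2⟩)
        refine (hF _ (hmem k hk'.le) x hx').trans ?_
        rw [abs_sub_comm, abs_of_nonneg (by linarith [hx.1]), div_eq_mul_one_div K]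
        exact mul_le_mul_of_nonneg_left (by linarith [hx.2]) hK
    rwa [hlen, abs_of_pos (by positivity), Real.norm_eq_abs] at h
  refine (Finset.abs_sum_le_sum_abs _ _).trans ((Finset.sum_le_sum hterm).trans (le_of_eq ?_))
  rw [Finset.sum_const, Finset.card_range, nsmul_eq_mul]
  field_simp

/-- The rate 1/n matters: it beats the factor √n in the modes below ℓ₀, whose continuous
coefficients vanish. -/
theorem abs_sineCoeff_sub_le {f : ℝ → ℝ} {K : ℝ} (hK : 0 ≤ K)
    (hf : ∀ x ∈ Icc (0 : ℝ) 1, ∀ y ∈ Icc (0 : ℝ) 1, |f x - f y| ≤ K * |x - y|)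
    (hfb : ∀ x ∈ Icc (0 : ℝ) 1, |f x| ≤ 1) (ℓ : ℕ) {n : ℕ} (hn : 0 < n) :
    |sineCoeff n f ℓ - √2 * ∫ x in (0 : ℝ)..1, f x * Real.sin (Real.pi * ℓ * x)|
      ≤ √2 * ((K + Real.pi * ℓ) / n) := by
  have hπ := Real.pi_pos
  have h := abs_riemannSum_sub_integral_le (F := fun x => f x * Real.sin (Real.pi * ℓ * x))
    (K := K + Real.pi * ℓ) (by positivity) (fun x hx y hy => by
      have e : f x * Real.sin (Real.pi * ℓ * x) - f y * Real.sin (Real.pi * ℓ * y)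
          = (f x - f y) * Real.sin (Real.pi * ℓ * x)
            + f y * (Real.sin (Real.pi * ℓ * x) - Real.sin (Real.pi * ℓ * y)) := by ring
      rw [e, add_mul]
      refine (abs_add_le _ _).trans (add_le_add ?_ ?_)
      · rw [abs_mul]
        calc _ ≤ |f x - f y| * 1 :=
              mul_le_mul_of_nonneg_left (Real.abs_sin_le_one _) (abs_nonneg _)
          _ ≤ _ := by rw [mul_one]; exact hf x hx y hy
      · rw [abs_mul]
        calc _ ≤ 1 * |Real.pi * ℓ * x - Real.pi * ℓ * y| :=
              mul_le_mul (hfb y hy) (abs_sin_sub_sin_le _ _) (abs_nonneg _) zero_le_one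
          _ = _ := by
              rw [one_mul, ← mul_sub, abs_mul, abs_of_nonneg (by positivity)]) hn
  have e : sineCoeff n f ℓ
      = √2 * (1 / n * ∑ y ∈ Finset.range n, f (y / n) * Real.sin (Real.pi * ℓ * (y / n))) := by
    rw [sineCoeff]
    simp_rw [mul_div_assoc]
    ring
  rw [e, ← mul_sub, abs_mul, abs_of_nonneg (Real.sqrt_nonneg 2)]
  exact mul_le_mul_of_nonneg_left h (Real.sqrt_nonneg 2)

theorem heatEigenvalue_le (n ℓ : ℕ) : heatEigenvalue n ℓ ≤ Real.pi ^ 2 * (ℓ : ℝ) ^ 2 := by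
  rcases Nat.eq_zero_or_pos n with rfl | hn
  · simp only [heatEigenvalue, Nat.cast_zero]
    simp only [ne_eq, OfNat.ofNat_ne_zero, not_false_eq_true, zero_pow, mul_zero, zero_mul]
    positivity
  have hn' : (0 : ℝ) < n := by exact_mod_cast hn
  have h := Real.abs_sin_le_abs (x := Real.pi * ℓ / (2 * n))
  have h2 := sq_le_sq.2 h
  calc heatEigenvalue n ℓ ≤ 4 * (n : ℝ) ^ 2 * (Real.pi * ℓ / (2 * n)) ^ 2 :=
        mul_le_mul_of_nonneg_left h2 (by positivity)
    _ = _ := by field_simp; ring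

theorem heatEigenvalue_nonneg (n ℓ : ℕ) : 0 ≤ heatEigenvalue n ℓ := by
  unfold heatEigenvalue; positivity

/-- From the cubic lower bound for the sine. An error of order n^{-2} is negligible against a time
of order log n, so the discrete eigenvalues can be replaced by π²ℓ². -/
theorem sub_heatEigenvalue_le {n ℓ : ℕ} (hn : 0 < n) :
    Real.pi ^ 2 * (ℓ : ℝ) ^ 2 - heatEigenvalue n ℓ ≤ Real.pi ^ 4 * (ℓ : ℝ) ^ 4 / (8 * n ^ 2) := by
  have hn' : (0 : ℝ) < n := by exact_mod_cast hn
  have hπ := Real.pi_pos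
  rcases Nat.eq_zero_or_pos ℓ with rfl | hℓ
  · simp [heatEigenvalue]
  have hℓ' : (0 : ℝ) < ℓ := by exact_mod_cast hℓ
  set y := Real.pi * ℓ / (2 * n) with hy
  have hy0 : 0 < y := by positivity
  have h1 := Real.sin_gt_sub_cube hy0
  have h2 := Real.sin_lt hy0
  have e1 : Real.pi ^ 2 * (ℓ : ℝ) ^ 2 = 4 * (n : ℝ) ^ 2 * y ^ 2 := by rw [hy]; field_simp; ring
  have e2 : Real.pi ^ 4 * (ℓ : ℝ) ^ 4 / (8 * n ^ 2) = 4 * (n : ℝ) ^ 2 * (y ^ 4 / 2) := by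
    rw [hy]; field_simp; ring
  rw [e1, e2, heatEigenvalue, ← mul_sub]
  refine mul_le_mul_of_nonneg_left ?_ (by positivity)
  have h3 : 0 ≤ y - Real.sin y := by linarith
  have h4 : y - Real.sin y ≤ y ^ 3 / 4 := by linarith [pow_pos hy0 3]
  have h5 : y + Real.sin y ≤ 2 * y := by linarith
  calc y ^ 2 - Real.sin y ^ 2 = (y - Real.sin y) * (y + Real.sin y) := by ring
    _ ≤ (y - Real.sin y) * (2 * y) := mul_le_mul_of_nonneg_left h5 h3
    _ ≤ y ^ 3 / 4 * (2 * y) := mul_le_mul_of_nonneg_right h4 (by positivity)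
    _ = y ^ 4 / 2 := by ring

theorem tendsto_cutoffTime {ℓ₀ : ℕ} (hℓ₀ : 1 ≤ ℓ₀) (b : ℝ) :
    Tendsto (fun n : ℕ => cutoffTime ℓ₀ n b) atTop atTop := by
  have hℓ : (0 : ℝ) < ℓ₀ := by exact_mod_cast hℓ₀
  have hπ := Real.pi_pos
  unfold cutoffTime
  refine tendsto_atTop_add_const_right _ _ (Tendsto.const_mul_atTop (by positivity) ?_)
  exact Real.tendsto_log_atTop.comp tendsto_natCast_atTop_atTop

theorem tendsto_eigenvalue_sub_mul_cutoffTime (ℓ₀ : ℕ) (b : ℝ) (ℓ : ℕ) :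
    Tendsto (fun n : ℕ => (Real.pi ^ 2 * (ℓ : ℝ) ^ 2 - heatEigenvalue n ℓ) * cutoffTime ℓ₀ n b)
      atTop (𝓝 0) := by
  have hcast : Tendsto (fun n : ℕ => (n : ℝ)) atTop atTop := tendsto_natCast_atTop_atTop
  set C := Real.pi ^ 4 * (ℓ : ℝ) ^ 4 / 8 with hC
  have hlog : Tendsto (fun n : ℕ => Real.log n / (n : ℝ)) atTop (𝓝 0) := by
    have := (Real.isLittleO_log_id_atTop.tendsto_div_nhds_zero).comp hcast
    simpa [Function.comp_def] using this
  have hinv : Tendsto (fun n : ℕ => 1 / (n : ℝ)) atTop (𝓝 0) := tendsto_one_div_atTop_nhds_zero_nat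
  have ht : Tendsto (fun n : ℕ => cutoffTime ℓ₀ n b / n) atTop (𝓝 0) := by
    have h := (hlog.const_mul (1 / (2 * Real.pi ^ 2 * (ℓ₀ : ℝ) ^ 2))).add
      (hinv.const_mul (b / (Real.pi ^ 2 * (ℓ₀ : ℝ) ^ 2)))
    simp only [mul_zero, add_zero] at h
    refine h.congr fun n => ?_
    rw [cutoffTime]; ring
  have hbd : Tendsto (fun n : ℕ => C * (1 / (n : ℝ)) * |cutoffTime ℓ₀ n b / n|) atTop (𝓝 0) := by
    have := (hinv.const_mul C).mul ht.abs
    simpa using this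
  refine squeeze_zero_norm' ?_ hbd
  filter_upwards [eventually_gt_atTop 0] with n hn
  have hn' : (0 : ℝ) < n := by exact_mod_cast hn
  have h1 := sub_heatEigenvalue_le (ℓ := ℓ) hn
  have h0 := heatEigenvalue_le n ℓ
  rw [Real.norm_eq_abs, abs_mul, abs_of_nonneg (by linarith), abs_div, abs_of_pos hn']
  calc _ ≤ Real.pi ^ 4 * (ℓ : ℝ) ^ 4 / (8 * n ^ 2) * |cutoffTime ℓ₀ n b| :=
        mul_le_mul_of_nonneg_right h1 (abs_nonneg _)
    _ = _ := by rw [hC]; field_simp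

/-- The identity behind the choice of `cutoffTime`: the mode ℓ₀ has decayed to the fluctuation scale
1/√n. -/
theorem sqrt_mul_exp_cutoffTime {ℓ₀ : ℕ} (hℓ₀ : 1 ≤ ℓ₀) (b : ℝ) {n : ℕ} (hn : 0 < n) :
    √(n : ℝ) * Real.exp (-(Real.pi ^ 2 * (ℓ₀ : ℝ) ^ 2 * cutoffTime ℓ₀ n b)) = Real.exp (-b) := by
  have hn' : (0 : ℝ) < n := by exact_mod_cast hn
  have hℓ : (0 : ℝ) < ℓ₀ := by exact_mod_cast hℓ₀
  have hπ := Real.pi_pos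
  have e : Real.pi ^ 2 * (ℓ₀ : ℝ) ^ 2 * cutoffTime ℓ₀ n b = 1 / 2 * Real.log n + b := by
    rw [cutoffTime]; field_simp
  have hs : √(n : ℝ) = Real.exp (1 / 2 * Real.log n) := by
    rw [Real.sqrt_eq_rpow, Real.rpow_def_of_pos hn', mul_comm]
  rw [e, hs, ← Real.exp_add]
  congr 1; ring

theorem tendsto_sqrt_mul_exp_of_eq {ℓ₀ : ℕ} (hℓ₀ : 1 ≤ ℓ₀) (b : ℝ) :
    Tendsto (fun n : ℕ => √(n : ℝ) * Real.exp (-heatEigenvalue n ℓ₀ * cutoffTime ℓ₀ n b)) atTop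
      (𝓝 (Real.exp (-b))) := by
  have h := ((Real.continuous_exp.tendsto 0).comp
    (tendsto_eigenvalue_sub_mul_cutoffTime ℓ₀ b ℓ₀)).const_mul (Real.exp (-b))
  rw [Real.exp_zero, mul_one] at h
  refine h.congr' ?_
  filter_upwards [eventually_gt_atTop 0] with n hn
  rw [← sqrt_mul_exp_cutoffTime hℓ₀ b hn, Function.comp_apply, mul_assoc, ← Real.exp_add]
  congr 2; ring

theorem tendsto_sqrt_mul_exp_of_lt {ℓ₀ ℓ : ℕ} (hℓ₀ : 1 ≤ ℓ₀) (hℓ : ℓ₀ < ℓ) (b : ℝ) :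
    Tendsto (fun n : ℕ => √(n : ℝ) * Real.exp (-heatEigenvalue n ℓ * cutoffTime ℓ₀ n b)) atTop
      (𝓝 0) := by
  have hlt : (ℓ₀ : ℝ) < ℓ := by exact_mod_cast hℓ
  have hπ := Real.pi_pos
  have hpos : 0 < Real.pi ^ 2 * ((ℓ : ℝ) ^ 2 - (ℓ₀ : ℝ) ^ 2) := by
    have h0 : (0 : ℝ) ≤ ℓ₀ := Nat.cast_nonneg _
    have : (ℓ₀ : ℝ) ^ 2 < (ℓ : ℝ) ^ 2 := by nlinarith
    exact mul_pos (by positivity) (by linarith)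
  have h1 : Tendsto (fun n : ℕ => Real.exp (-(Real.pi ^ 2 * ((ℓ : ℝ) ^ 2 - (ℓ₀ : ℝ) ^ 2)
      * cutoffTime ℓ₀ n b))) atTop (𝓝 0) :=
    Real.tendsto_exp_neg_atTop_nhds_zero.comp ((tendsto_cutoffTime hℓ₀ b).const_mul_atTop hpos)
  have h := ((((Real.continuous_exp.tendsto 0).comp
    (tendsto_eigenvalue_sub_mul_cutoffTime ℓ₀ b ℓ)).mul h1)).const_mul (Real.exp (-b))
  rw [mul_zero, mul_zero] at h
  refine h.congr' ?_
  filter_upwards [eventually_gt_atTop 0] with n hn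
  rw [← sqrt_mul_exp_cutoffTime hℓ₀ b hn, Function.comp_apply, mul_assoc, ← Real.exp_add,
    ← Real.exp_add]
  congr 2; ring

/-- The sum of the high-frequency factors at the cutoff time is negligible. -/
theorem sum_sqrt_mul_exp_le {ℓ₀ : ℕ} (hℓ₀ : 1 ≤ ℓ₀) (b : ℝ) {n : ℕ} (hn : 0 < n)
    (ht : 1 ≤ cutoffTime ℓ₀ n b) :
    ∑ ℓ ∈ Finset.Ico (2 * ℓ₀) n, √(n : ℝ) * Real.exp (-heatEigenvalue n ℓ * cutoffTime ℓ₀ n b)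
      ≤ Real.exp (-b) * Real.exp (1 - cutoffTime ℓ₀ n b) * 2 := by
  set t := cutoffTime ℓ₀ n b with htdef
  have hterm : ∀ ℓ ∈ Finset.Ico (2 * ℓ₀) n, √(n : ℝ) * Real.exp (-heatEigenvalue n ℓ * t)
      ≤ Real.exp (-b) * Real.exp (1 - t) * (1 / 2 : ℝ) ^ ℓ := by
    intro ℓ hℓ
    rw [Finset.mem_Ico] at hℓ
    have h2 : (2 : ℝ) * ℓ₀ ≤ ℓ := by exact_mod_cast hℓ.1
    have h0 : (1 : ℝ) ≤ ℓ₀ := by exact_mod_cast hℓ₀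
    have h4 := four_mul_sq_le_heatEigenvalue hℓ.2.le
    have hπ : Real.pi ^ 2 ≤ 10 := by nlinarith [Real.pi_lt_d2, Real.pi_pos]
    -- The uniform bound 4ℓ² exceeds π²ℓ₀² only for ℓ > πℓ₀/2, hence the threshold 2ℓ₀; the finitely
    -- many modes below it are handled one at a time.
    have hgap : (ℓ : ℝ) ≤ heatEigenvalue n ℓ - Real.pi ^ 2 * (ℓ₀ : ℝ) ^ 2 := by
      have g1 : Real.pi ^ 2 * (ℓ₀ : ℝ) ^ 2 ≤ 10 * (ℓ₀ : ℝ) ^ 2 :=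
        mul_le_mul_of_nonneg_right hπ (sq_nonneg _)
      have g2 : 4 * (ℓ₀ : ℝ) ^ 2 ≤ (ℓ : ℝ) ^ 2 := by nlinarith
      have g3 : (ℓ : ℝ) ≤ (ℓ : ℝ) ^ 2 := by nlinarith
      linarith
    have hexp : -heatEigenvalue n ℓ * t
        ≤ -(Real.pi ^ 2 * (ℓ₀ : ℝ) ^ 2 * t) + (1 - t) + ℓ * (-1) := by
      have g1 := mul_le_mul_of_nonneg_right hgap (by linarith : 0 ≤ t)
      have g2 : t - 1 ≤ ℓ * (t - 1) := by nlinarith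
      linarith
    calc √(n : ℝ) * Real.exp (-heatEigenvalue n ℓ * t)
        ≤ √(n : ℝ) * Real.exp (-(Real.pi ^ 2 * (ℓ₀ : ℝ) ^ 2 * t) + (1 - t) + ℓ * (-1)) :=
          mul_le_mul_of_nonneg_left (Real.exp_le_exp.2 hexp) (Real.sqrt_nonneg _)
      _ = Real.exp (-b) * Real.exp (1 - t) * Real.exp (-1) ^ ℓ := by
          rw [Real.exp_add, Real.exp_add, Real.exp_nat_mul, ← sqrt_mul_exp_cutoffTime hℓ₀ b hn]
          ring
      _ ≤ _ := by
          refine mul_le_mul_of_nonneg_left (pow_le_pow_left₀ (Real.exp_pos _).le ?_ ℓ)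
            (by positivity)
          rw [Real.exp_neg, one_div]
          exact inv_anti₀ (by norm_num) (by linarith [Real.add_one_le_exp (1 : ℝ)])
  refine (Finset.sum_le_sum hterm).trans ?_
  rw [← Finset.mul_sum]
  refine mul_le_mul_of_nonneg_left ?_ (by positivity)
  refine le_trans ?_ (sum_geometric_two_le n)
  refine Finset.sum_le_sum_of_subset_of_nonneg (fun ℓ hℓ => ?_) fun _ _ _ => by positivity
  exact Finset.mem_range.2 (Finset.mem_Ico.1 hℓ).2

variable {f : ℝ → ℝ} {K : ℝ} {ℓ₀ : ℕ}

/-- Below ℓ₀ no decay in time is used: the discrete coefficient is O(1/n). At ℓ₀ the time is tuned,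
and above ℓ₀ the exponential beats √n. -/
theorem tendsto_sqrt_mul_sineCoeff_mul_exp (hK : 0 ≤ K)
    (hf : ∀ x ∈ Icc (0 : ℝ) 1, ∀ y ∈ Icc (0 : ℝ) 1, |f x - f y| ≤ K * |x - y|)
    (hfb : ∀ x ∈ Icc (0 : ℝ) 1, |f x| ≤ 1) (hℓ₀ : 1 ≤ ℓ₀)
    (hc : ∀ ℓ < ℓ₀, √2 * ∫ x in (0 : ℝ)..1, f x * Real.sin (Real.pi * ℓ * x) = 0) (b : ℝ)
    (ℓ : ℕ) :
    Tendsto (fun n : ℕ => √(n : ℝ)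
        * (sineCoeff n f ℓ * Real.exp (-heatEigenvalue n ℓ * cutoffTime ℓ₀ n b))) atTop
      (𝓝 (if ℓ = ℓ₀ then (√2 * ∫ x in (0 : ℝ)..1, f x * Real.sin (Real.pi * ℓ₀ * x))
        * Real.exp (-b) else 0)) := by
  have hπ := Real.pi_pos
  have hcast : Tendsto (fun n : ℕ => (n : ℝ)) atTop atTop := tendsto_natCast_atTop_atTop
  have hinv : Tendsto (fun n : ℕ => 1 / (n : ℝ)) atTop (𝓝 0) := tendsto_one_div_atTop_nhds_zero_nat
  rcases lt_trichotomy ℓ ℓ₀ with h | h | h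
  · rw [if_neg h.ne]
    have hsq : Tendsto (fun n : ℕ => √2 * (K + Real.pi * ℓ) * (√(n : ℝ))⁻¹) atTop (𝓝 0) := by
      have := (tendsto_inv_atTop_zero.comp (Real.tendsto_sqrt_atTop.comp hcast)).const_mul
        (√2 * (K + Real.pi * ℓ))
      simpa [Function.comp_def] using this
    refine squeeze_zero_norm' ?_ hsq
    filter_upwards [eventually_gt_atTop 0, (tendsto_cutoffTime hℓ₀ b).eventually_ge_atTop 0]
      with n hn ht
    have hn' : (0 : ℝ) < n := by exact_mod_cast hn
    have h1 := abs_sineCoeff_sub_le hK hf hfb ℓ hn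
    rw [hc ℓ h, sub_zero] at h1
    have h2 : Real.exp (-heatEigenvalue n ℓ * cutoffTime ℓ₀ n b) ≤ 1 := by
      rw [Real.exp_le_one_iff]
      have := mul_nonneg (heatEigenvalue_nonneg n ℓ) ht
      linarith
    rw [Real.norm_eq_abs, abs_mul, abs_mul, abs_of_pos (Real.exp_pos _),
      abs_of_nonneg (Real.sqrt_nonneg _)]
    have hs : √(n : ℝ) * √(n : ℝ) = n := Real.mul_self_sqrt hn'.le
    have hs0 : 0 < √(n : ℝ) := Real.sqrt_pos.2 hn'
    calc _ ≤ √(n : ℝ) * (√2 * ((K + Real.pi * ℓ) / n) * 1) := by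
          gcongr
      _ = √2 * (K + Real.pi * ℓ) * (√(n : ℝ) / (√(n : ℝ) * √(n : ℝ))) := by rw [hs]; ring
      _ = _ := by field_simp
  · subst h
    rw [if_pos rfl]
    have hcoef : Tendsto (fun n : ℕ => sineCoeff n f ℓ) atTop
        (𝓝 (√2 * ∫ x in (0 : ℝ)..1, f x * Real.sin (Real.pi * ℓ * x))) := by
      rw [tendsto_iff_norm_sub_tendsto_zero]
      have hb : Tendsto (fun n : ℕ => √2 * (K + Real.pi * ℓ) * (1 / (n : ℝ))) atTop (𝓝 0) := by
        simpa using hinv.const_mul (√2 * (K + Real.pi * ℓ))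
      refine squeeze_zero' (Eventually.of_forall fun n => norm_nonneg _) ?_ hb
      filter_upwards [eventually_gt_atTop 0] with n hn
      refine (abs_sineCoeff_sub_le hK hf hfb ℓ hn).trans (le_of_eq ?_)
      ring
    refine (hcoef.mul (tendsto_sqrt_mul_exp_of_eq hℓ₀ b)).congr fun n => ?_
    ring
  · rw [if_neg h.ne']
    have hb : Tendsto (fun n : ℕ => √2 * (√(n : ℝ)
        * Real.exp (-heatEigenvalue n ℓ * cutoffTime ℓ₀ n b))) atTop (𝓝 0) := by
      simpa using (tendsto_sqrt_mul_exp_of_lt hℓ₀ h b).const_mul √2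
    refine squeeze_zero_norm (fun n => ?_) hb
    rw [Real.norm_eq_abs, abs_mul, abs_mul, abs_of_pos (Real.exp_pos _),
      abs_of_nonneg (Real.sqrt_nonneg _)]
    have := abs_sineCoeff_le (n := n) hfb ℓ
    calc _ ≤ √(n : ℝ) * (√2 * Real.exp (-heatEigenvalue n ℓ * cutoffTime ℓ₀ n b)) := by gcongr
      _ = _ := by ring

/-- At the cutoff time the solution of the heat equation is, to leading order, given by the
first nonvanishing mode. -/
theorem exists_tendsto_abs_heatSolution_sub_le (hK : 0 ≤ K)
    (hf : ∀ x ∈ Icc (0 : ℝ) 1, ∀ y ∈ Icc (0 : ℝ) 1, |f x - f y| ≤ K * |x - y|)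
    (hfb : ∀ x ∈ Icc (0 : ℝ) 1, |f x| ≤ 1) (hℓ₀ : 1 ≤ ℓ₀)
    (hc : ∀ ℓ < ℓ₀, √2 * ∫ x in (0 : ℝ)..1, f x * Real.sin (Real.pi * ℓ * x) = 0) (b : ℝ)
    {c : ℝ} (hcℓ₀ : √2 * ∫ x in (0 : ℝ)..1, f x * Real.sin (Real.pi * ℓ₀ * x) = c) :
    ∃ ε : ℕ → ℝ, Tendsto ε atTop (𝓝 0) ∧ ∀ᶠ n : ℕ in atTop, ∀ x : ℝ,
      |√(n : ℝ) * heatSolution n f (cutoffTime ℓ₀ n b) x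
        - √2 * c * Real.exp (-b) * Real.sin (Real.pi * ℓ₀ * x / n)| ≤ ε n := by
  let a : ℕ → ℕ → ℝ := fun n ℓ =>
    √(n : ℝ) * (sineCoeff n f ℓ * Real.exp (-heatEigenvalue n ℓ * cutoffTime ℓ₀ n b))
  let L : ℕ → ℝ := fun ℓ => if ℓ = ℓ₀ then c * Real.exp (-b) else 0
  have ha : ∀ ℓ, Tendsto (fun n => a n ℓ) atTop (𝓝 (L ℓ)) := fun ℓ => by
    have := tendsto_sqrt_mul_sineCoeff_mul_exp hK hf hfb hℓ₀ hc b ℓ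
    rwa [hcℓ₀] at this
  have hsqrt2 : 0 ≤ √(2 : ℝ) := Real.sqrt_nonneg 2
  refine ⟨fun n => √2 * (∑ ℓ ∈ Finset.range (2 * ℓ₀), |a n ℓ - L ℓ|
    + √2 * (Real.exp (-b) * Real.exp (1 - cutoffTime ℓ₀ n b) * 2)), ?_, ?_⟩
  · have h1 : Tendsto (fun n => ∑ ℓ ∈ Finset.range (2 * ℓ₀), |a n ℓ - L ℓ|) atTop (𝓝 0) := by
      have := tendsto_finsetSum (Finset.range (2 * ℓ₀)) fun ℓ _ =>
        ((ha ℓ).sub_const (L ℓ)).abs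
      simpa using this
    have h2 : Tendsto (fun n : ℕ => Real.exp (1 - cutoffTime ℓ₀ n b)) atTop (𝓝 0) := by
      have := Real.tendsto_exp_atBot.comp
        (tendsto_atBot_add_const_left _ 1 (tendsto_neg_atTop_atBot.comp (tendsto_cutoffTime hℓ₀ b)))
      refine this.congr fun n => ?_
      simp [sub_eq_add_neg]
    have h3 := (h1.add (((h2.const_mul (Real.exp (-b))).mul_const 2).const_mul √2)).const_mul √2
    simpa using h3
  · filter_upwards [eventually_ge_atTop (2 * ℓ₀), (tendsto_cutoffTime hℓ₀ b).eventually_ge_atTop 1]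
      with n hn ht x
    have hn0 : 0 < n := by omega
    have hsum : √(n : ℝ) * heatSolution n f (cutoffTime ℓ₀ n b) x
        - √2 * c * Real.exp (-b) * Real.sin (Real.pi * ℓ₀ * x / n)
        = √2 * (∑ ℓ ∈ Finset.range (2 * ℓ₀), (a n ℓ - L ℓ) * Real.sin (Real.pi * ℓ * x / n)
          + ∑ ℓ ∈ Finset.Ico (2 * ℓ₀) n, a n ℓ * Real.sin (Real.pi * ℓ * x / n)) := by
      have hL : ∑ ℓ ∈ Finset.range (2 * ℓ₀), L ℓ * Real.sin (Real.pi * ℓ * x / n)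
          = c * Real.exp (-b) * Real.sin (Real.pi * ℓ₀ * x / n) := by
        rw [Finset.sum_eq_single ℓ₀ (fun ℓ _ hne => by simp [L, hne])
          (fun h => absurd (Finset.mem_range.2 (by omega)) h)]
        simp [L]
      have hH : √(n : ℝ) * heatSolution n f (cutoffTime ℓ₀ n b) x
          = √2 * ∑ ℓ ∈ Finset.range n, a n ℓ * Real.sin (Real.pi * ℓ * x / n) := by
        rw [heatSolution, Finset.mul_sum, Finset.mul_sum]
        exact Finset.sum_congr rfl fun ℓ _ => by simp only [a]; ring
      rw [hH, ← Finset.sum_range_add_sum_Ico _ hn]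
      simp_rw [sub_mul, Finset.sum_sub_distrib, hL]
      ring
    rw [hsum, abs_mul, abs_of_nonneg hsqrt2]
    refine mul_le_mul_of_nonneg_left ((abs_add_le _ _).trans (add_le_add ?_ ?_)) hsqrt2
    · refine (Finset.abs_sum_le_sum_abs _ _).trans (Finset.sum_le_sum fun ℓ _ => ?_)
      rw [abs_mul]
      exact mul_le_of_le_one_right (abs_nonneg _) (Real.abs_sin_le_one _)
    · refine (Finset.abs_sum_le_sum_abs _ _).trans ?_
      refine le_trans ?_ (mul_le_mul_of_nonneg_left (sum_sqrt_mul_exp_le hℓ₀ b hn0 ht) hsqrt2)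
      rw [Finset.mul_sum]
      refine Finset.sum_le_sum fun ℓ _ => ?_
      rw [abs_mul]
      refine (mul_le_of_le_one_right (abs_nonneg _) (Real.abs_sin_le_one _)).trans ?_
      simp only [a]
      rw [abs_mul, abs_mul, abs_of_pos (Real.exp_pos _), abs_of_nonneg (Real.sqrt_nonneg _)]
      have := abs_sineCoeff_le (n := n) hfb ℓ
      calc _ ≤ √(n : ℝ) * (√2 * Real.exp (-heatEigenvalue n ℓ * cutoffTime ℓ₀ n b)) := by gcongr
        _ = _ := by ring

theorem sum_site_eq_sum_range {n : ℕ} {g : ℕ → ℝ} (hg : g 0 = 0) :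
    ∑ x : Site n, g x = ∑ x ∈ Finset.range n, g x := by
  rw [Finset.sum_coe_sort (Finset.Ico 1 n) g, Finset.range_eq_Ico]
  refine Finset.sum_subset (Finset.Ico_subset_Ico (by omega) le_rfl) fun x hx hx' => ?_
  simp only [Finset.mem_Ico] at hx hx'
  obtain rfl : x = 0 := by omega
  exact hg

/-- The uniform and square norms of the density fluctuation at the cutoff time. -/
theorem tendsto_heatSolution_cutoffTime (hK : 0 ≤ K)
    (hf : ∀ x ∈ Icc (0 : ℝ) 1, ∀ y ∈ Icc (0 : ℝ) 1, |f x - f y| ≤ K * |x - y|)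
    (hfb : ∀ x ∈ Icc (0 : ℝ) 1, |f x| ≤ 1) (hℓ₀ : 1 ≤ ℓ₀)
    (hc : ∀ ℓ < ℓ₀, √2 * ∫ x in (0 : ℝ)..1, f x * Real.sin (Real.pi * ℓ * x) = 0) (b : ℝ)
    {c : ℝ} (hcℓ₀ : √2 * ∫ x in (0 : ℝ)..1, f x * Real.sin (Real.pi * ℓ₀ * x) = c) :
    (∃ s : ℕ → ℝ, Tendsto s atTop (𝓝 0) ∧ ∀ᶠ n : ℕ in atTop, ∀ x : ℝ,
      |heatSolution n f (cutoffTime ℓ₀ n b) x| ≤ s n) ∧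
    Tendsto (fun n : ℕ => ∑ x : Site n, heatSolution n f (cutoffTime ℓ₀ n b) (x : ℕ) ^ 2) atTop
      (𝓝 ((c * Real.exp (-b)) ^ 2)) := by
  obtain ⟨ε, hε, hbound⟩ := exists_tendsto_abs_heatSolution_sub_le hK hf hfb hℓ₀ hc b hcℓ₀
  set A := √2 * c * Real.exp (-b) with hA
  have hcast : Tendsto (fun n : ℕ => (n : ℝ)) atTop atTop := tendsto_natCast_atTop_atTop
  constructor
  · refine ⟨fun n => (ε n + |A|) * (√(n : ℝ))⁻¹, ?_, ?_⟩
    · have h := (hε.add_const |A|).mul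
        (tendsto_inv_atTop_zero.comp (Real.tendsto_sqrt_atTop.comp hcast))
      simpa [Function.comp_def] using h
    · filter_upwards [hbound, eventually_gt_atTop 0] with n hn hn0 x
      have hs0 : 0 < √(n : ℝ) := Real.sqrt_pos.2 (by exact_mod_cast hn0)
      rw [← div_eq_mul_inv, le_div_iff₀ hs0]
      have h1 := hn x
      have h2 : |A * Real.sin (Real.pi * ℓ₀ * x / n)| ≤ |A| := by
        rw [abs_mul]
        exact mul_le_of_le_one_right (abs_nonneg _) (Real.abs_sin_le_one _)
      have h3 : |heatSolution n f (cutoffTime ℓ₀ n b) x| * √(n : ℝ)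
          = |√(n : ℝ) * heatSolution n f (cutoffTime ℓ₀ n b) x| := by
        rw [abs_mul, abs_of_pos hs0, mul_comm]
      rw [h3]
      have h4 := abs_add_le (√(n : ℝ) * heatSolution n f (cutoffTime ℓ₀ n b) x
        - A * Real.sin (Real.pi * ℓ₀ * x / n)) (A * Real.sin (Real.pi * ℓ₀ * x / n))
      rw [sub_add_cancel] at h4
      linarith
  · rw [tendsto_iff_norm_sub_tendsto_zero]
    have hlim : Tendsto (fun n => ε n * (ε n + 2 * |A|)) atTop (𝓝 0) := by
      have := hε.mul (hε.add_const (2 * |A|))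
      simpa using this
    refine squeeze_zero' (Eventually.of_forall fun n => norm_nonneg _) ?_ hlim
    filter_upwards [hbound, eventually_gt_atTop ℓ₀] with n hn hn0
    have hn' : (0 : ℝ) < n := by exact_mod_cast (by omega : 0 < n)
    have hs : √(n : ℝ) ^ 2 = n := Real.sq_sqrt hn'.le
    rw [sum_site_eq_sum_range (g := fun k : ℕ => heatSolution n f (cutoffTime ℓ₀ n b) k ^ 2)
      (by simp [heatSolution_zero_right])]
    -- For n > ℓ₀ discrete orthogonality gives the square norm of the leading mode exactly, with no
    -- Riemann sum error.
    have hsin : (c * Real.exp (-b)) ^ 2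
        = ∑ x ∈ Finset.range n, 1 / (n : ℝ) * (A * Real.sin (Real.pi * ℓ₀ * x / n)) ^ 2 := by
      have h := sum_sin_mul_sin (by omega : 0 < ℓ₀) hn0 (by omega : 0 < ℓ₀) hn0
      rw [if_pos rfl] at h
      have h2 : (√2 : ℝ) ^ 2 = 2 := Real.sq_sqrt (by norm_num)
      have e : ∑ x ∈ Finset.range n, 1 / (n : ℝ) * (A * Real.sin (Real.pi * ℓ₀ * x / n)) ^ 2
          = (c * Real.exp (-b)) ^ 2 / n * ∑ x ∈ Finset.range n,
            2 * (Real.sin (Real.pi * x * ℓ₀ / n) * Real.sin (Real.pi * x * ℓ₀ / n)) := by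
        rw [Finset.mul_sum]
        refine Finset.sum_congr rfl fun x _ => ?_
        rw [hA, show Real.pi * ℓ₀ * (x : ℝ) / n = Real.pi * x * ℓ₀ / n by ring]
        linear_combination (c ^ 2 * Real.exp (-b) ^ 2 * Real.sin (Real.pi * x * ℓ₀ / n) ^ 2 / n) * h2
      rw [e, h]
      field_simp
    rw [hsin, ← Finset.sum_sub_distrib]
    refine (norm_sum_le _ _).trans ?_
    have hterm : ∀ x ∈ Finset.range n, ‖heatSolution n f (cutoffTime ℓ₀ n b) x ^ 2
        - 1 / (n : ℝ) * (A * Real.sin (Real.pi * ℓ₀ * x / n)) ^ 2‖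
        ≤ 1 / n * (ε n * (ε n + 2 * |A|)) := by
      intro x _
      set r := √(n : ℝ) * heatSolution n f (cutoffTime ℓ₀ n b) x with hr
      set q := A * Real.sin (Real.pi * ℓ₀ * x / n) with hq
      have h1 : |r - q| ≤ ε n := hn x
      have h2 : |q| ≤ |A| := by
        rw [hq, abs_mul]
        exact mul_le_of_le_one_right (abs_nonneg _) (Real.abs_sin_le_one _)
      have e : heatSolution n f (cutoffTime ℓ₀ n b) x ^ 2 - 1 / (n : ℝ) * q ^ 2
          = 1 / n * ((r - q) * ((r - q) + 2 * q)) := by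
        have hr2 : r ^ 2 = n * heatSolution n f (cutoffTime ℓ₀ n b) x ^ 2 := by
          rw [hr, mul_pow, hs]
        have : (r - q) * ((r - q) + 2 * q) = r ^ 2 - q ^ 2 := by ring
        rw [this, hr2]
        field_simp
      rw [e, Real.norm_eq_abs, abs_mul, abs_mul, abs_of_pos (by positivity)]
      refine mul_le_mul_of_nonneg_left (mul_le_mul h1 ?_ (abs_nonneg _)
        ((abs_nonneg _).trans h1)) (by positivity)
      refine (abs_add_le _ _).trans (add_le_add h1 ?_)
      rw [abs_mul, abs_of_pos (by norm_num : (0 : ℝ) < 2)]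
      linarith
    refine (Finset.sum_le_sum hterm).trans (le_of_eq ?_)
    rw [Finset.sum_const, Finset.card_range, nsmul_eq_mul]
    field_simp

/-! ### Characteristic function of the log-likelihood ratio -/

section Taylor

open Asymptotics

theorem isLittleO_sq_of_hasDerivAt {R R' : ℝ → ℂ} (h0 : R 0 = 0)
    (hd : ∀ᶠ y in 𝓝 (0 : ℝ), HasDerivAt R (R' y) y) (hR' : R' =o[𝓝 0] fun y : ℝ => y) :
    R =o[𝓝 0] fun y : ℝ => y ^ 2 := by
  rw [isLittleO_iff]
  intro c hc
  obtain ⟨δ, hδ, hball⟩ := Metric.eventually_nhds_iff_ball.1 (hd.and (isLittleO_iff.1 hR' hc))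
  filter_upwards [Metric.ball_mem_nhds (0 : ℝ) hδ] with y hy
  have hy' : |y| < δ := by simpa using hy
  have hsub : ∀ x ∈ Metric.closedBall (0 : ℝ) |y|, x ∈ Metric.ball (0 : ℝ) δ := fun x hx =>
    (Metric.closedBall_subset_ball hy') hx
  have h := Convex.norm_image_sub_le_of_norm_hasDerivWithin_le (f := R) (f' := R')
    (s := Metric.closedBall (0 : ℝ) |y|) (C := c * |y|) (x := 0) (y := y)
    (fun x hx => (hball x (hsub x hx)).1.hasDerivWithinAt)
    (fun x hx => ((hball x (hsub x hx)).2).trans (mul_le_mul_of_nonneg_left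
      (by simpa using hx) hc.le))
    (convex_closedBall _ _) (by simp) (by simp)
  rw [h0, sub_zero, sub_zero] at h
  calc ‖R y‖ ≤ c * |y| * ‖y‖ := h
    _ = c * ‖y ^ 2‖ := by rw [norm_pow, Real.norm_eq_abs]; ring

/-- Second-order expansion of `(1 + y) ^ (i s)` at `y = 0`. -/
theorem isLittleO_exp_log_sub (s : ℝ) :
    (fun y : ℝ => Complex.exp (((s * Real.log (1 + y) : ℝ) : ℂ) * Complex.I) - 1
      - Complex.I * s * y - (-(s : ℂ) ^ 2 - Complex.I * s) / 2 * y ^ 2)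
      =o[𝓝 0] fun y : ℝ => y ^ 2 := by
  have hE : ∀ y : ℝ, -1 < y →
      HasDerivAt (fun y : ℝ => Complex.exp (((s * Real.log (1 + y) : ℝ) : ℂ) * Complex.I))
        (Complex.exp (((s * Real.log (1 + y) : ℝ) : ℂ) * Complex.I)
          * (((s * (1 + y)⁻¹ : ℝ) : ℂ) * Complex.I)) y := by
    intro y hy
    have h1 : HasDerivAt (fun y : ℝ => s * Real.log (1 + y)) (s * (1 + y)⁻¹) y := by
      have h2 : HasDerivAt (fun y : ℝ => 1 + y) 1 y := (hasDerivAt_id y).const_add 1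
      have := (h2.log (by linarith : (1 : ℝ) + y ≠ 0)).const_mul s
      simpa using this
    exact (h1.ofReal_comp.mul_const Complex.I).cexp
  have hlin : ∀ y : ℝ, HasDerivAt (fun y : ℝ => (y : ℂ)) 1 y := fun y => by
    simpa using (hasDerivAt_id y).ofReal_comp
  refine isLittleO_sq_of_hasDerivAt (R' := fun y : ℝ =>
    Complex.exp (((s * Real.log (1 + y) : ℝ) : ℂ) * Complex.I)
      * (((s * (1 + y)⁻¹ : ℝ) : ℂ) * Complex.I) - Complex.I * s
      - (-(s : ℂ) ^ 2 - Complex.I * s) * y) ?_ ?_ ?_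
  · simp
  · filter_upwards [lt_mem_nhds (by norm_num : (-1 : ℝ) < 0)] with y hy
    have h := (((hE y hy).sub_const 1).sub ((hlin y).const_mul (Complex.I * s))).sub
      (((hlin y).fun_pow 2).const_mul ((-(s : ℂ) ^ 2 - Complex.I * s) / 2))
    refine h.congr_deriv ?_
    push_cast
    ring
  · have hinv : HasDerivAt (fun y : ℝ => s * (1 + y)⁻¹) (-s) 0 := by
      have h2 : HasDerivAt (fun y : ℝ => 1 + y) 1 0 := (hasDerivAt_id 0).const_add 1
      have := (h2.fun_inv (by norm_num)).const_mul s
      simpa using this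
    have h := (((hE 0 (by norm_num)).mul (hinv.ofReal_comp.mul_const Complex.I)).sub_const
      (Complex.I * s)).sub ((hlin 0).const_mul (-(s : ℂ) ^ 2 - Complex.I * s))
    have h2 := h.isLittleO
    refine (h2.congr (fun y => ?_) (fun y => ?_))
    · simp only [Pi.mul_apply, Pi.sub_apply]
      simp only [add_zero, Real.log_one, mul_zero, Complex.ofReal_zero, zero_mul, Complex.exp_zero,
        inv_one, mul_one, one_mul, sub_zero, Complex.real_smul]
      push_cast
      linear_combination (-(y : ℂ) * (s : ℂ) ^ 2) * Complex.I_sq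
    · simp

/-- The characteristic function at `s` of the log-likelihood ratio of two Bernoulli measures with
densities `ρ + h` and `ρ`. -/
noncomputable def logRatioCharFun (ρ s h : ℝ) : ℂ :=
  ρ * Complex.exp (((s * Real.log (1 + h / ρ) : ℝ) : ℂ) * Complex.I)
    + (1 - ρ) * Complex.exp (((s * Real.log (1 + -h / (1 - ρ)) : ℝ) : ℂ) * Complex.I)

theorem norm_logRatioCharFun_le {ρ : ℝ} (hρ : ρ ∈ Ioo (0 : ℝ) 1) (s h : ℝ) :
    ‖logRatioCharFun ρ s h‖ ≤ 1 := by
  have h1 : (0 : ℝ) < 1 - ρ := by linarith [hρ.2]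
  have e : ((1 : ℂ) - ρ) = ((1 - ρ : ℝ) : ℂ) := by push_cast; ring
  refine (norm_add_le _ _).trans ?_
  rw [e, norm_mul, norm_mul, Complex.norm_exp_ofReal_mul_I, Complex.norm_exp_ofReal_mul_I,
    Complex.norm_real, Complex.norm_real, Real.norm_eq_abs, Real.norm_eq_abs, abs_of_pos hρ.1,
    abs_of_pos h1]
  linarith

/-- The first-order terms cancel, as ρ(h/ρ) = (1-ρ)(h/(1-ρ)), and the second-order ones add up
through 1/ρ + 1/(1-ρ) = 1/(ρ(1-ρ)). -/
theorem isLittleO_logRatioCharFun_sub {ρ : ℝ} (hρ : ρ ∈ Ioo (0 : ℝ) 1) (s : ℝ) :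
    (fun h : ℝ => logRatioCharFun ρ s h
      - Complex.exp ((-(s : ℂ) ^ 2 - Complex.I * s) / (2 * (ρ * (1 - ρ))) * h ^ 2))
      =o[𝓝 0] fun h : ℝ => h ^ 2 := by
  have h0 := hρ.1.ne'
  have h1 : (1 : ℝ) - ρ ≠ 0 := by linarith [hρ.2]
  have c0 : (ρ : ℂ) ≠ 0 := by exact_mod_cast h0
  have c1 : (1 : ℂ) - ρ ≠ 0 := by exact_mod_cast h1
  have hR := isLittleO_exp_log_sub s
  have key : ∀ k : ℝ, Tendsto (fun h : ℝ => h * k) (𝓝 0) (𝓝 0) := fun k => by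
    have := (continuous_id.mul_const k).tendsto (0 : ℝ)
    simpa using this
  have hO : ∀ k : ℝ, (fun h : ℝ => (h * k) ^ 2) =O[𝓝 0] fun h : ℝ => h ^ 2 := fun k =>
    IsBigO.of_bound (k ^ 2) (Eventually.of_forall fun h => by
      rw [mul_pow, norm_mul, mul_comm, Real.norm_of_nonneg (sq_nonneg k)])
  have hA := ((hR.comp_tendsto (key ρ⁻¹)).trans_isBigO (hO ρ⁻¹)).const_mul_left (ρ : ℂ)
  have hB := ((hR.comp_tendsto (key (-(1 - ρ)⁻¹))).trans_isBigO (hO (-(1 - ρ)⁻¹))).const_mul_left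
    ((1 : ℂ) - ρ)
  set w : ℂ := (-(s : ℂ) ^ 2 - Complex.I * s) / (2 * (ρ * (1 - ρ))) with hw
  have hexp : (fun z : ℂ => Complex.exp z - 1 - z) =o[𝓝 0] fun z : ℂ => z := by
    have := (Complex.hasDerivAt_exp 0).isLittleO
    simpa using this
  have ht : Tendsto (fun h : ℝ => w * (h : ℂ) ^ 2) (𝓝 0) (𝓝 0) := by
    have : Continuous fun h : ℝ => w * (h : ℂ) ^ 2 := by fun_prop
    simpa using this.tendsto 0
  have hC : (fun h : ℝ => Complex.exp (w * (h : ℂ) ^ 2) - 1 - w * (h : ℂ) ^ 2)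
      =o[𝓝 0] fun h : ℝ => h ^ 2 := by
    refine (hexp.comp_tendsto ht).trans_isBigO (IsBigO.of_bound ‖w‖ (Eventually.of_forall fun h => ?_))
    simp [norm_pow]
  refine ((hA.add hB).sub hC).congr (fun h => ?_) fun h => rfl
  simp only [Function.comp_apply, logRatioCharFun, div_eq_mul_inv h, div_eq_mul_inv (-h),
    neg_mul, mul_neg]
  rw [hw]
  push_cast
  field_simp
  ring

end Taylor

theorem norm_prod_sub_prod_le {ι : Type*} (t : Finset ι) {a b : ι → ℂ}
    (ha : ∀ i ∈ t, ‖a i‖ ≤ 1) (hb : ∀ i ∈ t, ‖b i‖ ≤ 1) :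
    ‖∏ i ∈ t, a i - ∏ i ∈ t, b i‖ ≤ ∑ i ∈ t, ‖a i - b i‖ := by
  classical
  induction t using Finset.induction_on with
  | empty => simp
  | insert i t hi ih =>
    rw [Finset.prod_insert hi, Finset.prod_insert hi, Finset.sum_insert hi]
    have ih' := ih (fun j hj => ha j (Finset.mem_insert_of_mem hj))
      (fun j hj => hb j (Finset.mem_insert_of_mem hj))
    have h1 : ‖∏ j ∈ t, a j‖ ≤ 1 := by
      rw [norm_prod]
      exact Finset.prod_le_one (fun _ _ => norm_nonneg _)
        fun j hj => ha j (Finset.mem_insert_of_mem hj)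
    have e : a i * ∏ j ∈ t, a j - b i * ∏ j ∈ t, b j
        = (a i - b i) * ∏ j ∈ t, a j + b i * (∏ j ∈ t, a j - ∏ j ∈ t, b j) := by ring
    rw [e]
    refine (norm_add_le _ _).trans (add_le_add ?_ ?_)
    · rw [norm_mul]; exact mul_le_of_le_one_right (norm_nonneg _) h1
    · rw [norm_mul]
      exact (mul_le_of_le_one_left (norm_nonneg _) (hb i (Finset.mem_insert_self _ _))).trans ih'

/-- Convergence of the characteristic function of the log-likelihood ratio. -/
theorem tendsto_prod_logRatioCharFun {ρ : ℝ} (hρ : ρ ∈ Ioo (0 : ℝ) 1) (s : ℝ)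
    {h : ∀ n : ℕ, Site n → ℝ} {δ : ℕ → ℝ} (hδ : Tendsto δ atTop (𝓝 0))
    (hh : ∀ᶠ n in atTop, ∀ x, |h n x| ≤ δ n) {V : ℝ}
    (hV : Tendsto (fun n => ∑ x, h n x ^ 2) atTop (𝓝 V)) :
    Tendsto (fun n => ∏ x, logRatioCharFun ρ s (h n x)) atTop
      (𝓝 (Complex.exp ((-(s : ℂ) ^ 2 - Complex.I * s) / (2 * (ρ * (1 - ρ))) * V))) := by
  have h1 : (0 : ℝ) < 1 - ρ := by linarith [hρ.2]
  have hχ : 0 < ρ * (1 - ρ) := mul_pos hρ.1 h1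
  set w : ℂ := (-(s : ℂ) ^ 2 - Complex.I * s) / (2 * (ρ * (1 - ρ))) with hw
  -- Keeps the Gaussian factors in the unit disc, as the comparison of the two products requires.
  have hwre : w.re ≤ 0 := by
    have e : w = ((-s ^ 2 / (2 * (ρ * (1 - ρ))) : ℝ) : ℂ)
        + ((-s / (2 * (ρ * (1 - ρ))) : ℝ) : ℂ) * Complex.I := by
      rw [hw]; push_cast; ring
    rw [e]
    simp only [Complex.add_re, Complex.ofReal_re, Complex.mul_re, Complex.I_re, mul_zero,
      Complex.ofReal_im, Complex.I_im, mul_one, sub_self, add_zero]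
    exact div_nonpos_of_nonpos_of_nonneg (by nlinarith [sq_nonneg s]) (by positivity)
  have hb : ∀ y : ℝ, ‖Complex.exp (w * (y : ℂ) ^ 2)‖ ≤ 1 := by
    intro y
    rw [Complex.norm_exp, Real.exp_le_one_iff]
    have : (w * (y : ℂ) ^ 2).re = w.re * y ^ 2 := by
      rw [← Complex.ofReal_pow, Complex.re_mul_ofReal]
    rw [this]
    exact mul_nonpos_of_nonpos_of_nonneg hwre (sq_nonneg y)
  have hmain : Tendsto (fun n => Complex.exp (w * ((∑ x, h n x ^ 2 : ℝ) : ℂ))) atTop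
      (𝓝 (Complex.exp (w * V))) := by
    have hc : Continuous fun v : ℝ => Complex.exp (w * (v : ℂ)) := by fun_prop
    exact (hc.tendsto V).comp hV
  have hdiff : Tendsto (fun n => ∏ x, logRatioCharFun ρ s (h n x)
      - Complex.exp (w * ((∑ x, h n x ^ 2 : ℝ) : ℂ))) atTop (𝓝 0) := by
    rw [Metric.tendsto_atTop']
    intro ε hε
    have hV1 : ∀ᶠ n in atTop, ∑ x, h n x ^ 2 < |V| + 1 :=
      hV.eventually_lt_const (by linarith [le_abs_self V])
    have hc : 0 < ε / (2 * (|V| + 1)) := by positivity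
    have hlo := Asymptotics.isLittleO_iff.1 (isLittleO_logRatioCharFun_sub hρ s) hc
    obtain ⟨r, hr, hball⟩ := Metric.eventually_nhds_iff_ball.1 hlo
    have hδr : ∀ᶠ n in atTop, δ n < r := hδ.eventually_lt_const hr
    have hall : ∀ᶠ n in atTop, dist (∏ x, logRatioCharFun ρ s (h n x)
      - Complex.exp (w * ((∑ x, h n x ^ 2 : ℝ) : ℂ))) 0 < ε := by
      filter_upwards [hV1, hδr, hh] with n hVn hδn hhn
      have e : Complex.exp (w * ((∑ x, h n x ^ 2 : ℝ) : ℂ))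
          = ∏ x, Complex.exp (w * (h n x : ℂ) ^ 2) := by
        rw [← Complex.exp_sum, ← Finset.mul_sum]
        push_cast
        rfl
      rw [dist_zero_right, e]
      refine (norm_prod_sub_prod_le _ (fun x _ => norm_logRatioCharFun_le hρ s _)
        (fun x _ => hb _)).trans_lt ?_
      calc ∑ x, ‖logRatioCharFun ρ s (h n x) - Complex.exp (w * (h n x : ℂ) ^ 2)‖
          ≤ ∑ x, ε / (2 * (|V| + 1)) * h n x ^ 2 := by
            refine Finset.sum_le_sum fun x _ => ?_
            have hx := hball (h n x) (by
              rw [mem_ball_zero_iff, Real.norm_eq_abs]; exact (hhn x).trans_lt hδn)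
            rwa [Real.norm_of_nonneg (sq_nonneg _)] at hx
        _ = ε / (2 * (|V| + 1)) * ∑ x, h n x ^ 2 := by rw [Finset.mul_sum]
        _ ≤ ε / (2 * (|V| + 1)) * (|V| + 1) := mul_le_mul_of_nonneg_left hVn.le hc.le
        _ = ε / 2 := by
            have : |V| + 1 ≠ 0 := by positivity
            field_simp
        _ < ε := by linarith
    obtain ⟨N, hN⟩ := eventually_atTop.1 hall
    exact ⟨N, fun n hn => hN n hn.le⟩
  have := hdiff.add hmain
  rw [zero_add] at this
  exact this.congr fun n => by ring

/-! ### Gaussian limit of the distance between product measures -/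

theorem integral_ofWeight {α E : Type*} [Fintype α] [MeasurableSpace α] [MeasurableSingletonClass α]
    [NormedAddCommGroup E] [NormedSpace ℝ E] [CompleteSpace E] {w : α → ℝ} (hw : ∀ a, 0 ≤ w a)
    (f : α → E) :
    ∫ a, f a ∂(ofWeight w) = ∑ a, w a • f a := by
  rw [ofWeight, integral_finsetSum_measure]
  · refine Finset.sum_congr rfl fun a _ => ?_
    rw [integral_smul_measure, integral_dirac, ENNReal.toReal_ofReal (hw a)]
  · intro a _
    exact Integrable.smul_measure (integrable_dirac (by simp [enorm_lt_top])) ENNReal.ofReal_ne_top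

theorem isProbabilityMeasure_ofWeight {α : Type*} [Fintype α] [MeasurableSpace α] {w : α → ℝ}
    (hw : ∀ a, 0 ≤ w a) (hsum : ∑ a, w a = 1) : IsProbabilityMeasure (ofWeight w) := by
  constructor
  simp only [ofWeight, Measure.finsetSum_apply, Measure.smul_apply, smul_eq_mul, measure_univ,
    mul_one]
  rw [← ENNReal.ofReal_sum_of_nonneg fun a _ => hw a, hsum, ENNReal.ofReal_one]

theorem ofWeight_mul_eq_withDensity {α : Type*} [Fintype α] [MeasurableSpace α]
    [DiscreteMeasurableSpace α] {w : α → ℝ} (hw : ∀ a, 0 ≤ w a) (f : α → ℝ) :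
    ofWeight (fun a => w a * f a) = (ofWeight w).withDensity fun a => ENNReal.ofReal (f a) := by
  ext A _
  have hA : MeasurableSet A := MeasurableSet.of_discrete
  rw [withDensity_apply _ hA, ← lintegral_indicator hA]
  simp only [ofWeight, Measure.finsetSum_apply, Measure.smul_apply, smul_eq_mul,
    lintegral_finsetSum_measure, lintegral_smul_measure, lintegral_dirac]
  refine Finset.sum_congr rfl fun a _ => ?_
  rw [Measure.dirac_apply' _ hA, ENNReal.ofReal_mul (hw a)]
  by_cases h : a ∈ A <;> simp [h]

/-- The log-likelihood ratio of the Bernoulli product measures with densities `ρ + h` and `ρ`. -/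
noncomputable def logRatio {n : ℕ} (ρ : ℝ) (h : Site n → ℝ) (η : Config n) : ℝ :=
  ∑ x, if η x then Real.log (1 + h x / ρ) else Real.log (1 + -h x / (1 - ρ))

theorem bernoulliWeight_add {n : ℕ} {ρ : ℝ} (hρ : ρ ∈ Ioo (0 : ℝ) 1) {h : Site n → ℝ}
    (hh : ∀ x, ρ + h x ∈ Ioo (0 : ℝ) 1) (η : Config n) :
    bernoulliWeight (fun x => ρ + h x) η
      = bernoulliWeight (fun _ => ρ) η * Real.exp (logRatio ρ h η) := by
  have h0 := hρ.1
  have h1 : (0 : ℝ) < 1 - ρ := by linarith [hρ.2]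
  rw [logRatio, Real.exp_sum, bernoulliWeight, bernoulliWeight, ← Finset.prod_mul_distrib]
  refine Finset.prod_congr rfl fun x _ => ?_
  have hx := hh x
  unfold occ
  cases η x
  · have e : 1 + -h x / (1 - ρ) = (1 - (ρ + h x)) / (1 - ρ) := by field_simp; ring
    have hp : 0 < 1 + -h x / (1 - ρ) := by rw [e]; exact div_pos (by linarith [hx.2]) h1
    simp only [Bool.false_eq_true, if_false, Real.exp_log hp]
    rw [e]; field_simp; ring
  · have e : 1 + h x / ρ = (ρ + h x) / ρ := by field_simp
    have hp : 0 < 1 + h x / ρ := by rw [e]; exact div_pos hx.1 h0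
    simp only [if_true, Real.exp_log hp]
    rw [e]; field_simp; ring

theorem isProbabilityMeasure_bernoulli {n : ℕ} {u : Site n → ℝ} (hu : ∀ x, u x ∈ Ioo (0 : ℝ) 1) :
    IsProbabilityMeasure (ofWeight (bernoulliWeight u)) :=
  isProbabilityMeasure_ofWeight (fun η => (bernoulliWeight_pos hu η).le) (sum_bernoulliWeight u)

/-- The distance depends only on the law of the log-likelihood ratio under equilibrium, through a
bounded continuous function; weak convergence of that law is therefore enough. -/
theorem tvDist_bernoulli_eq {n : ℕ} {ρ : ℝ} (hρ : ρ ∈ Ioo (0 : ℝ) 1) {h : Site n → ℝ}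
    (hh : ∀ x, ρ + h x ∈ Ioo (0 : ℝ) 1) :
    tvDist (ofWeight (bernoulliWeight fun x => ρ + h x)) (ofWeight (bernoulliWeight fun _ => ρ))
      = ∫ y, max (1 - Real.exp y) 0
        ∂((ofWeight (bernoulliWeight fun _ : Site n => ρ)).map (logRatio ρ h)) := by
  have hw : ∀ η : Config n, 0 ≤ bernoulliWeight (fun _ => ρ) η := fun η =>
    (bernoulliWeight_pos (fun _ => hρ) η).le
  have e : ofWeight (bernoulliWeight fun x => ρ + h x)
      = (ofWeight (bernoulliWeight fun _ => ρ)).withDensity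
        fun η => ENNReal.ofReal (Real.exp (logRatio ρ h η)) := by
    rw [← ofWeight_mul_eq_withDensity hw]
    congr 1
    ext η
    exact bernoulliWeight_add hρ hh η
  have hP := isProbabilityMeasure_bernoulli (n := n) (u := fun _ => ρ) fun _ => hρ
  have hQ := isProbabilityMeasure_bernoulli hh
  rw [e] at hQ ⊢
  rw [tvDist_withDensity _ (Measurable.of_discrete) fun η => (Real.exp_pos _).le,
    integral_map (Measurable.of_discrete).aemeasurable]
  exact (Continuous.measurable (by fun_prop)).aestronglyMeasurable

theorem charFun_map_logRatio {n : ℕ} {ρ : ℝ} (hρ : ρ ∈ Ioo (0 : ℝ) 1) (h : Site n → ℝ) (s : ℝ) :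
    charFun ((ofWeight (bernoulliWeight fun _ : Site n => ρ)).map (logRatio ρ h)) s
      = ∏ x, logRatioCharFun ρ s (h x) := by
  rw [charFun_apply_real, integral_map (Measurable.of_discrete).aemeasurable
    (Continuous.aestronglyMeasurable (by fun_prop)),
    integral_ofWeight fun η => (bernoulliWeight_pos (fun _ => hρ) η).le]
  have hprod := sum_config_prod (R := ℂ) (n := n) fun x b =>
    ((if b then (ρ : ℂ) else 1 - ρ) * Complex.exp (((s * (if b then Real.log (1 + h x / ρ)
      else Real.log (1 + -h x / (1 - ρ))) : ℝ) : ℂ) * Complex.I))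
  refine Eq.trans ?_ (hprod.trans (Finset.prod_congr rfl fun x _ => by simp [logRatioCharFun]))
  refine Finset.sum_congr rfl fun η _ => ?_
  rw [Finset.prod_mul_distrib, ← Complex.exp_sum, Complex.real_smul, bernoulliWeight, logRatio]
  push_cast
  congr 1
  · refine Finset.prod_congr rfl fun x _ => ?_
    unfold occ
    cases η x <;> simp
  · congr 1
    rw [Finset.mul_sum, Finset.sum_mul]

/-- The relative density of two Gaussian measures of variance `1`. -/
theorem gaussianReal_eq_withDensity (m : ℝ) :
    gaussianReal m 1 = (gaussianReal 0 1).withDensity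
      fun z => ENNReal.ofReal (Real.exp (m * z - m ^ 2 / 2)) := by
  rw [gaussianReal_of_var_ne_zero _ one_ne_zero, gaussianReal_of_var_ne_zero _ one_ne_zero,
    ← withDensity_mul _ (measurable_gaussianPDF _ _) (by fun_prop)]
  congr 1
  ext z
  simp only [Pi.mul_apply, gaussianPDF]
  rw [← ENNReal.ofReal_mul (gaussianPDFReal_nonneg _ _ _)]
  congr 1
  simp only [gaussianPDFReal, NNReal.coe_one, mul_assoc, ← Real.exp_add]
  congr 2
  ring

/-- The log-likelihood ratio mz - m²/2 has this Gaussian law under N(0,1); the degenerate case m = 0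
is included. -/
theorem gaussianProfile_eq (m : ℝ) :
    gaussianProfile m = ∫ y, max (1 - Real.exp y) 0
      ∂(gaussianReal (-(m ^ 2 / 2)) (.mk (m ^ 2) (sq_nonneg m))) := by
  have hmap : (gaussianReal 0 1).map (fun z => m * z - m ^ 2 / 2)
      = gaussianReal (-(m ^ 2 / 2)) (.mk (m ^ 2) (sq_nonneg m)) := by
    have h := gaussianReal_map_sub_const (μ := m * 0) (v := .mk (m ^ 2) (sq_nonneg m) * 1)
      (m ^ 2 / 2)
    rw [← gaussianReal_map_const_mul m, Measure.map_map (by fun_prop) (by fun_prop)] at h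
    simpa [Function.comp_def] using h
  have hP : IsProbabilityMeasure ((gaussianReal 0 1).withDensity
      fun z => ENNReal.ofReal (Real.exp (m * z - m ^ 2 / 2))) := by
    rw [← gaussianReal_eq_withDensity]; infer_instance
  rw [gaussianProfile, gaussianReal_eq_withDensity m,
    tvDist_withDensity _ (by fun_prop) fun z => (Real.exp_pos _).le, ← hmap,
    integral_map (by fun_prop) (Continuous.aestronglyMeasurable (by fun_prop))]

/-- Asymptotics of the total variation distance of two nearby Bernoulli product measures. -/
theorem tendsto_tvDist_bernoulli {ρ : ℝ} (hρ : ρ ∈ Ioo (0 : ℝ) 1) {h : ∀ n : ℕ, Site n → ℝ}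
    {δ : ℕ → ℝ} (hδ : Tendsto δ atTop (𝓝 0)) (hh : ∀ᶠ n in atTop, ∀ x, |h n x| ≤ δ n) {m : ℝ}
    (hV : Tendsto (fun n => ∑ x, h n x ^ 2) atTop (𝓝 (m ^ 2 * (ρ * (1 - ρ))))) :
    Tendsto (fun n => tvDist (ofWeight (bernoulliWeight fun x => ρ + h n x))
      (ofWeight (bernoulliWeight fun _ : Site n => ρ))) atTop (𝓝 (gaussianProfile m)) := by
  have h1 : (0 : ℝ) < 1 - ρ := by linarith [hρ.2]
  have hP : ∀ n, IsProbabilityMeasure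
      ((ofWeight (bernoulliWeight fun _ : Site n => ρ)).map (logRatio ρ (h n))) := fun n => by
    have := isProbabilityMeasure_bernoulli (n := n) (u := fun _ => ρ) fun _ => hρ
    exact Measure.isProbabilityMeasure_map (Measurable.of_discrete).aemeasurable
  let P : ℕ → ProbabilityMeasure ℝ := fun n =>
    ⟨(ofWeight (bernoulliWeight fun _ : Site n => ρ)).map (logRatio ρ (h n)), hP n⟩
  let Q : ProbabilityMeasure ℝ :=
    ⟨gaussianReal (-(m ^ 2 / 2)) (.mk (m ^ 2) (sq_nonneg m)), inferInstance⟩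
  have hPQ : Tendsto P atTop (𝓝 Q) := by
    refine ProbabilityMeasure.tendsto_iff_tendsto_charFun.2 fun s => ?_
    have hlim := tendsto_prod_logRatioCharFun hρ s hδ hh hV
    have e : charFun (Q : Measure ℝ) s = Complex.exp ((-(s : ℂ) ^ 2 - Complex.I * s)
        / (2 * (ρ * (1 - ρ))) * ((m ^ 2 * (ρ * (1 - ρ)) : ℝ) : ℂ)) := by
      have c0 : (ρ : ℂ) ≠ 0 := by exact_mod_cast hρ.1.ne'
      have c1 : (1 : ℂ) - ρ ≠ 0 := by exact_mod_cast h1.ne'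
      change charFun (gaussianReal _ _) s = _
      rw [charFun_gaussianReal]
      congr 1
      push_cast
      field_simp
      ring
    rw [e]
    exact hlim.congr fun n => (charFun_map_logRatio hρ (h n) s).symm
  let φ : BoundedContinuousFunction ℝ ℝ := BoundedContinuousFunction.ofNormedAddCommGroup
    (fun y => max (1 - Real.exp y) 0) (by fun_prop) 1 fun y => by
      rw [Real.norm_eq_abs, abs_of_nonneg (le_max_right _ _)]
      exact max_le (by linarith [Real.exp_pos y]) zero_le_one
  have hφ := (ProbabilityMeasure.tendsto_iff_forall_integral_tendsto.1 hPQ) φ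
  have hQφ : ∫ y, φ y ∂(Q : Measure ℝ) = gaussianProfile m := (gaussianProfile_eq m).symm
  rw [hQφ] at hφ
  refine hφ.congr' ?_
  have hr : 0 < min ρ (1 - ρ) := lt_min hρ.1 h1
  filter_upwards [hh, hδ.eventually_lt_const hr] with n hn hδn
  refine (tvDist_bernoulli_eq hρ fun x => ?_).symm
  have h2 := (hn x).trans_lt hδn
  have h3 := abs_lt.1 h2
  have h4 := min_le_left ρ (1 - ρ)
  have h5 := min_le_right ρ (1 - ρ)
  exact ⟨by linarith [h3.1], by linarith [h3.2]⟩

/-! ### Comparison with the product measure and conclusion -/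

theorem tendsto_cutoffTime_atTop {ℓ : ℕ} (hℓ : 1 ≤ ℓ) (b : ℝ) :
    Tendsto (fun n : ℕ => cutoffTime ℓ n b) atTop atTop := by
  have hℓ' : (0 : ℝ) < ℓ := by exact_mod_cast hℓ
  exact tendsto_atTop_add_const_right _ _
    ((Real.tendsto_log_atTop.comp tendsto_natCast_atTop_atTop).const_mul_atTop (by positivity))

/-- The law of the process at time `t` is close to the Bernoulli product measure with the
profile solving the discrete heat equation. -/
theorem abs_distEq_sub_tvDist_le {n : ℕ} (hn : 3 ≤ n) {ρ : ℝ} {u₀ : ℝ → ℝ} (h0 : u₀ 0 = ρ)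
    (h1 : u₀ 1 = ρ) {K : ℝ} (hK : 0 ≤ K)
    (hf : ∀ x ∈ Icc (0 : ℝ) 1, ∀ y ∈ Icc (0 : ℝ) 1,
      |(u₀ x - ρ) - (u₀ y - ρ)| ≤ K * |x - y|)
    (hfb : ∀ x ∈ Icc (0 : ℝ) 1, |u₀ x - ρ| ≤ 1) {A t : ℝ} (hA : 0 < A) (ht : 0 ≤ t)
    (hu : ∀ x, profile n ρ (fun x => u₀ x - ρ) t x ∈ Ioo (0 : ℝ) 1)
    (hχ : ∀ x, (profile n ρ (fun x => u₀ x - ρ) t x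
      * (1 - profile n ρ (fun x => u₀ x - ρ) t x))⁻¹ ≤ A)
    (hAt : A ≤ 1 / (128 * (1 + (3 * K ^ 2 + 16 * Real.pi ^ 2))) * Real.exp (t / 8)) :
    |distEq n ρ u₀ t - tvDist (ofWeight (bernoulliWeight (profile n ρ (fun x => u₀ x - ρ) t)))
        (ofWeight (bernoulliWeight fun _ => ρ))|
      ≤ √(384 * (1 + (3 * K ^ 2 + 16 * Real.pi ^ 2)) * A * Real.exp (-(t / 8))) := by
  set f : ℝ → ℝ := fun x => u₀ x - ρ with hf_def
  have hf0 : f 0 = 0 := by simp [f, h0]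
  have hf1 : f 1 = 0 := by simp [f, h1]
  have hstart : profile n ρ f 0 = discretize n u₀ := by
    ext x
    rw [profile, heatSolution_zero_left hf0 hf1 (Finset.mem_Ico.1 x.2).2.le, discretize]
    simp [f]
  have hderiv := hasDerivAt_profile hn ρ f
  have hgrad : ∀ t, 0 ≤ t → ∀ e ∈ edges n,
      (n : ℝ) ^ 2 * (profile n ρ f t e.2 - profile n ρ f t e.1) ^ 2
        ≤ (3 * K ^ 2 + 16 * Real.pi ^ 2) * Real.exp (-t) := by
    intro t ht e he
    have h := sq_heatSolution_gradient_le (n := n) (by omega) hf0 hf1 hK hf hfb ht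
      (Finset.mem_Ico.1 e.1.2).2
    have he' : ((e.2 : ℕ) : ℝ) = (e.1 : ℕ) + 1 := by exact_mod_cast mem_edges.1 he
    simpa only [profile, he', add_sub_add_left_eq_sub] using h
  have hpi := Real.pi_pos
  have hcor := sum_correlation_sq_le (n := n) (by omega) (by positivity) hA hderiv hgrad ht hAt
  have hempty := correlation_empty hderiv t
  rw [hstart] at hcor hempty
  -- Parseval in the basis attached to the current profile: the inverse square norm of the monomial
  -- of S is at most A^|S|, the weight in the correlation bound.
  have hsq := (sum_abs_sub_bernoulliWeight_sq_le hu (lawWeight n ρ (discretize n u₀) t)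
    hempty).trans ((Finset.sum_le_sum fun S _ => ?_).trans hcor)
  · refine ((abs_tvDist_sub_tvDist_le _ _ _).trans (tvDist_ofWeight_le _ _)).trans ?_
    exact Real.le_sqrt_of_sq_le hsq
  · rw [div_eq_inv_mul, ← Finset.prod_inv_distrib]
    refine mul_le_mul_of_nonneg_right ?_ (sq_nonneg _)
    rw [← Finset.prod_const]
    exact Finset.prod_le_prod
      (fun x _ => (inv_pos.2 (mul_pos (hu x).1 (sub_pos.2 (hu x).2))).le) fun x _ => hχ x

end SSEP

open SSEP in
theorem theorem1 (ρ : ℝ) (hρ : ρ ∈ Ioo (0 : ℝ) 1) (u₀ : ℝ → ℝ)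
    (hdiff : DifferentiableOn ℝ u₀ (Icc 0 1))
    (hbdd : ∃ κ : ℝ, ∀ x ∈ Icc (0 : ℝ) 1, |derivWithin u₀ (Icc 0 1) x| ≤ κ)
    (h0 : u₀ 0 = ρ) (h1 : u₀ 1 = ρ)
    (hu : ∀ x ∈ Icc (0 : ℝ) 1, u₀ x ∈ Ioo (0 : ℝ) 1)
    (ℓ₀ : ℕ) (hℓ₀ : IsLeast {ℓ : ℕ | 1 ≤ ℓ ∧ SSEP.fourierCoeff ρ u₀ ℓ ≠ 0} ℓ₀) (b : ℝ) :
    Tendsto (fun n : ℕ => SSEP.distEq n ρ u₀ (SSEP.cutoffTime ℓ₀ n b)) atTop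
      (𝓝 (SSEP.gaussianProfile
        (|SSEP.fourierCoeff ρ u₀ ℓ₀| / √(ρ * (1 - ρ)) * Real.exp (-b)))) := by
  obtain ⟨κ, hκ⟩ := hbdd
  have hχ : 0 < ρ * (1 - ρ) := mul_pos hρ.1 (sub_pos.2 hρ.2)
  have hK : 0 ≤ κ := (abs_nonneg _).trans (hκ 0 (by simp))
  have hf : ∀ x ∈ Icc (0 : ℝ) 1, ∀ y ∈ Icc (0 : ℝ) 1,
      |(u₀ x - ρ) - (u₀ y - ρ)| ≤ κ * |x - y| := fun x hx y hy => by
    rw [sub_sub_sub_cancel_right]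
    exact (convex_Icc (0 : ℝ) 1).norm_image_sub_le_of_norm_derivWithin_le hdiff hκ hy hx
  have hfb : ∀ x ∈ Icc (0 : ℝ) 1, |u₀ x - ρ| ≤ 1 := fun x hx => by
    have := hu x hx
    rw [abs_le]
    constructor <;> linarith [this.1, this.2, hρ.1, hρ.2]
  have hℓ := hℓ₀.1.1
  have hc : ∀ ℓ < ℓ₀, √2 * ∫ x in (0 : ℝ)..1, (u₀ x - ρ) * Real.sin (Real.pi * ℓ * x) = 0 := by
    intro ℓ hlt
    rcases Nat.eq_zero_or_pos ℓ with rfl | hpos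
    · simp
    · by_contra h
      exact absurd (hℓ₀.2 ⟨hpos, h⟩) (not_le.2 hlt)
  obtain ⟨⟨δ, hδ, hbound⟩, hsum⟩ := tendsto_heatSolution_cutoffTime
    (f := fun x => u₀ x - ρ) hK hf hfb hℓ hc b (c := fourierCoeff ρ u₀ ℓ₀) rfl
  have hm : (fourierCoeff ρ u₀ ℓ₀ * Real.exp (-b)) ^ 2
      = (|fourierCoeff ρ u₀ ℓ₀| / √(ρ * (1 - ρ)) * Real.exp (-b)) ^ 2 * (ρ * (1 - ρ)) := by
    rw [mul_pow, mul_pow, div_pow, sq_abs, Real.sq_sqrt hχ.le, mul_right_comm, div_mul_cancel₀ _ hχ.ne']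
  rw [hm] at hsum
  have hlim := tendsto_tvDist_bernoulli hρ hδ
    (hbound.mono fun n hn (x : Site n) => hn (x : ℕ)) hsum
  have htime := tendsto_cutoffTime_atTop hℓ b
  have hexp : Tendsto (fun n : ℕ => cutoffTime ℓ₀ n b / 8) atTop atTop :=
    htime.atTop_div_const (by norm_num)
  have hpi := Real.pi_pos
  have herr : Tendsto (fun n : ℕ => √(384 * (1 + (3 * κ ^ 2 + 16 * Real.pi ^ 2))
      * (2 / (ρ * (1 - ρ))) * Real.exp (-(cutoffTime ℓ₀ n b / 8)))) atTop (𝓝 0) := by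
    have := ((Real.tendsto_exp_neg_atTop_nhds_zero.comp hexp).const_mul
      (384 * (1 + (3 * κ ^ 2 + 16 * Real.pi ^ 2)) * (2 / (ρ * (1 - ρ))))).sqrt
    simpa using this
  have hAt : ∀ᶠ n : ℕ in atTop, 2 / (ρ * (1 - ρ)) ≤
      1 / (128 * (1 + (3 * κ ^ 2 + 16 * Real.pi ^ 2))) * Real.exp (cutoffTime ℓ₀ n b / 8) :=
    ((Real.tendsto_exp_atTop.comp hexp).const_mul_atTop (by positivity)).eventually_ge_atTop _
  have hsmall : ∀ᶠ n : ℕ in atTop, δ n < ρ * (1 - ρ) / 4 :=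
    hδ.eventually_lt_const (by positivity)
  have hdiff : Tendsto (fun n : ℕ => distEq n ρ u₀ (cutoffTime ℓ₀ n b)
      - tvDist (ofWeight (bernoulliWeight fun x : Site n =>
          ρ + heatSolution n (fun x => u₀ x - ρ) (cutoffTime ℓ₀ n b) (x : ℕ)))
        (ofWeight (bernoulliWeight fun _ => ρ))) atTop (𝓝 0) := by
    refine squeeze_zero_norm' ?_ herr
    filter_upwards [hbound, hAt, hsmall, htime.eventually_ge_atTop 0, eventually_ge_atTop 3]
      with n hb hA hs ht hn
    -- A perturbation of ρ by at most ρ(1-ρ)/4 keeps at least half of the variance, which is why A =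
    -- 2/(ρ(1-ρ)).
    have hprof : ∀ x : Site n,
        ρ * (1 - ρ) / 2 ≤ profile n ρ (fun x => u₀ x - ρ) (cutoffTime ℓ₀ n b) x
            * (1 - profile n ρ (fun x => u₀ x - ρ) (cutoffTime ℓ₀ n b) x)
          ∧ profile n ρ (fun x => u₀ x - ρ) (cutoffTime ℓ₀ n b) x ∈ Ioo (0 : ℝ) 1 := by
      intro x
      have h := abs_le.1 ((hb (x : ℕ)).trans hs.le)
      rw [profile]
      set v := heatSolution n (fun x => u₀ x - ρ) (cutoffTime ℓ₀ n b) (x : ℕ)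
      obtain ⟨hρ0, hρ1⟩ := hρ
      refine ⟨?_, ?_, ?_⟩
      · have hρv : ρ * (1 - ρ) ≤ 1 := by nlinarith
        rcases le_total 0 v with hv | hv
        · linarith [mul_nonneg hv (by linarith : 0 ≤ 3 - 2 * ρ - v)]
        · linarith [mul_nonneg (neg_nonneg.2 hv) (by linarith : 0 ≤ 1 + 2 * ρ + v)]
      · nlinarith
      · nlinarith
    refine abs_distEq_sub_tvDist_le hn h0 h1 hK hf hfb (by positivity) ht
      (fun x => (hprof x).2) (fun x => ?_) hA
    rw [inv_le_comm₀ (mul_pos (hprof x).2.1 (sub_pos.2 (hprof x).2.2)) (by positivity), inv_div]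
    exact (hprof x).1
  simpa using hdiff.add hlim
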